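/- Work in the language of second-order arithmetic and let $\mathsf{RCA}_0$ be the usual base theory (basic axioms for $0,1,+,\cdot,<$, induction for $\Sigma^0_1$ formulas, comprehension for $\Delta^0_1$ formulas). A quasi-order $(Q,\le)$, given by sets $Q\subseteq\mathbb N$ and ${\le}\subseteq Q\times Q$ with $\le$ reflexive and transitive, is a well quasi-order (wqo) if every infinite sequence $(q_k)_k$ in $Q$ has indices $i<j$ with $q_i\le q_j$. A set $X$ gives the relation $x\le_X y:\Leftrightarrow\langle x,y\rangle\in X$; it is a well-order, $\mathrm{WO}(X)$, if $\le_X$ is a linear order of its field and transfinite induction along its strict part holds for every set $Y$. Consider - $\mathrm{WQP}(\times^\omega)$: for every $n$ and every quasi-order $Q$, if $Q$ is a wqo, then the $n$-fold product $Q\times\cdots\times Q$ with the componentwise order is a wqo; - $\mathrm{WOP}(X\mapsto X^\omega)$: for every $X$, if $X$ is a well-order, then so is $X^\omega$. Here $X^\omega$ is the (notation system for the) ordinal power $\sup_n X^n$: its elements are the finite sequences $\langle x_0,\dots,x_{l-1}\rangle$ of elements of $X$ with $x_0$ not the least element of $X$ (if $l>0$), read as base-$X$ expansions $X^{l-1}x_0+\cdots+X^0x_{l-1}$;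 shorter sequences are smaller, and sequences of equal length are compared lexicographically. Then $\mathsf{RCA}_0\vdash \mathrm{WQP}(\times^\omega)\rightarrow\mathrm{WOP}(X\mapsto X^\omega)$, whereas $\mathsf{RCA}_0\nvdash \mathrm{WOP}(X\mapsto X^\omega)\rightarrow\mathrm{WQP}(\times^\omega)$. -/

import Mathlib

namespace SOA

/-! ### The language of second-order arithmetic

Two sorts (numbers and sets), symbols `0, 1, +, ·, =, <, ∈`. Variables of each sort are de Bruijn
indices: `allN` binds number variable `0`, `allS` binds set variable `0`. -/

inductive Tm : Type
  | var : ℕ → Tm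
  | zero : Tm
  | one : Tm
  | add : Tm → Tm → Tm
  | mul : Tm → Tm → Tm

instance : Zero Tm := ⟨Tm.zero⟩
instance : One Tm := ⟨Tm.one⟩
instance : Add Tm := ⟨Tm.add⟩
instance : Mul Tm := ⟨Tm.mul⟩

inductive Fm : Type
  | eq : Tm → Tm → Fm
  | lt : Tm → Tm → Fm
  | mem : Tm → ℕ → Fm
  | fal : Fm
  | imp : Fm → Fm → Fm
  | allN : Fm → Fm
  | allS : Fm → Fm

def Tm.subst (σ : ℕ → Tm) : Tm → Tm
  | .var i => σ i
  | .zero => .zero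
  | .one => .one
  | .add s t => .add (s.subst σ) (t.subst σ)
  | .mul s t => .mul (s.subst σ) (t.subst σ)

def Tm.lift (t : Tm) : Tm := t.subst (fun i => .var (i + 1))

/-- The substitution `σ` pushed under a number quantifier. -/
def upN (σ : ℕ → Tm) : ℕ → Tm
  | 0 => .var 0
  | i + 1 => (σ i).lift

/-- The renaming `τ` pushed under a set quantifier. -/
def upS (τ : ℕ → ℕ) : ℕ → ℕ
  | 0 => 0
  | i + 1 => τ i + 1

namespace Fm

/-- Simultaneous capture-avoiding substitution of terms `σ` for the free number variables and
of set variables `τ` for the free set variables. -/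
def subst : (ℕ → Tm) → (ℕ → ℕ) → Fm → Fm
  | σ, _, .eq s t => .eq (s.subst σ) (t.subst σ)
  | σ, _, .lt s t => .lt (s.subst σ) (t.subst σ)
  | σ, τ, .mem t X => .mem (t.subst σ) (τ X)
  | _, _, .fal => .fal
  | σ, τ, .imp φ ψ => .imp (subst σ τ φ) (subst σ τ ψ)
  | σ, τ, .allN φ => .allN (subst (upN σ) τ φ)
  | σ, τ, .allS φ => .allS (subst σ (upS τ) φ)

/-- Make room for a new number variable `0`. -/
def liftN (φ : Fm) : Fm := φ.subst (fun i => .var (i + 1)) id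

/-- Make room for a new set variable `0`. -/
def liftS (φ : Fm) : Fm := φ.subst .var (fun i => i + 1)

/-- `φ(t)`: replace number variable `0` by `t` and remove it. -/
def instN (φ : Fm) (t : Tm) : Fm :=
  φ.subst (fun i => match i with | 0 => t | j + 1 => .var j) id

/-- `φ(X)`: replace set variable `0` by `X` and remove it. -/
def instS (φ : Fm) (X : ℕ) : Fm :=
  φ.subst .var (fun i => match i with | 0 => X | j + 1 => j)

/-- `φ(n + 1)`, where `n` is number variable `0`, which is kept. -/
def atSucc (φ : Fm) : Fm :=
  φ.subst (fun i => match i with | 0 => .var 0 + 1 | j + 1 => .var (j + 1)) id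

def neg (φ : Fm) : Fm := .imp φ .fal
def and (φ ψ : Fm) : Fm := neg (.imp φ (neg ψ))
def or (φ ψ : Fm) : Fm := .imp (neg φ) ψ
def iff (φ ψ : Fm) : Fm := and (.imp φ ψ) (.imp ψ φ)
def exN (φ : Fm) : Fm := neg (.allN (neg φ))
def exS (φ : Fm) : Fm := neg (.allS (neg φ))

end Fm

/-! ### Provability -/

/-- Classical two-sorted natural deduction with equality: `Deriv T Γ φ` says that `φ` is derivable
from the axioms `T` and the finite list `Γ` of open assumptions. Free variables of axioms are read
universally; only the open assumptions restrict generalization. -/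
inductive Deriv (T : Set Fm) : List Fm → Fm → Prop
  | ax {Γ : List Fm} {φ : Fm} : φ ∈ T → Deriv T Γ φ
  | hyp {Γ : List Fm} {φ : Fm} : φ ∈ Γ → Deriv T Γ φ
  | impI {Γ : List Fm} {φ ψ : Fm} : Deriv T (φ :: Γ) ψ → Deriv T Γ (.imp φ ψ)
  | impE {Γ : List Fm} {φ ψ : Fm} : Deriv T Γ (.imp φ ψ) → Deriv T Γ φ → Deriv T Γ ψ
  | raa {Γ : List Fm} {φ : Fm} : Deriv T (φ.neg :: Γ) .fal → Deriv T Γ φ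
  | allNI {Γ : List Fm} {φ : Fm} : Deriv T (Γ.map Fm.liftN) φ → Deriv T Γ (.allN φ)
  | allNE {Γ : List Fm} {φ : Fm} (t : Tm) : Deriv T Γ (.allN φ) → Deriv T Γ (φ.instN t)
  | allSI {Γ : List Fm} {φ : Fm} : Deriv T (Γ.map Fm.liftS) φ → Deriv T Γ (.allS φ)
  | allSE {Γ : List Fm} {φ : Fm} (X : ℕ) : Deriv T Γ (.allS φ) → Deriv T Γ (φ.instS X)
  | eqI {Γ : List Fm} (t : Tm) : Deriv T Γ (.eq t t)
  | eqE {Γ : List Fm} (φ : Fm) {s t : Tm} :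
      Deriv T Γ (.eq s t) → Deriv T Γ (φ.instN s) → Deriv T Γ (φ.instN t)

/-- `T ⊢ φ`. -/
def Provable (T : Set Fm) (φ : Fm) : Prop := Deriv T [] φ

/-! ### The theory `RCA₀` -/

/-- `Σ⁰₀` formulas: all number quantifiers are bounded, `∀ x < t`, with `x` not in `t`
(`∃ x < t` is `¬ ∀ x < t, ¬`), and there are no set quantifiers; set parameters are allowed. -/
inductive IsSigma00 : Fm → Prop
  | eq (s t : Tm) : IsSigma00 (.eq s t)
  | lt (s t : Tm) : IsSigma00 (.lt s t)
  | mem (t : Tm) (X : ℕ) : IsSigma00 (.mem t X)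
  | fal : IsSigma00 .fal
  | imp {φ ψ : Fm} : IsSigma00 φ → IsSigma00 ψ → IsSigma00 (.imp φ ψ)
  | ball (t : Tm) {φ : Fm} : IsSigma00 φ → IsSigma00 (.allN (.imp (.lt (.var 0) t.lift) φ))

def IsSigma01 (φ : Fm) : Prop := ∃ θ, IsSigma00 θ ∧ φ = θ.exN

def IsPi01 (φ : Fm) : Prop := ∃ θ, IsSigma00 θ ∧ φ = .allN θ

/-- The axioms of `RCA₀`: basic axioms, induction for `Σ⁰₁` formulas, comprehension for `Δ⁰₁`
formulas, both with arbitrary number and set parameters (further free variables). -/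
inductive RCA₀ : Set Fm
  | succ_ne_zero : RCA₀ (Fm.neg (.eq (.var 0 + 1) 0))
  | succ_inj : RCA₀ (.imp (.eq (.var 0 + 1) (.var 1 + 1)) (.eq (.var 0) (.var 1)))
  | add_zero : RCA₀ (.eq (.var 0 + 0) (.var 0))
  | add_succ : RCA₀ (.eq (.var 0 + (.var 1 + 1)) (.var 0 + .var 1 + 1))
  | mul_zero : RCA₀ (.eq (.var 0 * 0) 0)
  | mul_succ : RCA₀ (.eq (.var 0 * (.var 1 + 1)) (.var 0 * .var 1 + .var 0))
  | not_lt_zero : RCA₀ (Fm.neg (.lt (.var 0) 0))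
  | lt_succ : RCA₀ (Fm.iff (.lt (.var 0) (.var 1 + 1))
      (Fm.or (.lt (.var 0) (.var 1)) (.eq (.var 0) (.var 1))))
  | ind (φ : Fm) : IsSigma01 φ →
      RCA₀ (.imp (Fm.and (φ.instN 0) (.allN (.imp φ φ.atSucc))) (.allN φ))
  | comp (φ ψ : Fm) : IsSigma01 φ → IsPi01 ψ →
      RCA₀ (.imp (.allN (Fm.iff φ ψ)) (Fm.exS (.allN (Fm.iff (.mem (.var 0) 0) φ.liftS))))

/-! ### Writing formulas with Lean-bound variables

A concrete formula is written as a function of the number `d` of enclosing number quantifiers and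
the number `e` of enclosing set quantifiers, a term as a function of `d`, a set variable as a
function of `e`. The variable bound at depth `d` has de Bruijn index `d' - (d + 1)` at
depth `d'`. The formula itself is the value at `d = e = 0`. -/

abbrev PTm : Type := ℕ → Tm
abbrev PSet : Type := ℕ → ℕ
abbrev PFm : Type := ℕ → ℕ → Fm

def all (f : PTm → PFm) : PFm :=
  fun d e => .allN (f (fun d' => .var (d' - (d + 1))) (d + 1) e)
def ex (f : PTm → PFm) : PFm :=
  fun d e => .exN (f (fun d' => .var (d' - (d + 1))) (d + 1) e)
def allSet (f : PSet → PFm) : PFm :=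
  fun d e => .allS (f (fun e' => e' - (e + 1)) d (e + 1))

def eqF (s t : PTm) : PFm := fun d _ => .eq (s d) (t d)
def ltF (s t : PTm) : PFm := fun d _ => .lt (s d) (t d)
def memF (t : PTm) (X : PSet) : PFm := fun d e => .mem (t d) (X e)
def notF (φ : PFm) : PFm := fun d e => .neg (φ d e)
def impF (φ ψ : PFm) : PFm := fun d e => .imp (φ d e) (ψ d e)
def andF (φ ψ : PFm) : PFm := fun d e => .and (φ d e) (ψ d e)
def orF (φ ψ : PFm) : PFm := fun d e => .or (φ d e) (ψ d e)
def iffF (φ ψ : PFm) : PFm := fun d e => .iff (φ d e) (ψ d e)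

infix:50 " ≐ " => eqF
infix:50 " ⋖' " => ltF
infix:50 " ∈' " => memF
infixr:35 " ⋏ " => andF
infixr:30 " ⋎ " => orF
infixr:25 " ➝ " => impF
infix:20 " ⬌ " => iffF

/-- The pairing `⟨s, t⟩ = (s + t)² + s`. -/
def pair (s t : PTm) : PTm := (s + t) * (s + t) + s

/-! ### Orders

An order is given by formulas `D` (its field) and `L` (the relation `≤`). -/

/-- `L` is a reflexive and transitive relation on `D`. -/
def quasiOrder (D : PTm → PFm) (L : PTm → PTm → PFm) : PFm :=
  (all fun x => all fun y => L x y ➝ D x ⋏ D y) ⋏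
  (all fun x => D x ➝ L x x) ⋏
  (all fun x => all fun y => all fun z => L x y ➝ L y z ➝ L x z)

/-- `F` is (the graph of) an infinite sequence of elements of `D`. -/
def seqIn (F : PSet) (D : PTm → PFm) : PFm :=
  (all fun i => ex fun x => D x ⋏ pair i x ∈' F) ⋏
  (all fun i => all fun x => all fun y => pair i x ∈' F ➝ pair i y ∈' F ➝ x ≐ y)

/-- Well quasi-order: every infinite sequence has `i < j` with `i`-th entry `≤` `j`-th entry. -/
def wqo (D : PTm → PFm) (L : PTm → PTm → PFm) : PFm :=
  quasiOrder D L ⋏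
  allSet fun F => seqIn F D ➝
    ex fun i => ex fun j => ex fun x => ex fun y =>
      i ⋖' j ⋏ pair i x ∈' F ⋏ pair j y ∈' F ⋏ L x y

def linearOrder (D : PTm → PFm) (L : PTm → PTm → PFm) : PFm :=
  quasiOrder D L ⋏
  (all fun x => all fun y => L x y ➝ L y x ➝ x ≐ y) ⋏
  (all fun x => all fun y => D x ➝ D y ➝ L x y ⋎ L y x)

/-- The strict part of `L`. -/
def strict (L : PTm → PTm → PFm) (x y : PTm) : PFm := L x y ⋏ notF (x ≐ y)

/-- Transfinite induction along `L` holds for every set `Y`. -/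
def wellFounded (L : PTm → PTm → PFm) : PFm :=
  allSet fun Y =>
    (all fun x => (all fun y => strict L y x ➝ y ∈' Y) ➝ x ∈' Y) ➝ all fun x => x ∈' Y

def wellOrder (D : PTm → PFm) (L : PTm → PTm → PFm) : PFm :=
  wellFounded L ⋏ linearOrder D L

/-! ### Finite sequences -/

/-- `x` belongs to the finite set coded by `c = ⟨k, ⟨m, n⟩⟩`: `x < k` and `m(x+1)+1` divides
`n`. -/
def inFin (x c : PTm) : PFm :=
  ex fun k => ex fun m => ex fun n => c ≐ pair k (pair m n) ⋏ x ⋖' k ⋏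
    ex fun q => n ≐ q * (m * (x + 1) + 1)

/-- `c` is the least code of the finite set it codes. -/
def isCode (c : PTm) : PFm :=
  all fun c' => c' ⋖' c ➝ notF (all fun x => inFin x c' ⬌ inFin x c)

/-- The `i`-th entry of the finite sequence coded by `s` is `x`. -/
def entry (s i x : PTm) : PFm := inFin (pair i x) s

/-- `s` is the code of a finite sequence of length `l`, that is, of (the graph of) a function
on `{i | i < l}`. -/
def isSeq (s l : PTm) : PFm :=
  isCode s ⋏
  (all fun z => inFin z s ➝ ex fun i => ex fun x => i ⋖' l ⋏ z ≐ pair i x) ⋏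
  (all fun i => i ⋖' l ➝ ex fun x => entry s i x) ⋏
  (all fun i => all fun x => all fun y => entry s i x ➝ entry s i y ➝ x ≐ y)

/-! ### The two principles -/

/-- `s ∈ Dⁿ`. -/
def powDom (n : PTm) (D : PTm → PFm) (s : PTm) : PFm :=
  isSeq s n ⋏ all fun i => all fun x => entry s i x ➝ D x

/-- The product (componentwise) order on `Dⁿ`. -/
def powLe (n : PTm) (D : PTm → PFm) (L : PTm → PTm → PFm) (s t : PTm) : PFm :=
  powDom n D s ⋏ powDom n D t ⋏
  all fun i => all fun x => all fun y => entry s i x ➝ entry t i y ➝ L x y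

/-- `∀ n ∀ (Q, R)`: if `(Q, R)` is a wqo, then so is the `n`-fold product `Q × ⋯ × Q`. -/
def WQPprodPF : PFm :=
  all fun n => allSet fun Q => allSet fun R =>
    wqo (fun x => x ∈' Q) (fun x y => pair x y ∈' R) ➝
      wqo (powDom n fun x => x ∈' Q)
        (powLe n (fun x => x ∈' Q) (fun x y => pair x y ∈' R))

/-- Elements of `X^ω`: finite sequences `⟨x₀, …, x_{l-1}⟩` from the field `D` whose first entry, if
there is one, is not the least element of `D` (which is the coefficient `0`). Such a sequence stands
for the base-`X` expansion `X^(l-1)·x₀ + ⋯ + X^0·x_{l-1}`. -/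
def expDom (D : PTm → PFm) (L : PTm → PTm → PFm) (s : PTm) : PFm :=
  (ex fun l => isSeq s l) ⋏
  (all fun i => all fun x => entry s i x ➝ D x) ⋏
  (all fun x => entry s 0 x ➝ ex fun y => strict L y x)

/-- Shorter expansions are smaller; expansions of equal length are compared at the first place
where they differ. -/
def expLt (L : PTm → PTm → PFm) (s t : PTm) : PFm :=
  ex fun k => ex fun l => isSeq s k ⋏ isSeq t l ⋏
    (k ⋖' l ⋎
      (k ≐ l ⋏ ex fun i => ex fun x => ex fun y =>
        entry s i x ⋏ entry t i y ⋏ strict L x y ⋏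
        all fun j => j ⋖' i ➝ all fun z => entry s j z ⬌ entry t j z))

/-- The order of `X^ω`. -/
def expLe (D : PTm → PFm) (L : PTm → PTm → PFm) (s t : PTm) : PFm :=
  expDom D L s ⋏ expDom D L t ⋏ (s ≐ t ⋎ expLt L s t)

/-- `∀ X`: if `X` is a well-order (where `x ≤ y` means `⟨x, y⟩ ∈ X` and the field of `X` is
`{x | ⟨x, x⟩ ∈ X}`), then so is `X^ω`. -/
def WOPexpPF : PFm :=
  allSet fun X =>
    wellOrder (fun x => pair x x ∈' X) (fun x y => pair x y ∈' X) ➝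
      wellOrder (expDom (fun x => pair x x ∈' X) (fun x y => pair x y ∈' X))
        (expLe (fun x => pair x x ∈' X) (fun x y => pair x y ∈' X))

def WQPprod : Fm := WQPprodPF 0 0
def WOPexp : Fm := WOPexpPF 0 0

end SOA

/-!
Provability is treated through models. The calculus is sound (`Deriv.sound`) and complete
(`provable_of_models`, a Henkin construction with terms modulo provable equality as numbers and set
variables as sets), so the first claim is an argument inside an arbitrary structure with the basic
axioms, `Σ⁰₁` induction and `Δ⁰₁` comprehension, and the second one asks for a single such structure.

**Products give powers.** Let `X` be a well-order of the structure. A failure of transfinite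
induction along `X^ω`, started at an element of minimal length outside of the given set, can be
iterated to a descending sequence whose terms have a constant length `l` (`exists_iteration`,
`WellOrd.exp_of_noDesc`). At the first place where two tuples differ, the smaller one has the smaller
entry, so no term of a lexicographically descending sequence is below a later one componentwise: the
sequence is bad for the `l`-fold product (`noDesc_of_wqo`). On the other hand, `X` is a well
quasi-order (`WellOrd.wqo`), since a bad sequence in a linear order descends; the point that needs
care in `RCA₀` is that transfinite induction for sets excludes descending sequences
(`WellOrd.not_descending`).

**Powers do not give products.** In every structure whose numbers are the standard ones, the
induction for arbitrary predicates shows that the entries of a descending sequence of `l`-tuples from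
a well-order become constant one place after the other, so the principle for powers holds
(`sat_WOPexp_of_induction`). The product principle fails in the structure of all sets that are `Δ⁰₁`
in a suitable order. This order is the disjoint union of the order `x = y ∨ f x < f y` of the
numbers, for a sequence `f` of rationals, and its reverse. The pairs formed by the two copies of `k`, for
`k = 0, 1, …`, are a bad sequence in the square of the order, since a good pair `i < j` would demand
both `f i < f j` and `f j < f i` (`not_wqo_square`). The sequence `f` is generic
(`exists_generic_order`): for every unbounded set `P` that is `Σ⁰₁` in the order, some `n ∈ P` has
`f n` below almost all values of `f`, and some `n ∈ P` has `f n` above almost all of them. This can be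
achieved for one `P` after the other because membership of `n` in `P` depends on finitely many values
of `f` (`IsSigma00.exists_use`), while all later values may still be kept on either side of `f n`.
Applied to the set of indices hit by an infinite sequence of the structure in one of the two copies,
genericity yields a good pair, so the order is a well quasi-order of the structure (`wqo_generic`).
-/

namespace SOA

/-! ### Substitution -/

/-- The sequence `a, f 0, f 1, …`. -/
def scons {α : Type} (a : α) (f : ℕ → α) : ℕ → α
  | 0 => a
  | i + 1 => f i

@[simp] theorem scons_zero {α : Type} (a : α) (f : ℕ → α) : scons a f 0 = a := rfl

@[simp] theorem scons_succ {α : Type} (a : α) (f : ℕ → α) (i : ℕ) :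
    scons a f (i + 1) = f i := rfl

namespace Tm

theorem subst_subst (σ σ' : ℕ → Tm) (t : Tm) :
    (t.subst σ).subst σ' = t.subst (fun i => (σ i).subst σ') := by
  induction t <;> simp_all [Tm.subst]

theorem subst_var (t : Tm) : t.subst .var = t := by
  induction t <;> simp_all [Tm.subst]

theorem lift_subst_upN (σ : ℕ → Tm) (t : Tm) : t.lift.subst (upN σ) = (t.subst σ).lift := by
  simp only [Tm.lift, subst_subst]; rfl

/-- All variables of `t` are below `t.bd`. -/
def bd : Tm → ℕ
  | .var i => i + 1
  | .zero => 0
  | .one => 0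
  | .add s t => max s.bd t.bd
  | .mul s t => max s.bd t.bd

theorem subst_congr {σ σ' : ℕ → Tm} (t : Tm) (h : ∀ i < t.bd, σ i = σ' i) :
    t.subst σ = t.subst σ' := by
  induction t with
  | var i => exact h i (Nat.lt_succ_self i)
  | zero => rfl
  | one => rfl
  | add s t hs ht | mul s t hs ht =>
    simp only [Tm.subst, hs fun i hi => h i (lt_of_lt_of_le hi (le_max_left _ _)),
      ht fun i hi => h i (lt_of_lt_of_le hi (le_max_right _ _))]

end Tm

theorem upN_var : upN .var = .var := by
  funext i; cases i <;> rfl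

theorem upS_id : upS id = id := by
  funext i; cases i <;> rfl

theorem upN_comp (σ σ' : ℕ → Tm) :
    (fun i => (upN σ i).subst (upN σ')) = upN (fun i => (σ i).subst σ') := by
  funext i
  cases i with
  | zero => rfl
  | succ i => exact Tm.lift_subst_upN σ' (σ i)

theorem upS_comp (τ τ' : ℕ → ℕ) : upS τ' ∘ upS τ = upS (τ' ∘ τ) := by
  funext i; cases i <;> rfl

namespace Fm

theorem subst_subst (φ : Fm) : ∀ (σ σ' : ℕ → Tm) (τ τ' : ℕ → ℕ),
    (φ.subst σ τ).subst σ' τ' = φ.subst (fun i => (σ i).subst σ') (τ' ∘ τ) := by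
  induction φ with
  | allN φ ih => intro σ σ' τ τ'; simp only [Fm.subst, ih, upN_comp]
  | allS φ ih => intro σ σ' τ τ'; simp only [Fm.subst, ih, upS_comp]
  | _ => intros; simp_all [Fm.subst, Tm.subst_subst]

theorem subst_var (φ : Fm) : φ.subst .var id = φ := by
  induction φ <;> simp_all [Fm.subst, Tm.subst_var, upN_var, upS_id]

theorem instN_eq (φ : Fm) (t : Tm) : φ.instN t = φ.subst (scons t .var) id := by
  unfold instN; congr 1

theorem instS_eq (φ : Fm) (X : ℕ) : φ.instS X = φ.subst .var (scons X id) := by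
  unfold instS; congr 1

theorem atSucc_eq (φ : Fm) :
    φ.atSucc = φ.subst (scons (.var 0 + 1) fun j => .var (j + 1)) id := by
  unfold atSucc; congr 1

theorem subst_instN (φ : Fm) (σ : ℕ → Tm) (τ : ℕ → ℕ) (t : Tm) :
    (φ.subst (upN σ) τ).instN t = φ.subst (scons t σ) τ := by
  rw [instN_eq, subst_subst]
  congr 1
  funext i
  cases i with
  | zero => rfl
  | succ i =>
    simp only [upN, Tm.lift, Tm.subst_subst, scons_succ]
    exact Tm.subst_var _

theorem subst_instS (φ : Fm) (σ : ℕ → Tm) (τ : ℕ → ℕ) (X : ℕ) :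
    (φ.subst σ (upS τ)).instS X = φ.subst σ (scons X τ) := by
  rw [instS_eq, subst_subst]
  congr 1
  · funext i; exact Tm.subst_var _
  · funext i; cases i <;> rfl

theorem instN_subst (φ : Fm) (σ : ℕ → Tm) (τ : ℕ → ℕ) (t : Tm) :
    (φ.instN t).subst σ τ = (φ.subst (upN σ) τ).instN (t.subst σ) := by
  rw [subst_instN, instN_eq, subst_subst]
  congr 1
  funext i; cases i <;> rfl

theorem instS_subst (φ : Fm) (σ : ℕ → Tm) (τ : ℕ → ℕ) (X : ℕ) :
    (φ.instS X).subst σ τ = (φ.subst σ (upS τ)).instS (τ X) := by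
  rw [subst_instS, instS_eq, subst_subst]
  congr 1
  funext i; cases i <;> rfl

theorem liftN_subst (φ : Fm) (σ : ℕ → Tm) (τ : ℕ → ℕ) :
    φ.liftN.subst (upN σ) τ = (φ.subst σ τ).liftN := by
  simp only [liftN, subst_subst]; rfl

theorem liftS_subst (φ : Fm) (σ : ℕ → Tm) (τ : ℕ → ℕ) :
    φ.liftS.subst σ (upS τ) = (φ.subst σ τ).liftS := by
  simp only [liftS, subst_subst]
  congr 1
  funext i; exact (Tm.subst_var _).symm

/-- All free number variables of `φ` are below `φ.bdN`. -/
def bdN : Fm → ℕ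
  | .eq s t => max s.bd t.bd
  | .lt s t => max s.bd t.bd
  | .mem t _ => t.bd
  | .fal => 0
  | .imp φ ψ => max φ.bdN ψ.bdN
  | .allN φ => φ.bdN - 1
  | .allS φ => φ.bdN

/-- All free set variables of `φ` are below `φ.bdS`. -/
def bdS : Fm → ℕ
  | .eq _ _ => 0
  | .lt _ _ => 0
  | .mem _ X => X + 1
  | .fal => 0
  | .imp φ ψ => max φ.bdS ψ.bdS
  | .allN φ => φ.bdS
  | .allS φ => φ.bdS - 1

theorem subst_congr (φ : Fm) : ∀ {σ σ' : ℕ → Tm} {τ τ' : ℕ → ℕ},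
    (∀ i < φ.bdN, σ i = σ' i) → (∀ i < φ.bdS, τ i = τ' i) → φ.subst σ τ = φ.subst σ' τ' := by
  induction φ with
  | eq s t | lt s t =>
    intro σ σ' τ τ' h _
    simp only [Fm.subst, Tm.subst_congr s fun i hi => h i (lt_of_lt_of_le hi (le_max_left _ _)),
      Tm.subst_congr t fun i hi => h i (lt_of_lt_of_le hi (le_max_right _ _))]
  | mem t X =>
    intro σ σ' τ τ' h h'
    simp only [Fm.subst, Tm.subst_congr t h, h' X (Nat.lt_succ_self X)]
  | fal => intros; rfl
  | imp φ ψ hφ hψ =>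
    intro σ σ' τ τ' h h'
    simp only [Fm.subst]
    rw [hφ (fun i hi => h i (lt_of_lt_of_le hi (le_max_left _ _)))
      (fun i hi => h' i (lt_of_lt_of_le hi (le_max_left _ _))),
      hψ (fun i hi => h i (lt_of_lt_of_le hi (le_max_right _ _)))
      (fun i hi => h' i (lt_of_lt_of_le hi (le_max_right _ _)))]
  | allN φ ih =>
    intro σ σ' τ τ' h h'
    simp only [Fm.subst]
    rw [ih _ h']
    intro i hi
    cases i with
    | zero => rfl
    | succ i => simp only [upN, h i (Nat.lt_sub_of_add_lt hi)]
  | allS φ ih =>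
    intro σ σ' τ τ' h h'
    simp only [Fm.subst]
    rw [ih h]
    intro i hi
    cases i with
    | zero => rfl
    | succ i => simp only [upS, h' i (Nat.lt_sub_of_add_lt hi)]

end Fm

/-! ### Structures and satisfaction -/

/-- A structure for the two-sorted language: numbers `N` with the arithmetic symbols, and sets,
given as an arbitrary type `S` of names with a membership relation. -/
structure Str where
  N : Type
  S : Type
  zero : N
  one : N
  add : N → N → N
  mul : N → N → N
  lt : N → N → Prop
  mem : N → S → Prop

/-- The value of a term. -/
def Tm.eval (A : Str) (v : ℕ → A.N) : Tm → A.N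
  | .var i => v i
  | .zero => A.zero
  | .one => A.one
  | .add s t => A.add (s.eval A v) (t.eval A v)
  | .mul s t => A.mul (s.eval A v) (t.eval A v)

/-- Satisfaction of a formula under valuations of the number and the set variables. -/
def Fm.sat (A : Str) : Fm → (ℕ → A.N) → (ℕ → A.S) → Prop
  | .eq s t, v, _ => s.eval A v = t.eval A v
  | .lt s t, v, _ => A.lt (s.eval A v) (t.eval A v)
  | .mem t X, v, ρ => A.mem (t.eval A v) (ρ X)
  | .fal, _, _ => False
  | .imp φ ψ, v, ρ => φ.sat A v ρ → ψ.sat A v ρ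
  | .allN φ, v, ρ => ∀ x, φ.sat A (scons x v) ρ
  | .allS φ, v, ρ => ∀ X, φ.sat A v (scons X ρ)

theorem Tm.eval_subst (A : Str) (v : ℕ → A.N) (σ : ℕ → Tm) (t : Tm) :
    (t.subst σ).eval A v = t.eval A (fun i => (σ i).eval A v) := by
  induction t <;> simp_all [Tm.subst, Tm.eval]

theorem Tm.eval_lift (A : Str) (x : A.N) (v : ℕ → A.N) (t : Tm) :
    t.lift.eval A (scons x v) = t.eval A v := by
  rw [Tm.lift, Tm.eval_subst]; rfl

theorem Fm.sat_subst (A : Str) (φ : Fm) : ∀ (v : ℕ → A.N) (ρ : ℕ → A.S) (σ : ℕ → Tm) (τ : ℕ → ℕ),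
    (φ.subst σ τ).sat A v ρ ↔ φ.sat A (fun i => (σ i).eval A v) (ρ ∘ τ) := by
  induction φ with
  | allN φ ih =>
    intro v ρ σ τ
    refine forall_congr' fun x => (ih _ _ _ _).trans ?_
    have : (fun i => (upN σ i).eval A (scons x v)) = scons x fun i => (σ i).eval A v := by
      funext i
      cases i with
      | zero => rfl
      | succ i => exact Tm.eval_lift A x v (σ i)
    rw [this]
  | allS φ ih =>
    intro v ρ σ τ
    refine forall_congr' fun X => (ih _ _ _ _).trans ?_
    have : scons X ρ ∘ upS τ = scons X (ρ ∘ τ) := by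
      funext i; cases i <;> rfl
    rw [this]
  | _ => intros; simp_all [Fm.subst, Fm.sat, Tm.eval_subst]

section
variable {A : Str} {v : ℕ → A.N} {ρ : ℕ → A.S} {φ ψ : Fm}

theorem Fm.sat_instN {t : Tm} : (φ.instN t).sat A v ρ ↔ φ.sat A (scons (t.eval A v) v) ρ := by
  rw [Fm.instN_eq, Fm.sat_subst]
  have : (fun i => (scons t Tm.var i).eval A v) = scons (t.eval A v) v := by
    funext i; cases i <;> rfl
  rw [this, Function.comp_id]

theorem Fm.sat_instS {X : ℕ} : (φ.instS X).sat A v ρ ↔ φ.sat A v (scons (ρ X) ρ) := by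
  rw [Fm.instS_eq, Fm.sat_subst]
  have : ρ ∘ scons X id = scons (ρ X) ρ := by
    funext i; cases i <;> rfl
  rw [this]; rfl

theorem Fm.sat_liftN {x : A.N} : φ.liftN.sat A (scons x v) ρ ↔ φ.sat A v ρ := by
  rw [Fm.liftN, Fm.sat_subst]; rfl

theorem Fm.sat_liftS {X : A.S} : φ.liftS.sat A v (scons X ρ) ↔ φ.sat A v ρ := by
  rw [Fm.liftS, Fm.sat_subst]; rfl

theorem Fm.sat_neg : φ.neg.sat A v ρ ↔ ¬ φ.sat A v ρ := Iff.rfl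

theorem Fm.sat_and : (φ.and ψ).sat A v ρ ↔ φ.sat A v ρ ∧ ψ.sat A v ρ := by
  simp [Fm.and, Fm.neg, Fm.sat]

theorem Fm.sat_or : (φ.or ψ).sat A v ρ ↔ φ.sat A v ρ ∨ ψ.sat A v ρ := by
  simp only [Fm.or, Fm.neg, Fm.sat]; tauto

theorem Fm.sat_iff : (φ.iff ψ).sat A v ρ ↔ (φ.sat A v ρ ↔ ψ.sat A v ρ) := by
  simp only [Fm.iff, Fm.sat_and, Fm.sat]; tauto

theorem Fm.sat_exN : φ.exN.sat A v ρ ↔ ∃ x, φ.sat A (scons x v) ρ := by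
  simp [Fm.exN, Fm.neg, Fm.sat]

theorem Fm.sat_exS : φ.exS.sat A v ρ ↔ ∃ X, φ.sat A v (scons X ρ) := by
  simp [Fm.exS, Fm.neg, Fm.sat]

end

/-- The structure satisfies the theory `T`; free variables are read universally. -/
def Str.Models (A : Str) (T : Set Fm) : Prop := ∀ φ ∈ T, ∀ v ρ, φ.sat A v ρ

/-- Soundness of the calculus. -/
theorem Deriv.sound {T : Set Fm} {A : Str} (hA : A.Models T) {Γ : List Fm} {φ : Fm}
    (h : Deriv T Γ φ) : ∀ v ρ, (∀ ψ ∈ Γ, ψ.sat A v ρ) → φ.sat A v ρ := by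
  induction h with
  | ax h => intro v ρ _; exact hA _ h v ρ
  | hyp h => intro v ρ hΓ; exact hΓ _ h
  | impI _ ih => intro v ρ hΓ hφ; exact ih v ρ (by simpa using ⟨hφ, hΓ⟩)
  | impE _ _ ih₁ ih₂ => intro v ρ hΓ; exact ih₁ v ρ hΓ (ih₂ v ρ hΓ)
  | raa _ ih =>
    intro v ρ hΓ
    by_contra hφ
    exact ih v ρ (by simpa using ⟨hφ, hΓ⟩)
  | allNI _ ih =>
    intro v ρ hΓ x
    refine ih _ ρ fun ψ hψ => ?_
    obtain ⟨χ, hχ, rfl⟩ := List.mem_map.1 hψ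
    exact Fm.sat_liftN.2 (hΓ χ hχ)
  | allNE t _ ih => intro v ρ hΓ; exact Fm.sat_instN.2 (ih v ρ hΓ _)
  | allSI _ ih =>
    intro v ρ hΓ X
    refine ih v _ fun ψ hψ => ?_
    obtain ⟨χ, hχ, rfl⟩ := List.mem_map.1 hψ
    exact Fm.sat_liftS.2 (hΓ χ hχ)
  | allSE X _ ih => intro v ρ hΓ; exact Fm.sat_instS.2 (ih v ρ hΓ _)
  | eqI t => intro v ρ _; exact rfl
  | eqE φ _ _ ih₁ ih₂ =>
    intro v ρ hΓ
    have h₁ := ih₁ v ρ hΓ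
    have h₂ := Fm.sat_instN.1 (ih₂ v ρ hΓ)
    simp only [Fm.sat] at h₁
    rw [h₁] at h₂
    exact Fm.sat_instN.2 h₂


/-! ### Completeness -/

section Subst
variable {T : Set Fm}

theorem Deriv.weaken {Γ : List Fm} {φ : Fm} (h : Deriv T Γ φ) :
    ∀ {Δ : List Fm}, Γ ⊆ Δ → Deriv T Δ φ := by
  induction h with
  | ax h => intro Δ _; exact .ax h
  | hyp h => intro Δ hΔ; exact .hyp (hΔ h)
  | impI _ ih => intro Δ hΔ; exact .impI (ih (List.cons_subset_cons _ hΔ))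
  | impE _ _ ih₁ ih₂ => intro Δ hΔ; exact .impE (ih₁ hΔ) (ih₂ hΔ)
  | raa _ ih => intro Δ hΔ; exact .raa (ih (List.cons_subset_cons _ hΔ))
  | allNI _ ih => intro Δ hΔ; exact .allNI (ih (List.map_subset _ hΔ))
  | allNE t _ ih => intro Δ hΔ; exact .allNE t (ih hΔ)
  | allSI _ ih => intro Δ hΔ; exact .allSI (ih (List.map_subset _ hΔ))
  | allSE X _ ih => intro Δ hΔ; exact .allSE X (ih hΔ)
  | eqI t => intro Δ _; exact .eqI t
  | eqE φ _ _ ih₁ ih₂ => intro Δ hΔ; exact .eqE φ (ih₁ hΔ) (ih₂ hΔ)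

/-- Generalizing `m` number variables and instantiating them again performs any substitution that
is a mere shift from `m` on. -/
theorem Provable.substN_shift (m : ℕ) : ∀ {φ : Fm} {σ : ℕ → Tm}, Provable T φ →
    (∀ i, σ (m + i) = .var i) → Provable T (φ.subst σ id) := by
  induction m with
  | zero =>
    intro φ σ h hσ
    have : σ = .var := funext fun i => by simpa using hσ i
    rwa [this, Fm.subst_var]
  | succ m ih =>
    intro φ σ h hσ
    have h₁ : Provable T (φ.allN.subst (fun i => σ (i + 1)) id) :=
      ih (.allNI h) fun i => (congrArg σ (by omega)).trans (hσ i)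
    have h₂ := Deriv.allNE (σ 0) h₁
    rw [Fm.subst_instN] at h₂
    have : scons (σ 0) (fun i => σ (i + 1)) = σ := by funext i; cases i <;> rfl
    rwa [this] at h₂

theorem Provable.substS_shift (m : ℕ) : ∀ {φ : Fm} {τ : ℕ → ℕ}, Provable T φ →
    (∀ i, τ (m + i) = i) → Provable T (φ.subst .var τ) := by
  induction m with
  | zero =>
    intro φ τ h hτ
    have : τ = id := funext fun i => by simpa using hτ i
    rwa [this, Fm.subst_var]
  | succ m ih =>
    intro φ τ h hτ
    have h₁ : Provable T (φ.allS.subst .var (fun i => τ (i + 1))) :=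
      ih (.allSI h) fun i => (congrArg τ (by omega)).trans (hτ i)
    have h₂ := Deriv.allSE (τ 0) h₁
    rw [Fm.subst_instS] at h₂
    have : scons (τ 0) (fun i => τ (i + 1)) = τ := by funext i; cases i <;> rfl
    rwa [this] at h₂

theorem Provable.subst {φ : Fm} (h : Provable T φ) (σ : ℕ → Tm) (τ : ℕ → ℕ) :
    Provable T (φ.subst σ τ) := by
  have h₁ := Provable.substN_shift φ.bdN
    (σ := fun i => if i < φ.bdN then σ i else .var (i - φ.bdN)) h (by simp)
  rw [Fm.subst_congr (σ' := σ) (τ' := id) φ (fun i hi => by simp [hi]) (fun _ _ => rfl)] at h₁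
  have h₂ := Provable.substS_shift (φ.subst σ id).bdS
    (τ := fun i => if i < (φ.subst σ id).bdS then τ i else i - (φ.subst σ id).bdS) h₁ (by simp)
  rw [Fm.subst_congr (σ' := .var) (τ' := τ) _ (fun _ _ => rfl) (fun i hi => by simp [hi]),
    Fm.subst_subst] at h₂
  have : (fun i => Tm.subst Tm.var (σ i)) = σ := funext fun i => Tm.subst_var _
  rwa [this] at h₂

theorem Deriv.subst {Γ : List Fm} {φ : Fm} (h : Deriv T Γ φ) : ∀ (σ : ℕ → Tm) (τ : ℕ → ℕ),
    Deriv T (Γ.map (Fm.subst σ τ)) (φ.subst σ τ) := by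
  induction h with
  | ax h => intro σ τ; exact (Provable.subst (.ax h) σ τ).weaken (List.nil_subset _)
  | hyp h => intro σ τ; exact .hyp (List.mem_map_of_mem h)
  | impI _ ih => intro σ τ; exact .impI (ih σ τ)
  | impE _ _ ih₁ ih₂ => intro σ τ; exact .impE (ih₁ σ τ) (ih₂ σ τ)
  | raa _ ih => intro σ τ; exact .raa (ih σ τ)
  | @allNI Γ φ _ ih =>
    intro σ τ
    refine .allNI ?_
    have h := ih (upN σ) τ
    rw [List.map_map] at h ⊢
    convert h using 2
    funext ψ; exact (Fm.liftN_subst ψ σ τ).symm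
  | allNE t _ ih =>
    intro σ τ
    rw [Fm.instN_subst]
    exact .allNE _ (ih σ τ)
  | @allSI Γ φ _ ih =>
    intro σ τ
    refine .allSI ?_
    have h := ih σ (upS τ)
    rw [List.map_map] at h ⊢
    convert h using 2
    funext ψ; exact (Fm.liftS_subst ψ σ τ).symm
  | allSE X _ ih =>
    intro σ τ
    rw [Fm.instS_subst]
    exact .allSE _ (ih σ τ)
  | eqI t => intro σ τ; exact .eqI _
  | eqE φ _ _ ih₁ ih₂ =>
    intro σ τ
    have h := ih₂ σ τ
    rw [Fm.instN_subst] at h ⊢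
    exact .eqE _ (ih₁ σ τ) h

/-- A fresh number variable `k` is as good as a generalized one. -/
theorem Deriv.allN_of_fresh {Γ : List Fm} {φ : Fm} {k : ℕ} (hΓ : ∀ ψ ∈ Γ, ψ.bdN ≤ k)
    (hφ : φ.bdN ≤ k + 1) (h : Deriv T Γ (φ.instN (.var k))) : Deriv T Γ (.allN φ) := by
  refine .allNI ?_
  have h₁ := h.subst (fun i => if i < k then .var (i + 1) else .var 0) id
  have h₂ : Γ.map (Fm.subst (fun i => if i < k then .var (i + 1) else .var 0) id) =
      Γ.map Fm.liftN := by
    refine List.map_congr_left fun ψ hψ => Fm.subst_congr _ (fun i hi => ?_) fun _ _ => rfl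
    simp [lt_of_lt_of_le hi (hΓ ψ hψ)]
  have h₃ : (φ.instN (.var k)).subst (fun i => if i < k then .var (i + 1) else .var 0) id = φ := by
    rw [Fm.instN_eq, Fm.subst_subst]
    refine (Fm.subst_congr φ (σ' := .var) (τ' := id) (fun i hi => ?_) fun _ _ => rfl).trans
      φ.subst_var
    cases i with
    | zero => simp [Tm.subst]
    | succ i =>
      have : i < k := by omega
      simp [Tm.subst, this]
  rwa [h₂, h₃] at h₁

/-- A fresh set variable `k` is as good as a generalized one. -/
theorem Deriv.allS_of_fresh {Γ : List Fm} {φ : Fm} {k : ℕ} (hΓ : ∀ ψ ∈ Γ, ψ.bdS ≤ k)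
    (hφ : φ.bdS ≤ k + 1) (h : Deriv T Γ (φ.instS k)) : Deriv T Γ (.allS φ) := by
  refine .allSI ?_
  have h₁ := h.subst .var (fun i => if i < k then i + 1 else 0)
  have h₂ : Γ.map (Fm.subst .var (fun i => if i < k then i + 1 else 0)) =
      Γ.map Fm.liftS := by
    refine List.map_congr_left fun ψ hψ => Fm.subst_congr _ (fun _ _ => rfl) fun i hi => ?_
    simp [lt_of_lt_of_le hi (hΓ ψ hψ)]
  have h₃ : (φ.instS k).subst .var (fun i => if i < k then i + 1 else 0) = φ := by
    rw [Fm.instS_eq, Fm.subst_subst]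
    refine (Fm.subst_congr φ (σ' := .var) (τ' := id) (fun _ _ => rfl) fun i hi => ?_).trans
      φ.subst_var
    cases i with
    | zero => simp
    | succ i =>
      have : i < k := by omega
      simp [this]
  rwa [h₂, h₃] at h₁

theorem Deriv.exfalso {Γ : List Fm} {φ : Fm} (h : Deriv T Γ .fal) : Deriv T Γ φ :=
  .raa (h.weaken (List.subset_cons_self _ _))

/-- A finite set of formulas from which `⊥` is not derivable. -/
def Consistent (T : Set Fm) (Γ : List Fm) : Prop := ¬ Deriv T Γ .fal

theorem Consistent.cons_or {Γ : List Fm} (h : Consistent T Γ) (φ : Fm) :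
    Consistent T (φ :: Γ) ∨ Consistent T (φ.neg :: Γ) := by
  by_contra! hc
  obtain ⟨h₁, h₂⟩ := hc
  exact h (.impE (.impI (not_not.1 h₁)) (.raa (not_not.1 h₂)))

/-- A step of the Henkin construction: `φ` can be decided, and if it is a refuted universal
formula, a counterexample can be named. -/
theorem Consistent.henkin_step {Γ : List Fm} (h : Consistent T Γ) (φ : Fm) :
    ∃ Δ, Consistent T Δ ∧ Γ ⊆ Δ ∧ (φ ∈ Δ ∨ φ.neg ∈ Δ ∧
      (∀ χ, φ = .allN χ → ∃ t, (χ.instN t).neg ∈ Δ) ∧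
      (∀ χ, φ = .allS χ → ∃ X, (χ.instS X).neg ∈ Δ)) := by
  by_cases hφ : Consistent T (φ :: Γ)
  · exact ⟨_, hφ, List.subset_cons_self _ _, .inl List.mem_cons_self⟩
  have hn := (h.cons_or φ).resolve_left hφ
  have bound : ∀ f : Fm → ℕ, ∃ k, ∀ ψ ∈ φ.neg :: Γ, f ψ ≤ k := by
    intro f
    induction φ.neg :: Γ with
    | nil => exact ⟨0, by simp⟩
    | cons ψ Δ ih =>
      obtain ⟨k, hk⟩ := ih
      refine ⟨max (f ψ) k, fun χ hχ => ?_⟩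
      rcases List.mem_cons.1 hχ with rfl | hχ
      · exact le_max_left _ _
      · exact (hk χ hχ).trans (le_max_right _ _)
  cases φ with
  | allN χ =>
    obtain ⟨k, hk⟩ := bound Fm.bdN
    refine ⟨(χ.instN (.var k)).neg :: (Fm.allN χ).neg :: Γ, fun hd => hn ?_,
      fun ψ hψ => by simp [hψ], .inr ⟨by simp, ?_, by simp⟩⟩
    · refine .impE (.hyp List.mem_cons_self) (Deriv.allN_of_fresh hk ?_ (.raa hd))
      have := hk _ List.mem_cons_self
      simp only [Fm.neg, Fm.bdN] at this
      omega
    · rintro χ' ⟨⟩; exact ⟨_, List.mem_cons_self⟩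
  | allS χ =>
    obtain ⟨k, hk⟩ := bound Fm.bdS
    refine ⟨(χ.instS k).neg :: (Fm.allS χ).neg :: Γ, fun hd => hn ?_,
      fun ψ hψ => by simp [hψ], .inr ⟨by simp, by simp, ?_⟩⟩
    · refine .impE (.hyp List.mem_cons_self) (Deriv.allS_of_fresh hk ?_ (.raa hd))
      have := hk _ List.mem_cons_self
      simp only [Fm.neg, Fm.bdS] at this
      omega
    · rintro χ' ⟨⟩; exact ⟨_, List.mem_cons_self⟩
  | _ => exact ⟨_, hn, List.subset_cons_self _ _, .inr ⟨List.mem_cons_self, by simp, by simp⟩⟩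

/-- An injective numbering of the terms. -/
def Tm.code : Tm → ℕ
  | .var i => 4 * i
  | .zero => 1
  | .one => 5
  | .add s t => 4 * Nat.pair s.code t.code + 2
  | .mul s t => 4 * Nat.pair s.code t.code + 3

theorem Tm.code_injective : Function.Injective Tm.code := by
  intro s
  induction s with
  | add s s' h h' | mul s s' h h' =>
    intro t ht
    cases t <;> simp only [Tm.code] at ht <;> try omega
    simp [Nat.pair_eq_pair] at ht
    rw [h ht.1, h' ht.2]
  | _ => intro t ht; cases t <;> simp only [Tm.code] at ht <;> first | rfl | omega | (congr; omega)

/-- An injective numbering of the formulas. -/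
def Fm.code : Fm → ℕ
  | .eq s t => 7 * Nat.pair s.code t.code
  | .lt s t => 7 * Nat.pair s.code t.code + 1
  | .mem t X => 7 * Nat.pair t.code X + 2
  | .fal => 3
  | .imp φ ψ => 7 * Nat.pair φ.code ψ.code + 4
  | .allN φ => 7 * φ.code + 5
  | .allS φ => 7 * φ.code + 6

theorem Fm.code_injective : Function.Injective Fm.code := by
  intro φ
  induction φ with
  | eq s t | lt s t =>
    intro ψ h
    cases ψ <;> simp only [Fm.code] at h <;> try omega
    simp [Nat.pair_eq_pair] at h
    rw [Tm.code_injective h.1, Tm.code_injective h.2]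
  | mem t X =>
    intro ψ h
    cases ψ <;> simp only [Fm.code] at h <;> try omega
    simp [Nat.pair_eq_pair] at h
    rw [Tm.code_injective h.1, h.2]
  | fal => intro ψ h; cases ψ <;> simp only [Fm.code] at h <;> first | rfl | omega
  | imp φ φ' ih ih' =>
    intro ψ h
    cases ψ <;> simp only [Fm.code] at h <;> try omega
    simp [Nat.pair_eq_pair] at h
    rw [ih h.1, ih' h.2]
  | allN φ ih | allS φ ih =>
    intro ψ h
    cases ψ <;> simp only [Fm.code] at h <;> try omega
    rw [@ih _ (by simpa using h)]

instance : Countable Fm := Fm.code_injective.countable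

instance : Nonempty Fm := ⟨.fal⟩

end Subst

/-- A deductively closed, consistent, complete set of formulas with a named counterexample to each
refuted universal formula. -/
structure HenkinSet (T : Set Fm) (H : Set Fm) : Prop where
  closed : ∀ {Γ : List Fm} {φ : Fm}, (∀ ψ ∈ Γ, ψ ∈ H) → Deriv T Γ φ → φ ∈ H
  fal_notMem : Fm.fal ∉ H
  complete : ∀ φ, φ ∈ H ∨ φ.neg ∈ H
  allN : ∀ φ, (Fm.allN φ).neg ∈ H → ∃ t, (φ.instN t).neg ∈ H
  allS : ∀ φ, (Fm.allS φ).neg ∈ H → ∃ X, (φ.instS X).neg ∈ H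

theorem Consistent.exists_henkinSet {T : Set Fm} {Γ : List Fm} (h : Consistent T Γ) :
    ∃ H, HenkinSet T H ∧ ∀ ψ ∈ Γ, ψ ∈ H := by
  obtain ⟨e, he⟩ := exists_surjective_nat Fm
  choose f hf₁ hf₂ hf₃ using fun (Δ : {Δ // Consistent T Δ}) φ => Δ.2.henkin_step φ
  let C : ℕ → {Δ // Consistent T Δ} :=
    fun n => Nat.rec ⟨Γ, h⟩ (fun n Δ => ⟨f Δ (e n), hf₁ Δ (e n)⟩) n
  have hC : ∀ n, (C (n + 1)).1 = f (C n) (e n) := fun _ => rfl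
  have hmono : ∀ {m n}, m ≤ n → (C m).1 ⊆ (C n).1 := by
    intro m n hmn
    induction hmn with
    | refl => exact List.Subset.refl _
    | step _ ih => exact List.Subset.trans ih (hf₂ _ _)
  have hmem : ∀ {Δ : List Fm}, (∀ ψ ∈ Δ, ∃ n, ψ ∈ (C n).1) → ∃ n, Δ ⊆ (C n).1 := by
    intro Δ
    induction Δ with
    | nil => exact fun _ => ⟨0, List.nil_subset _⟩
    | cons ψ Δ ih =>
      intro hΔ
      obtain ⟨n, hn⟩ := ih fun χ hχ => hΔ χ (List.mem_cons_of_mem _ hχ)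
      obtain ⟨m, hm⟩ := hΔ ψ List.mem_cons_self
      exact ⟨max m n, List.cons_subset.2 ⟨hmono (le_max_left _ _) hm,
        List.Subset.trans hn (hmono (le_max_right _ _))⟩⟩
  have hdec : ∀ φ, (∃ n, φ ∈ (C n).1) ∨ ∃ n, φ.neg ∈ (C n).1 ∧
      (∀ χ, φ = .allN χ → ∃ t, (χ.instN t).neg ∈ (C n).1) ∧
      (∀ χ, φ = .allS χ → ∃ X, (χ.instS X).neg ∈ (C n).1) := by
    intro φ
    obtain ⟨n, rfl⟩ := he φ
    rcases hf₃ (C n) (e n) with h | h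
    · exact .inl ⟨n + 1, h⟩
    · exact .inr ⟨n + 1, h⟩
  have hcons : ∀ φ, (∃ n, φ ∈ (C n).1) → (∃ n, φ.neg ∈ (C n).1) → False := by
    rintro φ ⟨m, hm⟩ ⟨n, hn⟩
    exact (C (max m n)).2 (.impE (.hyp (hmono (le_max_right _ _) hn))
      (.hyp (hmono (le_max_left _ _) hm)))
  refine ⟨{ψ | ∃ n, ψ ∈ (C n).1}, ⟨?_, ?_, ?_, ?_, ?_⟩, fun ψ hψ => ⟨0, hψ⟩⟩
  · intro Δ φ hΔ hd
    refine (hdec φ).resolve_right ?_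
    rintro ⟨n, hn, -⟩
    obtain ⟨m, hm⟩ := hmem hΔ
    refine (C (max m n)).2 (.impE (.hyp (hmono (le_max_right _ _) hn))
      (hd.weaken (List.Subset.trans hm (hmono (le_max_left _ _)))))
  · rintro ⟨n, hn⟩; exact (C n).2 (.hyp hn)
  · intro φ
    exact (hdec φ).imp id fun ⟨n, hn, _⟩ => ⟨n, hn⟩
  · intro φ hφ
    rcases hdec (.allN φ) with h | ⟨n, -, hn, -⟩
    · exact (hcons _ h hφ).elim
    · obtain ⟨t, ht⟩ := hn φ rfl
      exact ⟨t, n, ht⟩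
  · intro φ hφ
    rcases hdec (.allS φ) with h | ⟨n, -, -, hn⟩
    · exact (hcons _ h hφ).elim
    · obtain ⟨t, ht⟩ := hn φ rfl
      exact ⟨t, n, ht⟩

namespace HenkinSet
variable {T H : Set Fm} (hH : HenkinSet T H)
include hH

theorem mp {φ ψ : Fm} (h : φ.imp ψ ∈ H) (h' : φ ∈ H) : ψ ∈ H :=
  hH.closed (Γ := [φ.imp ψ, φ]) (by simp [h, h']) (.impE (φ := φ) (.hyp (by simp)) (.hyp (by simp)))

theorem neg_mem {φ : Fm} : φ.neg ∈ H ↔ φ ∉ H :=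
  ⟨fun h h' => hH.fal_notMem (hH.mp h h'), (hH.complete φ).resolve_left⟩

theorem imp_mem {φ ψ : Fm} : φ.imp ψ ∈ H ↔ (φ ∈ H → ψ ∈ H) := by
  refine ⟨hH.mp, fun h => ?_⟩
  by_cases hφ : φ ∈ H
  · exact hH.closed (Γ := [ψ]) (by simp [h hφ]) (.impI (.hyp (by simp)))
  · exact hH.closed (Γ := [φ.neg]) (by simpa using hH.neg_mem.2 hφ)
      (.impI (Deriv.exfalso (.impE (φ := φ) (.hyp (by simp [Fm.neg])) (.hyp (by simp)))))

theorem allN_mem {φ : Fm} : φ.allN ∈ H ↔ ∀ t, φ.instN t ∈ H := by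
  refine ⟨fun h t => hH.closed (Γ := [φ.allN]) (by simp [h]) (.allNE t (.hyp (by simp))),
    fun h => ?_⟩
  by_contra hn
  obtain ⟨t, ht⟩ := hH.allN φ (hH.neg_mem.2 hn)
  exact hH.neg_mem.1 ht (h t)

theorem allS_mem {φ : Fm} : φ.allS ∈ H ↔ ∀ X, φ.instS X ∈ H := by
  refine ⟨fun h t => hH.closed (Γ := [φ.allS]) (by simp [h]) (.allSE t (.hyp (by simp))),
    fun h => ?_⟩
  by_contra hn
  obtain ⟨t, ht⟩ := hH.allS φ (hH.neg_mem.2 hn)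
  exact hH.neg_mem.1 ht (h t)

theorem eq_refl (t : Tm) : Fm.eq t t ∈ H := hH.closed (Γ := []) (by simp) (.eqI t)

theorem subst_eq {s t : Tm} (h : Fm.eq s t ∈ H) (φ : Fm) (h' : φ.instN s ∈ H) :
    φ.instN t ∈ H :=
  hH.closed (Γ := [.eq s t, φ.instN s]) (by simp [h, h'])
    (.eqE (s := s) φ (.hyp (by simp)) (.hyp (by simp)))

omit hH in
theorem lift_inst (r t : Tm) : r.lift.subst (scons t .var) = r := by
  rw [Tm.lift, Tm.subst_subst]; exact Tm.subst_var r

theorem eq_symm {s t : Tm} (h : Fm.eq s t ∈ H) : Fm.eq t s ∈ H := by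
  have := hH.subst_eq h (.eq (.var 0) s.lift)
  simp only [Fm.instN_eq, Fm.subst, Tm.subst, scons_zero, lift_inst] at this
  exact this (hH.eq_refl s)

theorem eq_trans {r s t : Tm} (h : Fm.eq r s ∈ H) (h' : Fm.eq s t ∈ H) : Fm.eq r t ∈ H := by
  have := hH.subst_eq h' (.eq r.lift (.var 0))
  simp only [Fm.instN_eq, Fm.subst, Tm.subst, scons_zero, lift_inst] at this
  exact this h

/-- Provable equality in `H`. -/
def setoid : Setoid Tm := ⟨fun s t => Fm.eq s t ∈ H, hH.eq_refl, hH.eq_symm, hH.eq_trans⟩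

theorem congr_op (f : Tm → Tm → Tm)
    (hf : ∀ s t σ, (f s t).subst σ = f (s.subst σ) (t.subst σ)) {s s' t t' : Tm}
    (hs : Fm.eq s s' ∈ H) (ht : Fm.eq t t' ∈ H) : Fm.eq (f s t) (f s' t') ∈ H := by
  have h₁ := hH.subst_eq hs (.eq (f s.lift t.lift) (f (.var 0) t.lift))
  have h₂ := hH.subst_eq ht (.eq (f s'.lift t.lift) (f s'.lift (.var 0)))
  simp only [Fm.instN_eq, Fm.subst, hf, Tm.subst, scons_zero, lift_inst] at h₁ h₂
  exact hH.eq_trans (h₁ (hH.eq_refl _)) (h₂ (hH.eq_refl _))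

theorem congr_lt {s s' t t' : Tm} (hs : Fm.eq s s' ∈ H) (ht : Fm.eq t t' ∈ H)
    (h : Fm.lt s t ∈ H) : Fm.lt s' t' ∈ H := by
  have h₁ := hH.subst_eq hs (.lt (.var 0) t.lift)
  have h₂ := hH.subst_eq ht (.lt s'.lift (.var 0))
  simp only [Fm.instN_eq, Fm.subst, Tm.subst, scons_zero, lift_inst] at h₁ h₂
  exact h₂ (h₁ h)

theorem congr_mem {s s' : Tm} (hs : Fm.eq s s' ∈ H) {X : ℕ} (h : Fm.mem s X ∈ H) :
    Fm.mem s' X ∈ H := by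
  have h₁ := hH.subst_eq hs (.mem (.var 0) X)
  simp only [Fm.instN_eq, Fm.subst, Tm.subst, scons_zero] at h₁
  exact h₁ h

/-- The term model: numbers are terms modulo provable equality, sets are the set variables. -/
def termModel : Str where
  N := Quotient hH.setoid
  S := ℕ
  zero := Quotient.mk _ .zero
  one := Quotient.mk _ .one
  add := Quotient.map₂ .add fun _ _ hs _ _ ht => hH.congr_op .add (fun _ _ _ => rfl) hs ht
  mul := Quotient.map₂ .mul fun _ _ hs _ _ ht => hH.congr_op .mul (fun _ _ _ => rfl) hs ht
  lt := Quotient.lift₂ (fun s t => Fm.lt s t ∈ H) fun _ _ _ _ hs ht =>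
    propext ⟨hH.congr_lt hs ht, hH.congr_lt (hH.eq_symm hs) (hH.eq_symm ht)⟩
  mem x X := Quotient.lift (fun s => Fm.mem s X ∈ H)
    (fun _ _ hs => propext ⟨hH.congr_mem hs, hH.congr_mem (hH.eq_symm hs)⟩) x

/-- The element of the term model named by `t`. -/
def cls (t : Tm) : hH.termModel.N := Quotient.mk _ t

theorem termModel_eval (σ : ℕ → Tm) (t : Tm) :
    t.eval hH.termModel (fun i => hH.cls (σ i)) = hH.cls (t.subst σ) := by
  induction t with
  | add s t hs ht | mul s t hs ht => simp only [Tm.eval, hs, ht]; rfl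
  | _ => rfl

/-- The truth lemma. -/
theorem termModel_sat (φ : Fm) : ∀ (σ : ℕ → Tm) (τ : ℕ → ℕ),
    φ.sat hH.termModel (fun i => hH.cls (σ i)) τ ↔ φ.subst σ τ ∈ H := by
  induction φ with
  | eq s t =>
    intro σ τ
    simp only [Fm.sat, termModel_eval, Fm.subst]
    exact Quotient.eq (r := hH.setoid)
  | lt s t => intro σ τ; simp only [Fm.sat, termModel_eval, Fm.subst]; rfl
  | mem t X => intro σ τ; simp only [Fm.sat, termModel_eval, Fm.subst]; rfl
  | fal => intro σ τ; exact iff_of_false id hH.fal_notMem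
  | imp φ ψ hφ hψ => intro σ τ; simp only [Fm.sat, Fm.subst, hH.imp_mem, hφ, hψ]
  | allN φ ih =>
    intro σ τ
    have key : ∀ t : Tm, φ.sat hH.termModel
        (scons (hH.cls t) fun i => hH.cls (σ i)) τ ↔
        (φ.subst (upN σ) τ).instN t ∈ H := by
      intro t
      rw [Fm.subst_instN, ← ih]
      have : scons (hH.cls t) (fun i => hH.cls (σ i)) =
          fun i => hH.cls (scons t σ i) := by funext i; cases i <;> rfl
      rw [← this]
    simp only [Fm.subst, hH.allN_mem, ← key]
    exact ⟨fun h t => h _, fun h x => Quotient.inductionOn x h⟩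
  | allS φ ih =>
    intro σ τ
    simp only [Fm.subst, hH.allS_mem, Fm.subst_instS, ← ih]
    rfl

theorem termModel_models : hH.termModel.Models T := by
  intro φ hφ v τ
  obtain ⟨σ, rfl⟩ : ∃ σ : ℕ → Tm, v = fun i => hH.cls (σ i) :=
    ⟨fun i => (v i).out, funext fun i => (Quotient.out_eq _).symm⟩
  refine (hH.termModel_sat φ σ τ).2 ?_
  exact hH.closed (Γ := []) (by simp) (Provable.subst (.ax hφ) σ τ)

end HenkinSet

/-- Gödel's completeness theorem for the two-sorted calculus. -/
theorem provable_of_models {T : Set Fm} {φ : Fm}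
    (h : ∀ A : Str, A.Models T → ∀ v ρ, φ.sat A v ρ) : Provable T φ := by
  by_contra hφ
  have hc : Consistent T [φ.neg] := fun hd => hφ (.raa hd)
  obtain ⟨H, hH, hmem⟩ := hc.exists_henkinSet
  have h₁ := h hH.termModel hH.termModel_models (fun i => hH.cls (.var i)) id
  rw [hH.termModel_sat, Fm.subst_var] at h₁
  exact hH.neg_mem.1 (hmem _ (by simp)) h₁


/-! ### Definable predicates of a structure -/

/-- The sequence `v 0, p 0, v 1, p 1, …`. Variables with even index take the arguments of a definable
predicate and those with odd index its parameters, so that neither kind runs out. -/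
def mix {α : Type} (v p : ℕ → α) : ℕ → α := fun i => if i % 2 = 0 then v (i / 2) else p (i / 2)

@[simp] theorem mix_even {α : Type} (v p : ℕ → α) (i : ℕ) : mix v p (2 * i) = v i := by
  simp [mix]

@[simp] theorem mix_odd {α : Type} (v p : ℕ → α) (i : ℕ) : mix v p (2 * i + 1) = p i := by
  have : (2 * i + 1) / 2 = i := by omega
  simp [mix, this]

theorem map_mix {α β : Type} (f : α → β) (v p : ℕ → α) :
    (fun i => f (mix v p i)) = mix (fun i => f (v i)) (fun i => f (p i)) := by
  funext i; simp only [mix]; split <;> rfl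

theorem map_scons {α β : Type} (f : α → β) (a : α) (v : ℕ → α) :
    (fun i => f (scons a v i)) = scons (f a) (fun i => f (v i)) := by
  funext i; cases i <;> rfl

theorem scons_head_tail {α : Type} (v : ℕ → α) : scons (v 0) (fun i => v (i + 1)) = v := by
  funext i; cases i <;> rfl

theorem IsSigma00.subst {φ : Fm} (h : IsSigma00 φ) :
    ∀ (σ : ℕ → Tm) (τ : ℕ → ℕ), IsSigma00 (φ.subst σ τ) := by
  induction h with
  | eq s t => intros; exact .eq _ _
  | lt s t => intros; exact .lt _ _
  | mem t X => intros; exact .mem _ _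
  | fal => intros; exact .fal
  | imp _ _ h₁ h₂ => intro σ τ; exact .imp (h₁ σ τ) (h₂ σ τ)
  | ball t _ ih =>
    intro σ τ
    simp only [Fm.subst, Tm.lift_subst_upN]
    exact .ball (t.subst σ) (ih (upN σ) τ)

/-- `t` defines the function `f` of the even variables, the odd ones being parameters. -/
def RepT {A : Str} (t : Tm) (p : ℕ → A.N) (f : (ℕ → A.N) → A.N) : Prop :=
  ∀ v, f v = t.eval A (mix v p)

/-- `θ` defines the predicate `P` of the even variables, the odd ones being parameters. -/
def Rep {A : Str} (θ : Fm) (p : ℕ → A.N) (ρ : ℕ → A.S) (P : (ℕ → A.N) → Prop) : Prop :=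
  IsSigma00 θ ∧ ∀ v, P v ↔ θ.sat A (mix v p) ρ

/-- Functions given by a term with parameters. -/
class TDef {A : Str} (f : (ℕ → A.N) → A.N) : Prop where
  out : ∃ t p, RepT t p f

/-- Predicates given by a `Σ⁰₀` formula with parameters. A predicate of `x₀, x₁, …` is written as one
of the sequence `v`, with `v i` for `xᵢ`, so that instance search can prove definability. -/
class Sig0 {A : Str} (P : (ℕ → A.N) → Prop) : Prop where
  out : ∃ θ p ρ, Rep θ p ρ P

/-- Predicates given by a `Σ⁰₁` formula with parameters. -/
class Sig1 {A : Str} (P : (ℕ → A.N) → Prop) : Prop where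
  out : ∃ Q : (ℕ → A.N) → Prop, Sig0 Q ∧ ∀ v, P v ↔ ∃ x, Q (scons x v)

/-- Predicates given by a `Π⁰₁` formula with parameters. -/
class Pi1 {A : Str} (P : (ℕ → A.N) → Prop) : Prop where
  out : Sig1 fun v => ¬ P v

section
variable {A : Str}

/-- The substitution that keeps the even variables and moves the odd ones along `a`. -/
def reindex (a : ℕ → ℕ) : ℕ → Tm := mix (fun i => .var (2 * i)) (fun i => .var (2 * a i + 1))

theorem eval_reindex {a : ℕ → ℕ} {p p' : ℕ → A.N} (hp : ∀ i, p' (a i) = p i) (v : ℕ → A.N) :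
    (fun i => (reindex a i).eval A (mix v p')) = mix v p := by
  rw [reindex, map_mix]
  congr 1 <;> funext i <;> simp [Tm.eval, hp]

theorem RepT.reindex {t : Tm} {p p' : ℕ → A.N} {f : (ℕ → A.N) → A.N} (h : RepT t p f)
    (a : ℕ → ℕ) (hp : ∀ i, p' (a i) = p i) : RepT (t.subst (reindex a)) p' f := by
  intro v
  rw [h v, Tm.eval_subst, eval_reindex hp]

theorem Rep.reindex {θ : Fm} {p p' : ℕ → A.N} {ρ ρ' : ℕ → A.S} {P : (ℕ → A.N) → Prop}
    (h : Rep θ p ρ P) (a b : ℕ → ℕ) (hp : ∀ i, p' (a i) = p i) (hρ : ∀ i, ρ' (b i) = ρ i) :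
    Rep (θ.subst (SOA.reindex a) b) p' ρ' P := by
  refine ⟨h.1.subst _ _, fun v => ?_⟩
  rw [h.2 v, Fm.sat_subst, eval_reindex hp]
  have : ρ' ∘ b = ρ := funext hρ
  rw [this]

theorem TDef.var (i : ℕ) : TDef fun v : ℕ → A.N => v i :=
  ⟨.var (2 * i), fun _ => A.zero, fun v => by simp [Tm.eval]⟩

theorem TDef.const (a : A.N) : TDef fun _ : ℕ → A.N => a :=
  ⟨.var 1, fun _ => a, fun v => (mix_odd v (fun _ => a) 0).symm⟩

theorem TDef.pair_rep {f g : (ℕ → A.N) → A.N} (hf : TDef f) (hg : TDef g) :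
    ∃ s t p, RepT s p f ∧ RepT t p g := by
  obtain ⟨s, p, hs⟩ := hf.out
  obtain ⟨t, q, ht⟩ := hg.out
  exact ⟨_, _, mix p q, hs.reindex (fun i => 2 * i) (by simp),
    ht.reindex (fun i => 2 * i + 1) (by simp)⟩

theorem TDef.add' {f g : (ℕ → A.N) → A.N} (hf : TDef f) (hg : TDef g) :
    TDef fun v => A.add (f v) (g v) := by
  obtain ⟨s, t, p, hs, ht⟩ := hf.pair_rep hg
  exact ⟨.add s t, p, fun v => by simp [Tm.eval, hs v, ht v]⟩

theorem TDef.mul' {f g : (ℕ → A.N) → A.N} (hf : TDef f) (hg : TDef g) :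
    TDef fun v => A.mul (f v) (g v) := by
  obtain ⟨s, t, p, hs, ht⟩ := hf.pair_rep hg
  exact ⟨.mul s t, p, fun v => by simp [Tm.eval, hs v, ht v]⟩

theorem Sig0.eq' [Nonempty A.S] {f g : (ℕ → A.N) → A.N} (hf : TDef f) (hg : TDef g) :
    Sig0 fun v => f v = g v := by
  obtain ⟨s, t, p, hs, ht⟩ := hf.pair_rep hg
  exact ⟨.eq s t, p, fun _ => Classical.arbitrary _, .eq _ _, fun v => by
    simp [Fm.sat, hs v, ht v]⟩

theorem Sig0.lt' [Nonempty A.S] {f g : (ℕ → A.N) → A.N} (hf : TDef f) (hg : TDef g) :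
    Sig0 fun v => A.lt (f v) (g v) := by
  obtain ⟨s, t, p, hs, ht⟩ := hf.pair_rep hg
  exact ⟨.lt s t, p, fun _ => Classical.arbitrary _, .lt _ _, fun v => by
    simp [Fm.sat, hs v, ht v]⟩

theorem Sig0.mem' {f : (ℕ → A.N) → A.N} (hf : TDef f) (X : A.S) :
    Sig0 fun v => A.mem (f v) X := by
  obtain ⟨s, p, hs⟩ := hf.out
  exact ⟨.mem s 0, p, fun _ => X, .mem _ _, fun v => by simp [Fm.sat, hs v]⟩

theorem Sig0.false' [Nonempty A.S] : Sig0 fun _ : ℕ → A.N => False :=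
  ⟨.fal, fun _ => A.zero, fun _ => Classical.arbitrary _, .fal, fun _ => Iff.rfl⟩

theorem Sig0.imp' {P Q : (ℕ → A.N) → Prop} (hP : Sig0 P) (hQ : Sig0 Q) :
    Sig0 fun v => P v → Q v := by
  obtain ⟨θ, p, ρ, h⟩ := hP.out
  obtain ⟨χ, q, π, h'⟩ := hQ.out
  have h₁ := h.reindex (p' := mix p q) (ρ' := mix ρ π) (fun i => 2 * i) (fun i => 2 * i)
    (by simp) (by simp)
  have h₂ := h'.reindex (p' := mix p q) (ρ' := mix ρ π) (fun i => 2 * i + 1) (fun i => 2 * i + 1)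
    (by simp) (by simp)
  exact ⟨_, _, _, .imp h₁.1 h₂.1, fun v => imp_congr (h₁.2 v) (h₂.2 v)⟩

theorem Sig0.ball' {f : (ℕ → A.N) → A.N} {P : A.N → (ℕ → A.N) → Prop} (hf : TDef f)
    (hP : Sig0 fun v => P (v 0) (fun i => v (i + 1))) :
    Sig0 fun v => ∀ x, A.lt x (f v) → P x v := by
  obtain ⟨t, p, h⟩ := hf.out
  obtain ⟨χ, q, ρ, h'⟩ := hP.out
  have h₁ := h.reindex (p' := mix p q) (fun i => 2 * i) (by simp)
  have h₂ := h'.reindex (p' := mix p q) (ρ' := ρ) (fun i => 2 * i + 1) id (by simp) (by simp)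
  generalize t.subst (reindex fun i => 2 * i) = t at h₁
  generalize χ.subst _ id = χ at h₂
  refine ⟨.allN (.imp (.lt (.var 0) t.lift) (χ.subst (mix (scons (.var 0)
    (fun i => .var (2 * i + 1))) (fun i => .var (2 * i + 1 + 1))) id)), mix p q, ρ,
    .ball _ (h₂.1.subst _ _), fun v => forall_congr' fun x => ?_⟩
  have h₃ := h₂.2 (scons x v)
  simp only [scons_zero, scons_succ] at h₃
  simp only [Fm.sat, Tm.eval_lift, ← h₁ v]
  refine imp_congr Iff.rfl (h₃.trans ?_)
  rw [Fm.sat_subst, map_mix, map_scons]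
  simp [Tm.eval]

/-- Substituting definable functions for the variables. -/
theorem Sig0.subst {P : (ℕ → A.N) → Prop} (hP : Sig0 P) {g : ℕ → (ℕ → A.N) → A.N}
    (hg : ∀ i, TDef (g i)) : Sig0 fun v => P fun i => g i v := by
  obtain ⟨θ, p, ρ, h⟩ := hP.out
  choose t q hq using fun i => (hg i).out
  refine ⟨θ.subst (mix (fun i => (t i).subst (reindex fun j => 2 * Nat.pair i j + 1))
    (fun i => .var (2 * (2 * i) + 1))) id, mix p (fun k => q k.unpair.1 k.unpair.2), ρ,
    h.1.subst _ _, fun v => ?_⟩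
  refine (h.2 _).trans ?_
  rw [Fm.sat_subst, map_mix]
  simp only [Tm.eval_subst, Tm.eval, mix_odd, mix_even, Function.comp_id]
  have : ∀ i, (fun k => (reindex (fun j => 2 * Nat.pair i j + 1) k).eval A
      (mix v (mix p fun k => q k.unpair.1 k.unpair.2))) = mix v (q i) :=
    fun i => eval_reindex (by simp) v
  simp only [this, ← hq _ v]

theorem TDef.rename {f : (ℕ → A.N) → A.N} (hf : TDef f) (r : ℕ → ℕ) :
    TDef fun v => f fun i => v (r i) := by
  obtain ⟨t, p, h⟩ := hf.out
  refine ⟨t.subst (mix (fun i => .var (2 * r i)) fun i => .var (2 * i + 1)), p, fun v => ?_⟩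
  refine (h _).trans ?_
  rw [Tm.eval_subst, map_mix]
  simp only [Tm.eval, mix_even, mix_odd]

theorem Sig1.subst {P : (ℕ → A.N) → Prop} (hP : Sig1 P) {g : ℕ → (ℕ → A.N) → A.N}
    (hg : ∀ i, TDef (g i)) : Sig1 fun v => P fun i => g i v := by
  obtain ⟨Q, hQ, h⟩ := hP.out
  have hg' : ∀ i, TDef (scons (fun v => v 0) (fun i v => g i fun j => v (j + 1)) i) := by
    intro i
    cases i with
    | zero => exact .var 0
    | succ i => exact (hg i).rename fun i => i + 1
  refine ⟨_, hQ.subst hg', fun v => (h _).trans (exists_congr fun x => ?_)⟩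
  rw [map_scons (fun f : (ℕ → A.N) → A.N => f (scons x v))]
  rfl

theorem Sig0.subst₂ {R : A.N → A.N → Prop} (hR : Sig0 fun v => R (v 0) (v 1))
    {f g : (ℕ → A.N) → A.N} (hf : TDef f) (hg : TDef g) : Sig0 fun v => R (f v) (g v) := by
  refine hR.subst (g := scons f fun _ => g) fun i => ?_
  cases i
  exacts [hf, hg]

theorem Sig0.subst₁ {R : A.N → Prop} (hR : Sig0 fun v => R (v 0))
    {f : (ℕ → A.N) → A.N} (hf : TDef f) : Sig0 fun v => R (f v) :=
  hR.subst (g := fun _ => f) fun _ => hf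

theorem Sig1.subst₁ {R : A.N → Prop} (hR : Sig1 fun v => R (v 0))
    {f : (ℕ → A.N) → A.N} (hf : TDef f) : Sig1 fun v => R (f v) :=
  hR.subst (g := fun _ => f) fun _ => hf

theorem Sig0.sig1 {P : (ℕ → A.N) → Prop} (hP : Sig0 P) : Sig1 P :=
  ⟨_, hP.subst fun i => TDef.var (i + 1), fun _ => ⟨fun h => ⟨A.zero, h⟩, fun ⟨_, h⟩ => h⟩⟩

theorem Sig0.congr {P Q : (ℕ → A.N) → Prop} (hP : Sig0 P) (h : ∀ v, Q v ↔ P v) : Sig0 Q := by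
  rwa [show Q = P from funext fun v => propext (h v)]

theorem Sig1.congr {P Q : (ℕ → A.N) → Prop} (hP : Sig1 P) (h : ∀ v, Q v ↔ P v) : Sig1 Q := by
  rwa [show Q = P from funext fun v => propext (h v)]

/-- A `Σ⁰₁` predicate of one variable is given by a `Σ⁰₁` formula. -/
theorem Sig1.exists_formula {P : A.N → Prop} (h : Sig1 fun v => P (v 0)) :
    ∃ θ w ρ, IsSigma00 θ ∧ ∀ x, P x ↔ θ.exN.sat A (scons x w) ρ := by
  obtain ⟨Q, hQ, h⟩ := h.out
  obtain ⟨θ, p, ρ, hθ, hr⟩ := hQ.out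
  refine ⟨θ.subst (mix (scons (.var 0) fun _ => .var 1) (fun i => .var (i + 2))) id, p, ρ,
    hθ.subst _ _, fun x => (h fun _ => x).trans ?_⟩
  rw [Fm.sat_exN]
  refine exists_congr fun y => (hr _).trans ?_
  rw [Fm.sat_subst, map_mix, map_scons]
  simp [Tm.eval]

theorem IsSigma00.sig0 {θ : Fm} (hθ : IsSigma00 θ) (ρ : ℕ → A.S) :
    Sig0 fun v : ℕ → A.N => θ.sat A v ρ := by
  refine ⟨θ.subst (fun i => .var (2 * i)) id, fun _ => A.zero, ρ, hθ.subst _ _, fun v => ?_⟩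
  rw [Fm.sat_subst]
  simp [Tm.eval]

/-- A `Σ⁰₁` formula gives a `Σ⁰₁` predicate of its first variable. -/
theorem IsSigma00.sig1_exN {θ : Fm} (hθ : IsSigma00 θ) (w : ℕ → A.N) (ρ : ℕ → A.S) :
    Sig1 fun v : ℕ → A.N => θ.exN.sat A (scons (v 0) w) ρ := by
  have hg : ∀ i, TDef (scons (fun v : ℕ → A.N => v 0) (scons (fun v => v 1) fun i _ => w i) i) := by
    intro i
    match i with
    | 0 => exact .var 0
    | 1 => exact .var 1
    | i + 2 => exact .const (w i)
  refine ⟨_, (hθ.sig0 ρ).subst hg, fun v => ?_⟩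
  rw [Fm.sat_exN]
  refine exists_congr fun x => ?_
  rw [map_scons (fun f : (ℕ → A.N) → A.N => f (scons x v)),
    map_scons (fun f : (ℕ → A.N) → A.N => f (scons x v))]
  rfl

end

/-- Induction for `Σ⁰₁` predicates along `x ↦ x + 1` and the basic axioms. -/
class Str.IsArith (A : Str) : Prop where
  nonempty : Nonempty A.S
  succ_ne_zero : ∀ x, A.add x A.one ≠ A.zero
  succ_inj : ∀ x y, A.add x A.one = A.add y A.one → x = y
  add_zero : ∀ x, A.add x A.zero = x
  add_succ : ∀ x y, A.add x (A.add y A.one) = A.add (A.add x y) A.one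
  mul_zero : ∀ x, A.mul x A.zero = A.zero
  mul_succ : ∀ x y, A.mul x (A.add y A.one) = A.add (A.mul x y) x
  not_lt_zero : ∀ x, ¬ A.lt x A.zero
  lt_succ : ∀ x y, A.lt x (A.add y A.one) ↔ A.lt x y ∨ x = y
  ind : ∀ P : A.N → Prop, Sig1 (fun v => P (v 0)) → P A.zero →
    (∀ x, P x → P (A.add x A.one)) → ∀ x, P x

/-- Comprehension for `Δ⁰₁` predicates. -/
class Str.HasComp (A : Str) : Prop where
  comp : ∀ P : A.N → Prop, Sig1 (fun v => P (v 0)) → Pi1 (fun v => P (v 0)) →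
    ∃ X, ∀ x, A.mem x X ↔ P x

section
variable {A : Str}

theorem Str.Models.isArith (hA : A.Models RCA₀) [Nonempty A.S] : A.IsArith := by
  have X : A.S := Classical.arbitrary _
  refine ⟨‹_›, fun x => ?_, fun x y => ?_, fun x => ?_, fun x y => ?_, fun x => ?_,
    fun x y => ?_, fun x => ?_, fun x y => ?_, fun P hP h0 hs => ?_⟩
  · exact hA _ .succ_ne_zero (fun _ => x) (fun _ => X)
  · exact hA _ .succ_inj (scons x fun _ => y) (fun _ => X)
  · exact hA _ .add_zero (fun _ => x) (fun _ => X)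
  · exact hA _ .add_succ (scons x fun _ => y) (fun _ => X)
  · exact hA _ .mul_zero (fun _ => x) (fun _ => X)
  · exact hA _ .mul_succ (scons x fun _ => y) (fun _ => X)
  · exact hA _ .not_lt_zero (fun _ => x) (fun _ => X)
  · have h := hA _ .lt_succ (scons x fun _ => y) (fun _ => X)
    rw [Fm.sat_iff, Fm.sat_or] at h
    exact h
  · obtain ⟨θ, w, ρ, hθ, h⟩ := hP.exists_formula
    have hi := hA _ (.ind θ.exN ⟨θ, hθ, rfl⟩) w ρ
    simp only [Fm.sat, Fm.sat_and, Fm.sat_instN, Fm.atSucc_eq, Fm.sat_subst] at hi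
    intro x
    refine (h x).2 (hi ⟨(h _).1 h0, fun y hy => ?_⟩ x)
    rw [map_scons]
    exact (h _).1 (hs y ((h y).2 hy))

theorem Str.Models.hasComp (hA : A.Models RCA₀) : A.HasComp := by
  refine ⟨fun P hP hP' => ?_⟩
  obtain ⟨θ, w, ρ, hθ, h⟩ := hP.exists_formula
  obtain ⟨χ, q, π, hχ, h'⟩ := hP'.out.exists_formula (P := fun x => ¬ P x)
  let e : ℕ → Tm := scons (.var 0) fun i => .var (2 * i + 1)
  let o : ℕ → Tm := scons (.var 0) fun i => .var (2 * i + 1 + 1)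
  let φ := (θ.subst (upN e) fun i => 2 * i).exN
  let ψ := (χ.neg.subst (upN o) fun i => 2 * i + 1).allN
  have hφ : ∀ x, φ.sat A (scons x (mix w q)) (mix ρ π) ↔ P x := by
    intro x
    rw [h x, show φ = θ.exN.subst e fun i => 2 * i from rfl, Fm.sat_subst, map_scons]
    have : (mix ρ π ∘ fun i => 2 * i) = ρ := funext fun i => by simp
    rw [this]
    simp [Tm.eval]
  have hψ : ∀ x, ψ.sat A (scons x (mix w q)) (mix ρ π) ↔ P x := by
    intro x
    rw [← not_iff_not, h' x, show ψ = χ.neg.allN.subst o fun i => 2 * i + 1 from rfl,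
      Fm.sat_subst, map_scons]
    have : (mix ρ π ∘ fun i => 2 * i + 1) = π := funext fun i => by simp
    rw [this]
    simp [Tm.eval, Fm.exN, Fm.sat_neg]
  have hc := hA _ (.comp φ ψ ⟨_, hθ.subst _ _, rfl⟩
    ⟨_, (IsSigma00.imp hχ .fal).subst _ _, rfl⟩) (mix w q) (mix ρ π)
  simp only [Fm.sat, Fm.sat_iff, Fm.sat_exS, Fm.sat_liftS, hφ, hψ] at hc
  exact hc fun _ => trivial

theorem Str.models_of_isArith [hA : A.IsArith] [hC : A.HasComp] : A.Models RCA₀ := by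
  intro φ hφ v ρ
  cases hφ with
  | succ_ne_zero => exact hA.succ_ne_zero _
  | succ_inj => exact hA.succ_inj _ _
  | add_zero => exact hA.add_zero _
  | add_succ => exact hA.add_succ _ _
  | mul_zero => exact hA.mul_zero _
  | mul_succ => exact hA.mul_succ _ _
  | not_lt_zero => exact hA.not_lt_zero _
  | lt_succ => rw [Fm.sat_iff, Fm.sat_or]; exact hA.lt_succ _ _
  | ind φ h =>
    obtain ⟨θ, hθ, rfl⟩ := h
    simp only [Fm.sat, Fm.sat_and, Fm.sat_instN, Fm.atSucc_eq, Fm.sat_subst]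
    rintro ⟨h0, hs⟩
    refine hA.ind _ (hθ.sig1_exN v ρ) h0 fun x hx => ?_
    have := hs x hx
    rw [map_scons] at this
    exact this
  | comp φ ψ h h' =>
    obtain ⟨θ, hθ, rfl⟩ := h
    obtain ⟨χ, hχ, rfl⟩ := h'
    simp only [Fm.sat, Fm.sat_iff, Fm.sat_exS, Fm.sat_liftS]
    intro h
    refine hC.comp _ (hθ.sig1_exN v ρ) ⟨?_⟩
    refine ((IsSigma00.imp hχ .fal).sig1_exN v ρ).congr fun w => ?_
    rw [h, Fm.sat_exN, ← not_forall_not]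
    simp [Fm.sat]

end


/-! ### Arithmetic from `Σ⁰₁` induction -/

section
variable {A : Str}

instance : Zero A.N := ⟨A.zero⟩
instance : One A.N := ⟨A.one⟩
instance : Add A.N := ⟨A.add⟩
instance : Mul A.N := ⟨A.mul⟩
instance : LT A.N := ⟨A.lt⟩
instance : Membership A.N A.S := ⟨fun X x => A.mem x X⟩

theorem Sig0.not' [Nonempty A.S] {P : (ℕ → A.N) → Prop} (hP : Sig0 P) : Sig0 fun v => ¬ P v :=
  hP.imp' .false'

theorem Sig0.or' [Nonempty A.S] {P Q : (ℕ → A.N) → Prop} (hP : Sig0 P) (hQ : Sig0 Q) :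
    Sig0 fun v => P v ∨ Q v :=
  (hP.not'.imp' hQ).congr fun _ => or_iff_not_imp_left

variable [hA : A.IsArith]

namespace IsArith

instance : Nonempty A.S := hA.nonempty

theorem zero_add' (x : A.N) : 0 + x = x := by
  refine hA.ind (fun x => 0 + x = x) (Sig0.eq' (.add' (.const 0) (.var 0)) (.var 0)).sig1
    (hA.add_zero _) (fun x hx => ?_) x
  exact (hA.add_succ _ _).trans (congrArg (· + (1 : A.N)) hx)

theorem succ_add' (x y : A.N) : x + 1 + y = x + y + 1 := by
  refine hA.ind (fun y => x + 1 + y = x + y + 1)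
    (Sig0.eq' (.add' (.const (x + 1)) (.var 0)) (.add' (.add' (.const x) (.var 0))
      (.const 1))).sig1
    ?_ (fun y hy => ?_) y
  · exact (hA.add_zero _).trans (congrArg (· + (1 : A.N)) (hA.add_zero x).symm)
  · exact (hA.add_succ _ _).trans (congrArg (· + (1 : A.N)) (hy.trans (hA.add_succ x y).symm))

theorem add_comm' (x y : A.N) : x + y = y + x := by
  refine hA.ind (fun y => x + y = y + x)
    (Sig0.eq' (.add' (.const x) (.var 0)) (.add' (.var 0) (.const x))).sig1
    ((hA.add_zero _).trans (zero_add' x).symm) (fun y hy => ?_) y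
  exact (hA.add_succ _ _).trans ((congrArg (· + (1 : A.N)) hy).trans (succ_add' y x).symm)

theorem add_assoc' (x y z : A.N) : x + y + z = x + (y + z) := by
  refine hA.ind (fun z => x + y + z = x + (y + z))
    (Sig0.eq' (.add' (.const (x + y)) (.var 0)) (.add' (.const x) (.add' (.const y)
      (.var 0)))).sig1
    ?_ (fun z hz => ?_) z
  · exact (hA.add_zero _).trans (congrArg (x + ·) (hA.add_zero y).symm)
  · refine (hA.add_succ _ _).trans ((congrArg (· + (1 : A.N)) hz).trans ?_)
    exact (hA.add_succ x (y + z)).symm.trans (congrArg (x + ·) (hA.add_succ y z).symm)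

instance : AddCommMonoid A.N where
  add_assoc := add_assoc'
  zero_add := zero_add'
  add_zero := hA.add_zero
  add_comm := add_comm'
  nsmul := nsmulRec

theorem zero_mul' (x : A.N) : 0 * x = 0 := by
  refine hA.ind (fun x => 0 * x = 0) (Sig0.eq' (.mul' (.const 0) (.var 0)) (.const 0)).sig1
    (hA.mul_zero _) (fun x hx => ?_) x
  exact (hA.mul_succ _ _).trans ((hA.add_zero _).trans hx)

theorem mul_succ' (x y : A.N) : x * (y + 1) = x * y + x := hA.mul_succ x y

theorem succ_mul' (x y : A.N) : (x + 1) * y = x * y + y := by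
  refine hA.ind (fun y => (x + 1) * y = x * y + y)
    (Sig0.eq' (.mul' (.const (x + 1)) (.var 0)) (.add' (.mul' (.const x) (.var 0))
      (.var 0))).sig1 ?_ (fun y hy => ?_) y
  · exact (hA.mul_zero _).trans ((hA.add_zero _).trans (hA.mul_zero _)).symm
  · change (x + 1) * (y + 1) = x * (y + 1) + (y + 1)
    rw [mul_succ', mul_succ', hy]; abel

theorem mul_comm' (x y : A.N) : x * y = y * x := by
  refine hA.ind (fun y => x * y = y * x)
    (Sig0.eq' (.mul' (.const x) (.var 0)) (.mul' (.var 0) (.const x))).sig1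
    ((hA.mul_zero _).trans (zero_mul' x).symm) (fun y hy => ?_) y
  change x * (y + 1) = (y + 1) * x
  rw [mul_succ', succ_mul', hy]

theorem mul_add' (x y z : A.N) : x * (y + z) = x * y + x * z := by
  refine hA.ind (fun z => x * (y + z) = x * y + x * z)
    (Sig0.eq' (.mul' (.const x) (.add' (.const y) (.var 0))) (.add' (.const (x * y))
      (.mul' (.const x) (.var 0)))).sig1 ?_ (fun z hz => ?_) z
  · change x * (y + 0) = x * y + x * 0
    rw [add_zero, show x * 0 = 0 from hA.mul_zero x, add_zero]
  · change x * (y + (z + 1)) = x * y + x * (z + 1)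
    rw [← add_assoc, mul_succ', mul_succ', hz, add_assoc]

theorem mul_assoc' (x y z : A.N) : x * y * z = x * (y * z) := by
  refine hA.ind (fun z => x * y * z = x * (y * z))
    (Sig0.eq' (.mul' (.const (x * y)) (.var 0)) (.mul' (.const x)
      (.mul' (.const y) (.var 0)))).sig1 ?_ (fun z hz => ?_) z
  · change x * y * 0 = x * (y * 0)
    rw [show y * 0 = 0 from hA.mul_zero y, show x * y * 0 = 0 from hA.mul_zero _,
      show x * 0 = 0 from hA.mul_zero x]
  · change x * y * (z + 1) = x * (y * (z + 1))
    rw [mul_succ', mul_succ', hz, mul_add']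

theorem mul_one' (x : A.N) : x * 1 = x := by
  have := mul_succ' x 0
  rwa [zero_add, show x * 0 = 0 from hA.mul_zero x, zero_add] at this

instance : CommSemiring A.N where
  left_distrib := mul_add'
  right_distrib x y z := by rw [mul_comm', mul_add', mul_comm' z x, mul_comm' z y]
  zero_mul := zero_mul'
  mul_zero := hA.mul_zero
  mul_assoc := mul_assoc'
  one_mul x := by rw [mul_comm', mul_one']
  mul_one := mul_one'
  mul_comm := mul_comm'

theorem lt_iff_exists (x y : A.N) : x < y ↔ ∃ z, y = x + z + 1 := by
  constructor
  · intro h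
    suffices ∀ y, ∃ z, x < y → y = x + z + 1 by
      obtain ⟨z, hz⟩ := this y
      exact ⟨z, hz h⟩
    refine hA.ind _ ⟨_, Sig0.imp' (Sig0.lt' (.const x) (.var 1))
      (Sig0.eq' (.var 1) (.add' (.add' (.const x) (.var 0)) (.const 1))), fun v => Iff.rfl⟩
      ⟨0, fun h => (hA.not_lt_zero x h).elim⟩ fun y ⟨z, hz⟩ => ?_
    by_cases h : x < y
    · exact ⟨z + 1, fun _ => by
        change y + 1 = _
        rw [hz h]; ring⟩
    · refine ⟨0, fun h' => ?_⟩
      rw [((hA.lt_succ x y).1 h').resolve_left h]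
      change y + 1 = _
      ring
  · rintro ⟨z, rfl⟩
    refine hA.ind (fun z => x < x + z + 1) (Sig0.lt' (.const x) (.add' (.add' (.const x)
      (.var 0)) (.const 1))).sig1 ((hA.lt_succ _ _).2 (.inr (add_zero x).symm)) (fun z hz => ?_) z
    refine (hA.lt_succ _ _).2 (.inl ?_)
    change x < x + (z + 1)
    rwa [← add_assoc]

theorem add_cancel (x y z : A.N) (h : x + z = y + z) : x = y := by
  refine hA.ind (fun z => x + z = y + z → x = y) (Sig0.imp' (Sig0.eq' (.add' (.const x) (.var 0))
    (.add' (.const y) (.var 0))) (Sig0.eq' (.const x) (.const y))).sig1 ?_ (fun z hz h => ?_) z h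
  · intro h; rwa [show A.zero = 0 from rfl, add_zero, add_zero] at h
  · refine hz (hA.succ_inj _ _ ?_)
    change x + (z + 1) = y + (z + 1) at h
    rwa [← add_assoc, ← add_assoc] at h

theorem lt_irrefl' (x : A.N) : ¬ x < x := by
  rw [lt_iff_exists]
  rintro ⟨z, hz⟩
  refine hA.succ_ne_zero z (add_cancel _ _ x ?_)
  change z + 1 + x = 0 + x
  rw [zero_add]
  exact ((by ring : z + 1 + x = x + z + 1)).trans hz.symm

theorem lt_trans' {x y z : A.N} (h : x < y) (h' : y < z) : x < z := by
  rw [lt_iff_exists] at *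
  obtain ⟨a, rfl⟩ := h
  obtain ⟨b, rfl⟩ := h'
  exact ⟨a + 1 + b, by ring⟩

theorem eq_zero_or_pos' (x : A.N) : x = 0 ∨ 0 < x := by
  refine hA.ind (fun x => x = 0 ∨ 0 < x) (Sig0.or' (.eq' (.var 0) (.const 0))
    (.lt' (.const 0) (.var 0))).sig1 (.inl rfl) (fun x _ => .inr ?_) x
  exact (lt_iff_exists _ _).2 ⟨x, (congrArg (· + (1 : A.N)) (zero_add x)).symm⟩

theorem trichotomy (x y : A.N) : x < y ∨ x = y ∨ y < x := by
  refine hA.ind (fun y => x < y ∨ x = y ∨ y < x) (Sig0.or' (.lt' (.const x) (.var 0))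
    (.or' (.eq' (.const x) (.var 0)) (.lt' (.var 0) (.const x)))).sig1
    (.inr (eq_zero_or_pos' x)) (fun y hy => ?_) y
  rcases hy with h | h | h
  · exact .inl ((hA.lt_succ _ _).2 (.inl h))
  · exact .inl ((hA.lt_succ _ _).2 (.inr h))
  · obtain ⟨z, rfl⟩ := (lt_iff_exists _ _).1 h
    rcases eq_zero_or_pos' z with rfl | hz
    · exact .inr (.inl (by rw [add_zero]; rfl))
    · obtain ⟨w, rfl⟩ := (lt_iff_exists _ _).1 hz
      refine .inr (.inr ((lt_iff_exists _ _).2 ⟨w, ?_⟩))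
      change _ = y + 1 + w + 1
      ring

open Classical in
noncomputable instance : LinearOrder A.N where
  lt x y := A.lt x y
  le x y := A.lt x y ∨ x = y
  le_refl x := .inr rfl
  le_trans x y z := by
    rintro (h | rfl) (h' | rfl)
    · exact .inl (lt_trans' h h')
    · exact .inl h
    · exact .inl h'
    · exact .inr rfl
  lt_iff_le_not_ge x y := by
    refine ⟨fun h => ⟨.inl h, ?_⟩, ?_⟩
    · rintro (h' | rfl)
      · exact lt_irrefl' x (lt_trans' h h')
      · exact lt_irrefl' _ h
    · rintro ⟨h | rfl, h'⟩
      · exact h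
      · exact (h' (.inr rfl)).elim
  le_antisymm x y := by
    rintro (h | rfl) (h' | h')
    · exact (lt_irrefl' x (lt_trans' h h')).elim
    · exact h'.symm
    · rfl
    · rfl
  le_total x y := by
    rcases trichotomy x y with h | h | h
    · exact .inl (.inl h)
    · exact .inl (.inr h)
    · exact .inr (.inl h)
  toDecidableLE := Classical.decRel _

theorem le_iff_exists (x y : A.N) : x ≤ y ↔ ∃ z, y = x + z := by
  rw [le_iff_lt_or_eq, lt_iff_exists]
  constructor
  · rintro (⟨z, rfl⟩ | rfl)
    · exact ⟨z + 1, by ring⟩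
    · exact ⟨0, (add_zero x).symm⟩
  · rintro ⟨z, rfl⟩
    rcases eq_zero_or_pos' z with rfl | hz
    · exact .inr (add_zero x).symm
    · obtain ⟨w, rfl⟩ := (lt_iff_exists _ _).1 hz
      exact .inl ⟨w, by ring⟩

instance : CanonicallyOrderedAdd A.N where
  exists_add_of_le h := (le_iff_exists _ _).1 h
  le_self_add _ y := (le_iff_exists _ _).2 ⟨y, rfl⟩
  le_add_self _ y := (le_iff_exists _ _).2 ⟨y, add_comm _ _⟩

instance : IsOrderedCancelAddMonoid A.N where
  add_le_add_left x y h z := by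
    obtain ⟨w, rfl⟩ := (le_iff_exists _ _).1 h
    exact (le_iff_exists _ _).2 ⟨w, by ring⟩
  le_of_add_le_add_left x y z h := by
    obtain ⟨w, hw⟩ := (le_iff_exists _ _).1 h
    exact (le_iff_exists _ _).2 ⟨w, add_cancel _ _ x (by rw [add_comm z, hw]; ring)⟩

theorem zero_lt_one' : (0 : A.N) < 1 := (lt_iff_exists _ _).2 ⟨0, by ring⟩

theorem mul_lt_mul_left' (x y z : A.N) (h : y < z) (hx : 0 < x) : x * y < x * z := by
  obtain ⟨a, rfl⟩ := (lt_iff_exists _ _).1 h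
  obtain ⟨b, rfl⟩ := (lt_iff_exists _ _).1 hx
  exact (lt_iff_exists _ _).2 ⟨(0 + b + 1) * a + b, by ring⟩

instance : IsStrictOrderedRing A.N where
  zero_le_one := zero_lt_one'.le
  exists_pair_ne := ⟨0, 1, zero_lt_one'.ne⟩
  mul_lt_mul_of_pos_left x hx y z h := mul_lt_mul_left' x y z h hx
  mul_lt_mul_of_pos_right x hx y z h := by
    simpa only [mul_comm _ x] using mul_lt_mul_left' x y z h hx

end IsArith

theorem lt_add_one_iff' {x y : A.N} : x < y + 1 ↔ x ≤ y :=
  (hA.lt_succ x y).trans (le_iff_lt_or_eq (a := x) (b := y)).symm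

theorem succ_le_iff' {x y : A.N} : x + 1 ≤ y ↔ x < y := by
  rw [← not_lt, lt_add_one_iff', not_le]

theorem eq_zero_or_succ (x : A.N) : x = 0 ∨ ∃ y, x = y + 1 := by
  rcases IsArith.eq_zero_or_pos' x with h | h
  · exact .inl h
  · obtain ⟨y, hy⟩ := (IsArith.lt_iff_exists _ _).1 h
    exact .inr ⟨y, by rw [hy, zero_add]⟩

/-! ### Closure of the definability classes -/

section Def
variable {P Q : (ℕ → A.N) → Prop} {f g : (ℕ → A.N) → A.N} {R : A.N → (ℕ → A.N) → Prop}

instance (i : ℕ) : TDef fun v : ℕ → A.N => v i := .var i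
instance (a : A.N) : TDef fun _ : ℕ → A.N => a := .const a
instance [hf : TDef f] [hg : TDef g] : TDef fun v => f v + g v := hf.add' hg
instance [hf : TDef f] [hg : TDef g] : TDef fun v => f v * g v := hf.mul' hg

instance [hf : TDef f] [hg : TDef g] : Sig0 fun v => f v = g v := .eq' hf hg
instance [hf : TDef f] [hg : TDef g] : Sig0 fun v => f v < g v := .lt' hf hg
instance [hf : TDef f] (X : A.S) : Sig0 fun v => f v ∈ X := .mem' hf X
instance : Sig0 fun _ : ℕ → A.N => False := .false'
instance [hP : Sig0 P] [hQ : Sig0 Q] : Sig0 fun v => P v → Q v := hP.imp' hQ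
instance [hP : Sig0 P] : Sig0 fun v => ¬ P v := hP.not'
instance [hP : Sig0 P] [hQ : Sig0 Q] : Sig0 fun v => P v ∨ Q v := hP.or' hQ
instance [hP : Sig0 P] [hQ : Sig0 Q] : Sig0 fun v => P v ∧ Q v :=
  (hP.imp' hQ.not').not'.congr fun _ => by tauto
instance [hP : Sig0 P] [hQ : Sig0 Q] : Sig0 fun v => P v ↔ Q v :=
  (inferInstance : (Sig0 fun v : ℕ → A.N => (P v → Q v) ∧ (Q v → P v))).congr fun _ => iff_def
instance Sig0.ball [hf : TDef f] [hR : Sig0 fun v => R (v 0) (fun i => v (i + 1))] :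
    Sig0 fun v => ∀ x, x < f v → R x v := .ball' hf hR
instance Sig0.ball_le [hf : TDef f] [hR : Sig0 fun v => R (v 0) (fun i => v (i + 1))] :
    Sig0 fun v => ∀ x, x ≤ f v → R x v :=
  (inferInstance : (Sig0 fun v : ℕ → A.N => ∀ x, x < f v + 1 → R x v)).congr fun _ => by
    simp only [lt_add_one_iff']
instance Sig0.bex [hf : TDef f] [hR : Sig0 fun v => R (v 0) (fun i => v (i + 1))] :
    Sig0 fun v => ∃ x, x < f v ∧ R x v :=
  (inferInstance : (Sig0 fun v : ℕ → A.N => ¬ ∀ x, x < f v → ¬ R x v)).congr fun _ => by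
    push Not; rfl
instance Sig0.bex_le [hf : TDef f] [hR : Sig0 fun v => R (v 0) (fun i => v (i + 1))] :
    Sig0 fun v => ∃ x, x ≤ f v ∧ R x v :=
  (inferInstance : (Sig0 fun v : ℕ → A.N => ∃ x, x < f v + 1 ∧ R x v)).congr fun _ => by
    simp only [lt_add_one_iff']

instance (priority := low) [hP : Sig0 P] : Sig1 P := hP.sig1
instance (priority := low) [hP : Sig0 P] : Pi1 P := ⟨inferInstance⟩

/-- Two existential quantifiers contract to one for a common bound of the witnesses. -/
theorem Sig0.exists₂ {Q : (ℕ → A.N) → Prop} (hQ : Sig0 Q) :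
    Sig1 fun v => ∃ x, ∃ y, Q (scons y (scons x v)) := by
  have : Sig0 fun v : ℕ → A.N =>
      Q (fun i => scons (fun v => v 0) (scons (fun v => v 1) fun i v => v (i + 3)) i v) := by
    refine hQ.subst fun i => ?_
    match i with
    | 0 => exact .var 0
    | 1 => exact .var 1
    | i + 2 => exact .var (i + 3)
  have h : ∀ b x y v, Q (scons y (scons x v)) ↔
      Q (fun i => scons (fun v => v 0) (scons (fun v => v 1) fun i v => v (i + 3)) i
        (scons y (scons x (scons b v)))) := by
    intro b x y v
    rw [map_scons (fun f : (ℕ → A.N) → A.N => f (scons y (scons x (scons b v)))),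
      map_scons (fun f : (ℕ → A.N) → A.N => f (scons y (scons x (scons b v))))]
    rfl
  refine ⟨fun v => ∃ x, x < v 0 ∧ ∃ y, y < v 0 ∧ Q (scons y (scons x fun i => v (i + 1))), ?_,
    fun v => ⟨?_, ?_⟩⟩
  · have h₁ : Sig0 fun v : ℕ → A.N => Q (scons (v 0) (scons (v (0 + 1)) fun i => v (i + 1 + 1 + 1))) :=
      this.congr fun v => ?_
    · infer_instance
    rw [h (v 2)]
    conv_rhs => rw [← scons_head_tail v, ← scons_head_tail fun i => v (i + 1),
      ← scons_head_tail fun i => v (i + 1 + 1)]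
  · rintro ⟨x, y, hxy⟩
    exact ⟨x + y + 1, x, lt_add_one_iff'.2 le_self_add, y, lt_add_one_iff'.2 le_add_self, hxy⟩
  · rintro ⟨b, x, -, y, -, hxy⟩
    exact ⟨x, y, hxy⟩

instance Sig1.ex [hR : Sig1 fun v => R (v 0) (fun i => v (i + 1))] :
    Sig1 fun v => ∃ x, R x v := by
  obtain ⟨Q, hQ, h⟩ := hR.out
  refine hQ.exists₂.congr fun v => exists_congr fun x => ?_
  exact h (scons x v)

instance [hP : Sig1 P] [hQ : Sig1 Q] : Sig1 fun v => P v ∨ Q v := by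
  obtain ⟨P', hP', h⟩ := hP.out
  obtain ⟨Q', hQ', h'⟩ := hQ.out
  refine ⟨_, (inferInstance : Sig0 fun v : ℕ → A.N => P' v ∨ Q' v), fun v => ?_⟩
  rw [h, h', exists_or]

instance [hP : Sig1 P] [hQ : Sig1 Q] : Sig1 fun v => P v ∧ Q v := by
  obtain ⟨P', hP', h⟩ := hP.out
  obtain ⟨Q', hQ', h'⟩ := hQ.out
  have h₁ : Sig0 fun v : ℕ → A.N => P' fun i => v (i + 1) := hP'.subst fun i => TDef.var (i + 1)
  have h₂ : Sig0 fun v : ℕ → A.N => Q' fun i => scons (fun v => v 0) (fun i v => v (i + 2)) i v := by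
    refine hQ'.subst fun i => ?_
    cases i
    exacts [.var 0, .var _]
  refine (Sig0.exists₂ (inferInstance : (Sig0 fun v : ℕ → A.N => P' (fun i => v (i + 1)) ∧
    Q' fun i => scons (fun v => v 0) (fun i v => v (i + 2)) i v))).congr fun v => ?_
  have : ∀ x y, (fun i => scons (fun v : ℕ → A.N => v 0) (fun i v => v (i + 2)) i
      (scons y (scons x v))) = scons y v := by
    intro x y
    rw [map_scons (fun f : (ℕ → A.N) → A.N => f (scons y (scons x v)))]
    rfl
  simp only [this, h, h']
  exact ⟨fun ⟨⟨x, hx⟩, y, hy⟩ => ⟨x, y, hx, hy⟩, fun ⟨x, y, hx, hy⟩ => ⟨⟨x, hx⟩, y, hy⟩⟩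

instance [hP : Pi1 P] : Sig1 fun v => ¬ P v := hP.out
instance [hP : Pi1 P] [hQ : Sig1 Q] : Sig1 fun v => P v → Q v :=
  (inferInstance : (Sig1 fun v : ℕ → A.N => ¬ P v ∨ Q v)).congr fun _ => imp_iff_not_or
instance [hP : Pi1 P] [hQ : Pi1 Q] : Pi1 fun v => P v ∧ Q v :=
  ⟨(inferInstance : (Sig1 fun v : ℕ → A.N => ¬ P v ∨ ¬ Q v)).congr fun _ => not_and_or⟩
instance [hP : Pi1 P] [hQ : Pi1 Q] : Pi1 fun v => P v ∨ Q v :=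
  ⟨(inferInstance : (Sig1 fun v : ℕ → A.N => ¬ P v ∧ ¬ Q v)).congr fun _ => not_or⟩
instance [hP : Sig1 P] [hQ : Pi1 Q] : Pi1 fun v => P v → Q v :=
  ⟨(inferInstance : (Sig1 fun v : ℕ → A.N => P v ∧ ¬ Q v)).congr fun _ => Classical.not_imp⟩
instance Pi1.all [hR : Pi1 fun v => R (v 0) (fun i => v (i + 1))] :
    Pi1 fun v => ∀ x, R x v := by
  have h := hR.out
  exact ⟨(inferInstance : (Sig1 fun v : ℕ → A.N => ∃ x, ¬ R x v)).congr fun _ => not_forall⟩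

/-- `Σ⁰₀` collection. -/
theorem Sig0.collection {R : A.N → A.N → Prop} (hR : Sig0 fun v => R (v 0) (v 1)) {t : A.N}
    (h : ∀ x < t, ∃ y, R y x) : ∃ b, ∀ x < t, ∃ y < b, R y x := by
  have hR' : Sig0 fun v : ℕ → A.N => R (v 0) (v 1) := hR
  suffices ∀ s, s ≤ t → ∃ b, ∀ x < s, ∃ y < b, R y x from this t le_rfl
  refine hA.ind _ inferInstance (fun _ => ⟨0, fun x hx => (hA.not_lt_zero x hx).elim⟩) ?_
  intro s ih hs
  obtain ⟨b, hb⟩ := ih ((lt_add_one_iff'.2 le_rfl).le.trans hs)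
  obtain ⟨y, hy⟩ := h s (succ_le_iff'.1 hs)
  refine ⟨b + y + 1, fun x hx => ?_⟩
  rcases (hA.lt_succ x s).1 hx with hx | rfl
  · obtain ⟨z, hz, hzx⟩ := hb x hx
    exact ⟨z, lt_add_one_iff'.2 (hz.le.trans le_self_add), hzx⟩
  · exact ⟨y, lt_add_one_iff'.2 le_add_self, hy⟩

/-- By collection, a bounded universal quantifier can be moved inside of an existential one. -/
instance Sig1.ball [hf : TDef f] [hR : Sig1 fun v => R (v 0) (fun i => v (i + 1))] :
    Sig1 fun v => ∀ x, x < f v → R x v := by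
  obtain ⟨Q, hQ, h⟩ := hR.out
  have hf' : TDef fun v : ℕ → A.N => f fun i => v (i + 1) := hf.rename _
  have hQ' : Sig0 fun v : ℕ → A.N =>
      Q (fun i => scons (fun v => v 0) (scons (fun v => v 1) fun i v => v (i + 3)) i v) := by
    refine hQ.subst fun i => ?_
    match i with
    | 0 => exact .var 0
    | 1 => exact .var 1
    | i + 2 => exact .var (i + 3)
  have h₁ : Sig0 fun v : ℕ → A.N => Q (scons (v 0) (scons (v (0 + 1)) fun i => v (i + 1 + 1 + 1))) :=
    hQ'.congr fun v => by
      rw [map_scons (fun f : (ℕ → A.N) → A.N => f v), map_scons (fun f : (ℕ → A.N) → A.N => f v)]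
  refine ⟨fun v => ∀ x, x < f (fun i => v (i + 1)) → ∃ y, y < v 0 ∧
    Q (scons y (scons x fun i => v (i + 1))), inferInstance, fun v => ⟨fun hv => ?_, ?_⟩⟩
  · have h₂ : Sig0 fun w : ℕ → A.N => Q (scons (w 0) (scons (w 1) v)) := by
      have hg : ∀ i, TDef (scons (fun w : ℕ → A.N => w 0)
          (scons (fun w => w 1) fun i _ => v i) i) := by
        intro i
        match i with
        | 0 => exact .var 0
        | 1 => exact .var 1
        | i + 2 => exact .const (v i)
      refine (hQ.subst hg).congr fun w => ?_
      rw [map_scons (fun f : (ℕ → A.N) → A.N => f w), map_scons (fun f : (ℕ → A.N) → A.N => f w)]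
    exact h₂.collection (R := fun y x => Q (scons y (scons x v)))
      fun x hx => (h (scons x v)).1 (hv x hx)
  · rintro ⟨b, hb⟩ x hx
    obtain ⟨y, -, hy⟩ := hb x hx
    exact (h (scons x v)).2 ⟨y, hy⟩

end Def
end

section
variable {A : Str} [hA : A.IsArith]

/-! ### Induction, least elements, comprehension -/

theorem sig_ind (P : A.N → Prop) [hP : Sig1 fun v => P (v 0)] (h0 : P 0)
    (hs : ∀ x, P x → P (x + 1)) (x : A.N) : P x := hA.ind P hP h0 hs x

theorem not_lt_zero' (x : A.N) : ¬ x < 0 := hA.not_lt_zero x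

theorem pi_lnp (P : A.N → Prop) [hP : Pi1 fun v => P (v 0)] (h : ∃ x, P x) :
    ∃ x, P x ∧ ∀ y < x, ¬ P y := by
  by_contra! hc
  obtain ⟨a, ha⟩ := h
  have hP' : Sig1 fun v : ℕ → A.N => ¬ P (v 0) := hP.out
  have : ∀ x, ∀ y, y < x → ¬ P y := by
    have : Sig1 fun v : ℕ → A.N => ∀ y, y < v 0 → ¬ P y := inferInstance
    refine sig_ind _ (fun y hy => (not_lt_zero' y hy).elim) fun x ih y hy hPy => ?_
    obtain ⟨z, hz, hPz⟩ := hc y hPy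
    exact ih z (hz.trans_le (lt_add_one_iff'.1 hy)) hPz
  exact this (a + 1) a (lt_add_one_iff'.2 le_rfl) ha

theorem sig_lnp (P : A.N → Prop) [hP : Sig1 fun v => P (v 0)] (h : ∃ x, P x) :
    ∃ x, P x ∧ ∀ y < x, ¬ P y := by
  by_contra! hc
  obtain ⟨a, ha⟩ := h
  -- reverse the numbers below `a`: there is a witness at most `a - x`, for all `x ≤ a`
  have : ∀ x, x ≤ a → ∃ y, P y ∧ x + y ≤ a := by
    have hP' : Sig1 fun v : ℕ → A.N => P (v 0) := hP
    have : Sig1 fun v : ℕ → A.N => v 0 ≤ a → ∃ y, P y ∧ v 0 + y ≤ a := inferInstance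
    refine sig_ind _ (fun _ => ⟨a, ha, by rw [zero_add]⟩) fun x ih hx => ?_
    obtain ⟨y, hy, hxy⟩ := ih (le_self_add.trans hx)
    obtain ⟨z, hz, hPz⟩ := hc y hy
    refine ⟨z, hPz, ?_⟩
    have : x + (z + 1) ≤ x + y := add_le_add_right (succ_le_iff'.2 hz) x
    rw [add_assoc, add_comm 1]
    exact this.trans hxy
  obtain ⟨y, hy, hay⟩ := this a le_rfl
  obtain ⟨z, hz, -⟩ := hc y hy
  have : a + z < a + y := add_lt_add_right hz a
  exact absurd (this.trans_le hay) (not_lt.2 le_self_add)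

omit hA in
theorem exists_set [hC : A.HasComp] (P : A.N → Prop) [h : Sig1 fun v => P (v 0)]
    [h' : Pi1 fun v => P (v 0)] : ∃ X : A.S, ∀ x, x ∈ X ↔ P x := hC.comp P h h'

/-! ### Pairs -/

/-- The pairing `⟨x, y⟩ = (x + y)² + x`. -/
def pr (x y : A.N) : A.N := (x + y) * (x + y) + x

theorem le_mul_self' (x : A.N) : x ≤ x * x := by
  rcases eq_zero_or_succ x with rfl | ⟨y, rfl⟩
  · exact zero_le
  · have : (y + 1) * (y + 1) = (y + 1) + y * (y + 1) := by ring
    rw [this]; exact le_self_add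

theorem left_le_pr (x y : A.N) : x ≤ pr x y := le_add_self

theorem right_le_pr (x y : A.N) : y ≤ pr x y :=
  (le_add_self.trans (le_mul_self' (x + y))).trans le_self_add

theorem pr_lt_pr {x y z w : A.N} (h : x + y < z + w) : pr x y < pr z w := by
  have h₁ := mul_le_mul' (succ_le_iff'.2 h) (succ_le_iff'.2 h)
  have h₂ : (x + y + 1) * (x + y + 1) = pr x y + (x + y + y + 1) := by unfold pr; ring
  rw [h₂] at h₁
  refine lt_of_lt_of_le ?_ (h₁.trans le_self_add)
  have : pr x y < pr x y + (x + y + y) + 1 := lt_add_one_iff'.2 le_self_add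
  rwa [add_assoc] at this

theorem pr_inj {x y z w : A.N} : pr x y = pr z w ↔ x = z ∧ y = w := by
  refine ⟨fun h => ?_, fun ⟨h, h'⟩ => by rw [h, h']⟩
  have hs : x + y = z + w := by
    rcases lt_trichotomy (x + y) (z + w) with h' | h' | h'
    · exact absurd h (pr_lt_pr h').ne
    · exact h'
    · exact absurd h (pr_lt_pr h').ne'
  simp only [pr, hs, add_left_cancel_iff] at h
  subst h
  exact ⟨rfl, add_left_cancel hs⟩

/-! ### Codes of finite sets -/

/-- `x` belongs to the finite set coded by `c`. -/
def InFin (x c : A.N) : Prop :=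
  ∃ k m n, c = pr k (pr m n) ∧ x < k ∧ ∃ q, n = q * (m * (x + 1) + 1)

/-- `c` is the least code of its finite set. -/
def IsCode (c : A.N) : Prop := ∀ c' < c, ¬ ∀ x, InFin x c' ↔ InFin x c

theorem inFin_pr {x k m n : A.N} :
    InFin x (pr k (pr m n)) ↔ x < k ∧ m * (x + 1) + 1 ∣ n := by
  simp only [InFin, pr_inj]
  constructor
  · rintro ⟨_, _, _, ⟨rfl, rfl, rfl⟩, h, q, hq⟩
    exact ⟨h, q, by rw [hq, mul_comm]⟩
  · rintro ⟨h, q, hq⟩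
    exact ⟨_, _, _, ⟨rfl, rfl, rfl⟩, h, q, by rw [hq, mul_comm]⟩

theorem InFin.lt {x c : A.N} (h : InFin x c) : x < c := by
  obtain ⟨k, m, n, rfl, h, -⟩ := h
  exact h.trans_le (left_le_pr _ _)

theorem inFin_iff_bounded {x c : A.N} : InFin x c ↔ ∃ k, k ≤ c ∧ ∃ m, m ≤ c ∧ ∃ n, n ≤ c ∧
    c = (k + ((m + n) * (m + n) + m)) * (k + ((m + n) * (m + n) + m)) + k ∧ x < k ∧
    ∃ q, q ≤ n ∧ n = q * (m * (x + 1) + 1) := by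
  constructor
  · rintro ⟨k, m, n, rfl, h, q, hq⟩
    refine ⟨k, left_le_pr _ _, m, (left_le_pr _ _).trans (right_le_pr _ _), n,
      (right_le_pr _ _).trans (right_le_pr _ _), rfl, h, q, ?_, hq⟩
    have : q * (m * (x + 1) + 1) = q + q * (m * (x + 1)) := by ring
    rw [hq, this]
    exact le_self_add
  · rintro ⟨k, -, m, -, n, -, hc, hx, q, -, hq⟩
    exact ⟨k, m, n, hc, hx, q, hq⟩

theorem isCode_iff_bounded {c : A.N} :
    IsCode c ↔ ∀ c', c' < c → ¬ ∀ x, x < c → (InFin x c' ↔ InFin x c) := by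
  refine forall₂_congr fun c' hc => not_congr (forall_congr' fun x => ?_)
  refine ⟨fun h _ => h, fun h => ?_⟩
  by_cases hx : x < c
  · exact h hx
  · exact iff_of_false (fun h => hx (h.lt.trans hc)) fun h => hx h.lt

section Def
variable {f g : (ℕ → A.N) → A.N}

instance [TDef f] [TDef g] : TDef fun v => pr (f v) (g v) := by
  unfold pr; infer_instance

instance [hf : TDef f] [hg : TDef g] : Sig0 fun v => InFin (f v) (g v) :=
  .subst₂ (by simp only [inFin_iff_bounded]; infer_instance) hf hg

instance [hf : TDef f] : Sig0 fun v => IsCode (f v) :=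
  .subst₁ (by simp only [isCode_iff_bounded]; infer_instance) hf

theorem dvd_iff_bounded {a b : A.N} : a ∣ b ↔ ∃ c, c ≤ b ∧ b = a * c := by
  constructor
  · rintro ⟨c, rfl⟩
    rcases eq_zero_or_succ a with rfl | ⟨d, rfl⟩
    · exact ⟨0, zero_le, by simp⟩
    · exact ⟨c, by rw [add_mul, one_mul]; exact le_add_self, rfl⟩
  · rintro ⟨c, -, h⟩; exact ⟨c, h⟩

instance [hf : TDef f] [hg : TDef g] : Sig0 fun v => f v ∣ g v :=
  .subst₂ (by simp only [dvd_iff_bounded]; infer_instance) hf hg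

end Def

theorem dvd_of_dvd_add {a b c : A.N} (ha : 0 < a) (h : a ∣ b) (h' : a ∣ b + c) : a ∣ c := by
  obtain ⟨p, rfl⟩ := h
  obtain ⟨q, hq⟩ := h'
  have hpq : p ≤ q := by
    refine le_of_mul_le_mul_left ?_ ha
    rw [← hq]; exact le_self_add
  obtain ⟨r, rfl⟩ := exists_add_of_le hpq
  rw [mul_add] at hq
  exact ⟨r, add_left_cancel hq⟩

/-- The numbers `a(i + 1) + e`, for `i < b`, have a positive common multiple. This is needed for
`a, e = 1, 0` and for the moduli in codes of finite sets, where `e = 1`. -/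
theorem exists_common_multiple (a e b : A.N) (h : 0 < a + e) :
    ∃ m, 0 < m ∧ ∀ i < b, a * (i + 1) + e ∣ m := by
  refine sig_ind (fun b => ∃ m, 0 < m ∧ ∀ i, i < b → a * (i + 1) + e ∣ m)
    ⟨1, zero_lt_one, fun i hi => (not_lt_zero' i hi).elim⟩ (fun b ⟨m, hm, ih⟩ => ?_) b
  refine ⟨m * (a * (b + 1) + e), mul_pos hm (h.trans_le ?_), fun i hi => ?_⟩
  · have : a * (b + 1) + e = a + e + a * b := by ring
    rw [this]; exact le_self_add
  · rcases (lt_add_one_iff'.1 hi).lt_or_eq with hi | rfl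
    · exact (ih i hi).mul_right _
    · exact dvd_mul_left _ _

/-- The moduli `m(x + 1) + 1`, `x < b`, are pairwise coprime if all positive numbers up to `b`
divide `m`. -/
theorem dvd_of_dvd_modulus_mul {m b x y k : A.N} (hm : ∀ i < b, 1 * (i + 1) + 0 ∣ m)
    (hx : x < b) (hy : y < b) (hxy : x ≠ y) (h : m * (x + 1) + 1 ∣ (m * (y + 1) + 1) * k) :
    m * (x + 1) + 1 ∣ k := by
  have hpos : 0 < m * (x + 1) + 1 := lt_of_lt_of_le zero_lt_one le_add_self
  have hcop : ∀ j, m * (x + 1) + 1 ∣ m * j → m * (x + 1) + 1 ∣ j := by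
    intro j hj
    refine dvd_of_dvd_add hpos (hj.mul_left (x + 1)) ⟨j, by ring⟩
  obtain ⟨d, hd, hdk⟩ : ∃ d, d + 1 ≤ b ∧ m * (x + 1) + 1 ∣ m * ((d + 1) * k) := by
    rcases lt_or_gt_of_ne hxy with hlt | hlt
    · obtain ⟨d, rfl⟩ := (IsArith.lt_iff_exists _ _).1 hlt
      refine ⟨d, le_trans ?_ hy.le, ?_⟩
      · rw [add_assoc]; exact le_add_self
      · refine dvd_of_dvd_add (b := (m * (x + 1) + 1) * k) hpos (dvd_mul_right _ _) ?_
        convert h using 1; ring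
    · obtain ⟨d, rfl⟩ := (IsArith.lt_iff_exists _ _).1 hlt
      refine ⟨d, le_trans ?_ hx.le, ?_⟩
      · rw [add_assoc]; exact le_add_self
      · refine dvd_of_dvd_add hpos h ⟨k, by ring⟩
  obtain ⟨e, he⟩ := hm d (succ_le_iff'.1 hd)
  refine hcop k ?_
  have := (hcop _ hdk).mul_left e
  convert this using 1
  rw [he]; ring

/-- Bounded `Σ⁰₁` comprehension, with the finite set given by a code: the third component of the
code is the least common multiple of the moduli of the elements. -/
theorem exists_fin (P : A.N → Prop) [hP : Sig1 fun v => P (v 0)] (b : A.N) :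
    ∃ c, IsCode c ∧ ∀ x, InFin x c ↔ x < b ∧ P x := by
  suffices ∃ c, ∀ x, InFin x c ↔ x < b ∧ P x by
    obtain ⟨c, hc⟩ := this
    obtain ⟨d, hd, hmin⟩ := sig_lnp (fun d => ∀ x, x < c → (InFin x d ↔ InFin x c))
      ⟨c, fun _ _ => Iff.rfl⟩
    have hdc : d ≤ c := not_lt.1 fun h => hmin c h fun _ _ => Iff.rfl
    have hd' : ∀ x, InFin x d ↔ InFin x c := fun x => by
      by_cases hx : x < c
      · exact hd x hx
      · exact iff_of_false (fun h => hx (h.lt.trans_le hdc)) fun h => hx h.lt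
    exact ⟨d, fun e he h => hmin e he fun x _ => (h x).trans (hd' x),
      fun x => (hd' x).trans (hc x)⟩
  have hP' : Sig1 fun v : ℕ → A.N => P (v 0) := hP
  obtain ⟨m, hm, hdvd⟩ := exists_common_multiple 1 0 b (by rw [add_zero]; exact zero_lt_one)
  obtain ⟨n₀, hn₀, hn₀'⟩ := exists_common_multiple m 1 b (hm.trans_le le_self_add)
  -- the condition on `n` is `Π⁰₁`, so the least common multiple exists though `P` is undecided
  obtain ⟨n, ⟨hn, hnP⟩, hmin⟩ := pi_lnp
    (fun n => 0 < n ∧ ∀ x, x < b → P x → m * (x + 1) + 1 ∣ n) ⟨n₀, hn₀, fun x hx _ => hn₀' x hx⟩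
  refine ⟨pr b (pr m n), fun x => inFin_pr.trans (and_congr_right fun hx => ⟨fun h => ?_, hnP x hx⟩)⟩
  by_contra hPx
  -- division by the modulus of `x` would give a smaller common multiple
  obtain ⟨n', rfl⟩ := h
  have hn' : 0 < n' := pos_of_mul_pos_right hn (zero_le)
  refine hmin n' ?_ ⟨hn', fun y hy hPy => ?_⟩
  · have h₁ : (m * (x + 1) + 1) * n' = m * (x + 1) * n' + n' := by ring
    rw [h₁]
    exact lt_add_of_pos_left _ (mul_pos (mul_pos hm (lt_of_lt_of_le zero_lt_one le_add_self)) hn')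
  · exact dvd_of_dvd_modulus_mul hdvd hy hx (fun h => hPx (h ▸ hPy)) (hnP y hy hPy)

theorem IsCode.ext {c d : A.N} (hc : IsCode c) (hd : IsCode d) (h : ∀ x, InFin x c ↔ InFin x d) :
    c = d := by
  rcases lt_trichotomy c d with h' | h' | h'
  · exact (hd c h' h).elim
  · exact h'
  · exact (hc d h' fun x => (h x).symm).elim

end
section
variable {A : Str} [hA : A.IsArith]

/-! ### The two principles in a structure -/

/-- Reading of `quasiOrder`. -/
def QuasiOrder (D : A.N → Prop) (L : A.N → A.N → Prop) : Prop :=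
  (∀ x y, L x y → D x ∧ D y) ∧ (∀ x, D x → L x x) ∧ ∀ x y z, L x y → L y z → L x z

/-- Reading of `seqIn`. -/
def SeqIn (F : A.S) (D : A.N → Prop) : Prop :=
  (∀ i, ∃ x, D x ∧ pr i x ∈ F) ∧ ∀ i x y, pr i x ∈ F → pr i y ∈ F → x = y

/-- Reading of `wqo`. -/
def Wqo (D : A.N → Prop) (L : A.N → A.N → Prop) : Prop :=
  QuasiOrder D L ∧ ∀ F, SeqIn F D → ∃ i j x y, i < j ∧ pr i x ∈ F ∧ pr j y ∈ F ∧ L x y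

/-- Reading of `linearOrder`. -/
def LinOrder (D : A.N → Prop) (L : A.N → A.N → Prop) : Prop :=
  QuasiOrder D L ∧ (∀ x y, L x y → L y x → x = y) ∧ ∀ x y, D x → D y → L x y ∨ L y x

/-- Reading of `strict`. -/
def StrictOf (L : A.N → A.N → Prop) (x y : A.N) : Prop := L x y ∧ ¬ x = y

/-- Reading of `wellFounded`. -/
def WellFdd (L : A.N → A.N → Prop) : Prop :=
  ∀ Y : A.S, (∀ x, (∀ y, StrictOf L y x → y ∈ Y) → x ∈ Y) → ∀ x, x ∈ Y

/-- Reading of `wellOrder`. -/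
def WellOrd (D : A.N → Prop) (L : A.N → A.N → Prop) : Prop := WellFdd L ∧ LinOrder D L

/-- Reading of `entry`. -/
def Entry (s i x : A.N) : Prop := InFin (pr i x) s

/-- Reading of `isSeq`. -/
def IsSeq (s l : A.N) : Prop :=
  IsCode s ∧ (∀ z, InFin z s → ∃ i x, i < l ∧ z = pr i x) ∧
  (∀ i, i < l → ∃ x, Entry s i x) ∧ ∀ i x y, Entry s i x → Entry s i y → x = y

/-- Reading of `powDom`. -/
def PowDom (n : A.N) (D : A.N → Prop) (s : A.N) : Prop :=
  IsSeq s n ∧ ∀ i x, Entry s i x → D x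

/-- Reading of `powLe`. -/
def PowLe (n : A.N) (D : A.N → Prop) (L : A.N → A.N → Prop) (s t : A.N) : Prop :=
  PowDom n D s ∧ PowDom n D t ∧ ∀ i x y, Entry s i x → Entry t i y → L x y

/-- Reading of `expDom`. -/
def ExpDom (D : A.N → Prop) (L : A.N → A.N → Prop) (s : A.N) : Prop :=
  (∃ l, IsSeq s l) ∧ (∀ i x, Entry s i x → D x) ∧ ∀ x, Entry s 0 x → ∃ y, StrictOf L y x

/-- Reading of `expLt`. -/
def ExpLt (L : A.N → A.N → Prop) (s t : A.N) : Prop :=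
  ∃ k l, IsSeq s k ∧ IsSeq t l ∧ (k < l ∨ (k = l ∧ ∃ i x y, Entry s i x ∧ Entry t i y ∧
    StrictOf L x y ∧ ∀ j, j < i → ∀ z, Entry s j z ↔ Entry t j z))

/-- Reading of `expLe`. -/
def ExpLe (D : A.N → Prop) (L : A.N → A.N → Prop) (s t : A.N) : Prop :=
  ExpDom D L s ∧ ExpDom D L t ∧ (s = t ∨ ExpLt L s t)

set_option linter.unusedSimpArgs false in
omit hA in
theorem sat_WQPprod (v : ℕ → A.N) (ρ : ℕ → A.S) : WQPprod.sat A v ρ ↔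
    ∀ (n : A.N) (Q R : A.S), Wqo (fun x => x ∈ Q) (fun x y => pr x y ∈ R) →
      Wqo (PowDom n fun x => x ∈ Q) (PowLe n (fun x => x ∈ Q) fun x y => pr x y ∈ R) := by
  simp only [WQPprod, WQPprodPF, all, ex, allSet, eqF, ltF, memF, notF, impF, andF, orF, iffF,
    quasiOrder, seqIn, wqo, inFin, isCode, entry, isSeq, powDom, powLe,
    Fm.sat, Fm.sat_and, Fm.sat_or, Fm.sat_iff, Fm.sat_exN, Fm.sat_neg]
  exact Iff.rfl

set_option maxHeartbeats 1600000 in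
set_option linter.unusedSimpArgs false in
omit hA in
theorem sat_WOPexp (v : ℕ → A.N) (ρ : ℕ → A.S) : WOPexp.sat A v ρ ↔
    ∀ X : A.S, WellOrd (fun x => pr x x ∈ X) (fun x y => pr x y ∈ X) →
      WellOrd (ExpDom (fun x => pr x x ∈ X) fun x y => pr x y ∈ X)
        (ExpLe (fun x => pr x x ∈ X) fun x y => pr x y ∈ X) := by
  simp (maxSteps := 1000000) only [WOPexp, WOPexpPF, all, ex, allSet, eqF, ltF, memF, notF, impF, andF, orF, iffF,
    quasiOrder, linearOrder, strict, wellFounded, wellOrder, inFin, isCode, entry, isSeq,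
    expDom, expLt, expLe,
    Fm.sat, Fm.sat_and, Fm.sat_or, Fm.sat_iff, Fm.sat_exN, Fm.sat_neg]
  refine forall_congr' fun X => imp_congr Iff.rfl (and_congr Iff.rfl
    (and_congr (and_congr Iff.rfl (and_congr ?_ Iff.rfl)) Iff.rfl))
  -- the simplifier has already evaluated `x = x` in the reflexivity clause
  exact forall_congr' fun x => imp_congr Iff.rfl
    ⟨fun h => ⟨h.1, h.2.1, .inl rfl⟩, fun h => ⟨h.1, h.2.1, .inl trivial⟩⟩

end
section
variable {A : Str} [hA : A.IsArith]

/-! ### Definable functions -/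

/-- `F` is the graph of `f`. -/
def IsGraph (F : A.S) (f : A.N → A.N) : Prop := ∀ i x, pr i x ∈ F ↔ f i = x

omit hA in
theorem SeqIn.exists_fun {F : A.S} {D : A.N → Prop} (h : SeqIn F D) :
    ∃ f, IsGraph F f ∧ ∀ i, D (f i) := by
  choose f hf using h.1
  exact ⟨f, fun i x => ⟨fun hx => h.2 i _ _ (hf i).2 hx, fun hx => hx ▸ (hf i).2⟩,
    fun i => (hf i).1⟩

omit hA in
theorem IsGraph.seqIn {F : A.S} {f : A.N → A.N} (h : IsGraph F f) {D : A.N → Prop}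
    (hD : ∀ i, D (f i)) : SeqIn F D :=
  ⟨fun i => ⟨f i, hD i, (h i _).2 rfl⟩, fun i x y hx hy => by
    rw [← (h i x).1 hx, ← (h i y).1 hy]⟩

/-- A total functional `Σ⁰₁` relation is a set. -/
theorem exists_graph [A.HasComp] (R : A.N → A.N → Prop) [hR : Sig1 fun v => R (v 0) (v 1)]
    (htot : ∀ i, ∃ x, R i x) (hfun : ∀ i x y, R i x → R i y → x = y) :
    ∃ F f, IsGraph F f ∧ ∀ i, R i (f i) := by
  have h₁ : Sig1 fun v : ℕ → A.N => R (v 1) (v 0) :=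
    hR.subst (g := scons (fun v => v 1) fun _ v => v 0) fun i => by
      cases i
      exacts [.var 1, .var 0]
  choose f hf using htot
  have hRf : ∀ i x, R i x ↔ f i = x := fun i x => ⟨fun h => hfun i _ _ (hf i) h, fun h => h ▸ hf i⟩
  have h₂ : Pi1 fun v : ℕ → A.N => ∃ i, ∃ x, v 0 = pr i x ∧ R i x := by
    have h₃ : Sig1 fun v : ℕ → A.N => (∀ i, i < v 0 + 1 → ∀ x, x < v 0 + 1 → ¬ v 0 = pr i x) ∨
        ∃ i, ∃ x, ∃ y, v 0 = pr i x ∧ R i y ∧ ¬ x = y := by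
      have : Sig1 fun v : ℕ → A.N => R (v 2) (v 0) :=
        hR.subst (g := scons (fun v => v 2) fun _ v => v 0) fun i => by
          cases i
          exacts [.var 2, .var 0]
      infer_instance
    refine ⟨h₃.congr fun v => ?_⟩
    constructor
    · intro h
      by_cases hp : ∃ i x, v 0 = pr i x
      · obtain ⟨i, x, hix⟩ := hp
        exact .inr ⟨i, x, f i, hix, hf i, fun hx => h ⟨i, x, hix, hx ▸ hf i⟩⟩
      · exact .inl fun i _ x _ hix => hp ⟨i, x, hix⟩
    · rintro (h | ⟨i, x, y, hix, hy, hxy⟩) ⟨j, z, hjz, hz⟩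
      · refine h j ?_ z ?_ hjz
        · rw [hjz]; exact lt_add_one_iff'.2 (left_le_pr _ _)
        · rw [hjz]; exact lt_add_one_iff'.2 (right_le_pr _ _)
      · obtain ⟨rfl, rfl⟩ := pr_inj.1 (hix.symm.trans hjz)
        exact hxy (hfun _ _ _ hz hy)
  have h₄ : Sig1 fun v : ℕ → A.N => ∃ i, ∃ x, v 0 = pr i x ∧ R i x := inferInstance
  obtain ⟨F, hF⟩ := exists_set fun z => ∃ i, ∃ x, z = pr i x ∧ R i x
  refine ⟨F, f, fun i x => ?_, hf⟩
  rw [hF, ← hRf]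
  constructor
  · rintro ⟨j, y, h, hy⟩
    obtain ⟨rfl, rfl⟩ := pr_inj.1 h
    exact hy
  · exact fun h => ⟨i, x, rfl, h⟩

omit hA in
theorem IsGraph.mem {F : A.S} {f : A.N → A.N} (h : IsGraph F f) (i : A.N) : pr i (f i) ∈ F :=
  (h i _).2 rfl

/-! ### Finite sequences -/

theorem Entry.lt_left {s i x : A.N} (h : Entry s i x) : i < s := (left_le_pr i x).trans_lt h.lt

theorem Entry.lt_right {s i x : A.N} (h : Entry s i x) : x < s := (right_le_pr i x).trans_lt h.lt

theorem IsSeq.lt {s l i x : A.N} (h : IsSeq s l) (hi : Entry s i x) : i < l := by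
  obtain ⟨j, y, hj, h⟩ := h.2.1 _ hi
  rwa [(pr_inj.1 h).1]

omit hA in
theorem IsSeq.eq {s l i x y : A.N} (h : IsSeq s l) (hx : Entry s i x) (hy : Entry s i y) : x = y :=
  h.2.2.2 i x y hx hy

theorem IsSeq.length_unique {s k l : A.N} (hk : IsSeq s k) (hl : IsSeq s l) : k = l := by
  rcases lt_trichotomy k l with h | h | h
  · obtain ⟨x, hx⟩ := hl.2.2.1 k h
    exact absurd (hk.lt hx) (lt_irrefl _)
  · exact h
  · obtain ⟨x, hx⟩ := hk.2.2.1 l h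
    exact absurd (hl.lt hx) (lt_irrefl _)

theorem IsSeq.length_le {s l : A.N} (h : IsSeq s l) : l ≤ s := by
  rcases eq_zero_or_succ l with rfl | ⟨k, rfl⟩
  · exact zero_le
  · obtain ⟨x, hx⟩ := h.2.2.1 k (lt_add_one_iff'.2 le_rfl)
    exact succ_le_iff'.2 hx.lt_left

theorem IsSeq.ext {s t l : A.N} (hs : IsSeq s l) (ht : IsSeq t l)
    (h : ∀ i x y, Entry s i x → Entry t i y → x = y) : s = t := by
  refine hs.1.ext ht.1 fun z => ⟨fun hz => ?_, fun hz => ?_⟩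
  · obtain ⟨i, x, hi, rfl⟩ := hs.2.1 z hz
    obtain ⟨y, hy⟩ := ht.2.2.1 i hi
    rwa [h i x y hz hy]
  · obtain ⟨i, y, hi, rfl⟩ := ht.2.1 z hz
    obtain ⟨x, hx⟩ := hs.2.2.1 i hi
    rwa [← h i x y hx hz]

theorem isSeq_iff_bounded {s l : A.N} : IsSeq s l ↔ IsCode s ∧
    (∀ z, z < s → InFin z s → ∃ i, i < l ∧ ∃ x, x < s ∧ z = pr i x) ∧
    (∀ i, i < l → ∃ x, x < s ∧ InFin (pr i x) s) ∧
    ∀ i, i < s → ∀ x, x < s → ∀ y, y < s → InFin (pr i x) s → InFin (pr i y) s → x = y := by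
  refine and_congr_right fun _ => and_congr ?_ (and_congr ?_ ?_)
  · refine forall_congr' fun z => ⟨fun h _ hz => ?_, fun h hz => ?_⟩
    · obtain ⟨i, x, hi, rfl⟩ := h hz
      exact ⟨i, hi, x, Entry.lt_right hz, rfl⟩
    · obtain ⟨i, hi, x, -, h⟩ := h hz.lt hz
      exact ⟨i, x, hi, h⟩
  · refine forall₂_congr fun i hi => exists_congr fun x => ⟨fun h => ⟨h.lt_right, h⟩, fun h => h.2⟩
  · exact ⟨fun h i _ x _ y _ => h i x y, fun h i x y hx hy =>
      h i hx.lt_left x hx.lt_right y hy.lt_right hx hy⟩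

section Def
variable {f g h : (ℕ → A.N) → A.N}

instance [TDef f] [TDef g] [TDef h] : Sig0 fun v => Entry (f v) (g v) (h v) :=
  inferInstanceAs (Sig0 fun v => InFin (pr (g v) (h v)) (f v))

instance [hf : TDef f] [hg : TDef g] : Sig0 fun v => IsSeq (f v) (g v) :=
  .subst₂ (by simp only [isSeq_iff_bounded]; infer_instance) hf hg

end Def

/-! ### Lexicographic comparison -/

/-- `s` is smaller than `t` at place `i`, the first place where they differ. -/
def LexAt (L : A.N → A.N → Prop) (s t i : A.N) : Prop :=
  ∃ x y, Entry s i x ∧ Entry t i y ∧ StrictOf L x y ∧ ∀ j, j < i → ∀ z, Entry s j z ↔ Entry t j z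

variable {D : A.N → Prop} {L : A.N → A.N → Prop} {s t u k l : A.N}

theorem expLt_iff (hs : IsSeq s k) (ht : IsSeq t l) :
    ExpLt L s t ↔ k < l ∨ k = l ∧ ∃ i, LexAt L s t i := by
  constructor
  · rintro ⟨k', l', hk, hl, h⟩
    obtain rfl := hs.length_unique hk
    obtain rfl := ht.length_unique hl
    exact h
  · exact fun h => ⟨k, l, hs, ht, h⟩

theorem ExpLt.irrefl : ¬ ExpLt L s s := by
  rintro ⟨k, l, hk, hl, h⟩
  obtain rfl := hk.length_unique hl
  rcases h with h | ⟨-, i, x, y, hx, hy, hxy, -⟩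
  · exact lt_irrefl _ h
  · exact hxy.2 (hk.eq hx hy)

omit hA in
theorem StrictOf.trans (hL : LinOrder D L) {x y z : A.N} (h : StrictOf L x y)
    (h' : StrictOf L y z) : StrictOf L x z := by
  refine ⟨hL.1.2.2 _ _ _ h.1 h'.1, ?_⟩
  rintro rfl
  exact h.2 (hL.2.1 _ _ h.1 h'.1)

theorem ExpLt.trans (hL : LinOrder D L) (h : ExpLt L s t) (h' : ExpLt L t u) : ExpLt L s u := by
  obtain ⟨k, l, hs, ht, h⟩ := h
  obtain ⟨l', m, ht', hu, h'⟩ := h'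
  obtain rfl := ht.length_unique ht'
  refine ⟨k, m, hs, hu, ?_⟩
  rcases h with h | ⟨rfl, i, x, y, hx, hy, hxy, hi⟩
  · rcases h' with h' | ⟨rfl, -⟩
    · exact .inl (h.trans h')
    · exact .inl h
  · rcases h' with h' | ⟨rfl, j, y', z, hy', hz, hyz, hj⟩
    · exact .inl h'
    · refine .inr ⟨rfl, ?_⟩
      rcases lt_trichotomy i j with hij | rfl | hij
      · exact ⟨i, x, y, hx, (hj i hij y).1 hy, hxy,
          fun p hp w => (hi p hp w).trans (hj p (hp.trans hij) w)⟩
      · obtain rfl := ht.eq hy hy'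
        exact ⟨i, x, z, hx, hz, hxy.trans hL hyz, fun p hp w => (hi p hp w).trans (hj p hp w)⟩
      · exact ⟨j, y', z, (hi j hij y').2 hy', hz, hyz,
          fun p hp w => (hi p (hp.trans hij) w).trans (hj p hp w)⟩

theorem ExpLt.total (hL : LinOrder D L) (hs : IsSeq s k) (ht : IsSeq t l)
    (hsD : ∀ i x, Entry s i x → D x) (htD : ∀ i x, Entry t i x → D x) :
    s = t ∨ ExpLt L s t ∨ ExpLt L t s := by
  rcases lt_trichotomy k l with h | rfl | h
  · exact .inr (.inl ⟨k, l, hs, ht, .inl h⟩)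
  · by_cases hst : ∃ i, ∃ x, ∃ y, Entry s i x ∧ Entry t i y ∧ ¬ x = y
    · obtain ⟨i, ⟨x, y, hx, hy, hxy⟩, hmin⟩ := sig_lnp
        (fun i => ∃ x, ∃ y, Entry s i x ∧ Entry t i y ∧ ¬ x = y) hst
      have hagree : ∀ j < i, ∀ z, Entry s j z ↔ Entry t j z := by
        intro j hj z
        have hjk : j < k := hj.trans (hs.lt hx)
        obtain ⟨a, ha⟩ := hs.2.2.1 j hjk
        obtain ⟨b, hb⟩ := ht.2.2.1 j hjk
        have hab : a = b := by
          by_contra hne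
          exact hmin j hj ⟨a, b, ha, hb, hne⟩
        subst hab
        exact ⟨fun h => hs.eq ha h ▸ hb, fun h => ht.eq hb h ▸ ha⟩
      rcases hL.2.2 x y (hsD i x hx) (htD i y hy) with h | h
      · exact .inr (.inl ⟨k, k, hs, ht, .inr ⟨rfl, i, x, y, hx, hy, ⟨h, hxy⟩, hagree⟩⟩)
      · exact .inr (.inr ⟨k, k, ht, hs, .inr ⟨rfl, i, y, x, hy, hx, ⟨h, Ne.symm hxy⟩,
          fun j hj z => (hagree j hj z).symm⟩⟩)
    · refine .inl (hs.ext ht fun i x y hx hy => ?_)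
      by_contra hxy
      exact hst ⟨i, x, y, hx, hy, hxy⟩
  · exact .inr (.inr ⟨l, k, ht, hs, .inl h⟩)

theorem linOrder_exp (hL : LinOrder D L) : LinOrder (ExpDom D L) (ExpLe D L) := by
  refine ⟨⟨fun s t h => ⟨h.1, h.2.1⟩, fun s h => ⟨h, h, .inl rfl⟩, ?_⟩, ?_, ?_⟩
  · rintro s t u ⟨hs, ht, rfl | h⟩ ⟨-, hu, rfl | h'⟩
    · exact ⟨hs, hs, .inl rfl⟩
    · exact ⟨hs, hu, .inr h'⟩
    · exact ⟨hs, ht, .inr h⟩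
    · exact ⟨hs, hu, .inr (h.trans hL h')⟩
  · rintro s t ⟨hs, ht, rfl | h⟩ ⟨-, -, h' | h'⟩
    · rfl
    · rfl
    · exact h'.symm
    · exact (ExpLt.irrefl (h.trans hL h')).elim
  · intro s t hs ht
    obtain ⟨k, hk⟩ := hs.1
    obtain ⟨l, hl⟩ := ht.1
    rcases ExpLt.total hL hk hl hs.2.1 ht.2.1 with h | h | h
    · exact .inl ⟨hs, ht, .inl h⟩
    · exact .inl ⟨hs, ht, .inr h⟩
    · exact .inr ⟨ht, hs, .inr h⟩

theorem expLt_iff_bounded {X : A.S} : ExpLt (fun x y => pr x y ∈ X) s t ↔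
    ∃ k, k ≤ s ∧ ∃ l, l ≤ t ∧ IsSeq s k ∧ IsSeq t l ∧ (k < l ∨ (k = l ∧ ∃ i, i < s ∧ ∃ x, x < s ∧
      ∃ y, y < t ∧ Entry s i x ∧ Entry t i y ∧ pr x y ∈ X ∧ ¬ x = y ∧
      ∀ j, j < i → ∀ z, z < s + t → (Entry s j z ↔ Entry t j z))) := by
  constructor
  · rintro ⟨k, l, hk, hl, h⟩
    refine ⟨k, hk.length_le, l, hl.length_le, hk, hl, h.imp_right ?_⟩
    rintro ⟨rfl, i, x, y, hx, hy, hxy, h⟩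
    exact ⟨rfl, i, hx.lt_left, x, hx.lt_right, y, hy.lt_right, hx, hy, hxy.1, hxy.2,
      fun j hj z _ => h j hj z⟩
  · rintro ⟨k, -, l, -, hk, hl, h⟩
    refine ⟨k, l, hk, hl, h.imp_right ?_⟩
    rintro ⟨rfl, i, -, x, -, y, -, hx, hy, hxy, hne, h⟩
    refine ⟨rfl, i, x, y, hx, hy, ⟨hxy, hne⟩, fun j hj z => ?_⟩
    by_cases hz : z < s + t
    · exact h j hj z hz
    · exact iff_of_false (fun h => hz (h.lt_right.trans_le le_self_add))
        fun h => hz (h.lt_right.trans_le le_add_self)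

instance {X : A.S} {f g : (ℕ → A.N) → A.N} [hf : TDef f] [hg : TDef g] :
    Sig0 fun v => ExpLt (fun x y => pr x y ∈ X) (f v) (g v) :=
  .subst₂ (R := ExpLt fun x y => pr x y ∈ X) (by simp only [expLt_iff_bounded]; infer_instance)
    hf hg

/-! ### Descending sequences -/

variable [hC : A.HasComp]

/-- In a well-order of the structure, a descending sequence of the structure is eventually
constant. If the terms are bounded as numbers, their range is a finite set without minimum.
Otherwise, the terms that exceed all earlier terms form a set without minimum. -/
theorem WellOrd.not_descending {X F : A.S}
    (hX : WellOrd (fun x => pr x x ∈ X) fun x y => pr x y ∈ X) {f : A.N → A.N} (hf : IsGraph F f)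
    (hdesc : ∀ i j, i ≤ j → pr (f j) (f i) ∈ X) (hne : ∀ i, ∃ j, i < j ∧ ¬ f j = f i) : False := by
  by_cases hb : ∃ b, ∀ i, f i < b
  · obtain ⟨b, hb⟩ := hb
    obtain ⟨c, -, hc⟩ := exists_fin (fun x => ∃ i, pr i x ∈ F) b
    have hmem : ∀ i, InFin (f i) c := fun i => (hc _).2 ⟨hb i, i, hf.mem i⟩
    obtain ⟨Y, hY⟩ := exists_set fun x => ¬ InFin x c
    refine (hY _).1 (hX.1 Y (fun x hx => (hY x).2 fun hxc => ?_) (f 0)) (hmem 0)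
    obtain ⟨-, i, hi⟩ := (hc x).1 hxc
    obtain rfl := (hf i x).1 hi
    obtain ⟨j, hij, hj⟩ := hne i
    exact (hY _).1 (hx (f j) ⟨hdesc i j hij.le, hj⟩) (hmem j)
  · push Not at hb
    have hrec : ∀ k x, (pr k x ∈ F ∧ ∀ j, j < k → ∃ y, y < x ∧ pr j y ∈ F) ↔
        f k = x ∧ ∀ j < k, f j < x := by
      intro k x
      refine and_congr (hf k x) (forall₂_congr fun j _ => ⟨?_, fun h => ⟨_, h, hf.mem j⟩⟩)
      rintro ⟨y, hy, hjy⟩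
      rwa [(hf j y).1 hjy]
    -- once a term exceeds `x`, no later term is equal to `x` and exceeds all earlier ones
    have hpi : Pi1 fun v : ℕ → A.N =>
        ∃ k, pr k (v 0) ∈ F ∧ ∀ j, j < k → ∃ y, y < v 0 ∧ pr j y ∈ F := by
      refine ⟨(inferInstance : Sig1 fun v : ℕ → A.N => ∃ k, ∃ z, pr k z ∈ F ∧ v 0 < z ∧
        ∀ j, j ≤ k → ¬ (pr j (v 0) ∈ F ∧ ∀ i, i < j → ∃ y, y < v 0 ∧ pr i y ∈ F)).congr fun v => ?_⟩
      simp only [hrec]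
      constructor
      · intro h
        obtain ⟨k, hk⟩ := hb (v 0 + 1)
        exact ⟨k, f k, hf.mem k, succ_le_iff'.1 hk, fun j _ hj => h ⟨j, hj⟩⟩
      · rintro ⟨k, z, hz, hlt, h⟩ ⟨j, hj⟩
        obtain rfl := (hf k z).1 hz
        exact h j (not_lt.1 fun hkj => lt_asymm hlt (hj.2 k hkj)) hj
    obtain ⟨Y, hY⟩ := exists_set fun x => ¬ ∃ k, pr k x ∈ F ∧ ∀ j, j < k → ∃ y, y < x ∧ pr j y ∈ F
    simp only [hrec] at hY
    refine (hY _).1 (hX.1 Y (fun x hx => (hY x).2 ?_) (f 0))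
      ⟨0, rfl, fun j hj => (not_lt_zero' j hj).elim⟩
    rintro ⟨k, rfl, hk⟩
    obtain ⟨j, ⟨z, hz, hlt⟩, hmin⟩ := sig_lnp (fun j => ∃ z, pr j z ∈ F ∧ f k < z) (by
      obtain ⟨i, hi⟩ := hb (f k + 1)
      exact ⟨i, f i, hf.mem i, succ_le_iff'.1 hi⟩)
    obtain rfl := (hf j z).1 hz
    have hkj : k ≤ j := not_lt.1 fun h => lt_asymm hlt (hk j h)
    refine (hY _).1 (hx (f j) ⟨hdesc k j hkj, hlt.ne'⟩) ⟨j, rfl, fun i hi => ?_⟩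
    exact lt_of_not_ge fun h => hmin i hi ⟨f i, hf.mem i, hlt.trans_le h⟩

/-- Dependent choice for `Σ⁰₀` relations, by primitive recursion: the next term is the number with
the least code. -/
theorem exists_iteration (Z : A.N → Prop) (W : A.N → A.N → Prop) [hZ : Sig0 fun v => Z (v 0)]
    [hW : Sig0 fun v => W (v 0) (v 1)] {z₀ : A.N} (hz₀ : Z z₀) (h : ∀ s, Z s → ∃ t, Z t ∧ W s t) :
    ∃ F f, IsGraph F f ∧ f 0 = z₀ ∧ (∀ i, Z (f i)) ∧ ∀ i, W (f i) (f (i + 1)) := by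
  let N : A.N → A.N → Prop := fun s t => (Z t ∧ W s t) ∧ ∀ t', t' < t → ¬ (Z t' ∧ W s t')
  have hN : Sig0 fun v : ℕ → A.N => N (v 0) (v 1) := by
    have h₁ : Sig0 fun v : ℕ → A.N => Z (v 1) := hZ.subst₁ (.var 1)
    have h₂ : Sig0 fun v : ℕ → A.N => W (v 1) (v 0) := hW.subst₂ (.var 1) (.var 0)
    infer_instance
  have hN' : Sig0 fun v : ℕ → A.N => N (v 1) (v 0) := hN.subst₂ (.var 1) (.var 0)
  have hNfun : ∀ s t t', N s t → N s t' → t = t' := by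
    intro s t t' ht ht'
    rcases lt_trichotomy t t' with hlt | hlt | hlt
    · exact (ht'.2 t hlt ht.1).elim
    · exact hlt
    · exact (ht.2 t' hlt ht'.1).elim
  have hNtot : ∀ s, Z s → ∃ t, N s t := by
    intro s hs
    have h₁ : Sig0 fun v : ℕ → A.N => W s (v 0) := hW.subst₂ (.const s) (.var 0)
    exact sig_lnp (fun t => Z t ∧ W s t) (h s hs)
  -- `c` codes a function whose restriction to the numbers `≤ k` satisfies the recursion
  let C : A.N → A.N → Prop := fun c k => Entry c 0 z₀ ∧
    (∀ i, i < k → ∃ x, x < c ∧ ∃ y, y < c ∧ Entry c i x ∧ Entry c (i + 1) y ∧ N x y) ∧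
    ∀ i, i < c → ∀ x, x < c → ∀ y, y < c → Entry c i x → Entry c i y → x = y
  have hCdef : Sig0 fun v : ℕ → A.N => C (v 0) (v 1) := inferInstance
  have hCdef' : Sig0 fun v : ℕ → A.N => C (v 0) (v 2) := hCdef.subst₂ (.var 0) (.var 2)
  have hCeq : ∀ {c k i x y}, C c k → Entry c i x → Entry c i y → x = y := fun hc hx hy =>
    hc.2.2 _ hx.lt_left _ hx.lt_right _ hy.lt_right hx hy
  have hCtop : ∀ {c k}, C c k → ∃ y, Entry c k y ∧ Z y := by
    intro c k hc
    rcases eq_zero_or_succ k with rfl | ⟨k, rfl⟩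
    · exact ⟨z₀, hc.1, hz₀⟩
    · obtain ⟨x, -, y, -, -, hy, hxy⟩ := hc.2.1 k (lt_add_one_iff'.2 le_rfl)
      exact ⟨y, hy, hxy.1.1⟩
  have hCuniq : ∀ {c k c' k'}, C c k → C c' k' → ∀ i, i ≤ k → i ≤ k' → ∀ x, x < c → ∀ y, y < c' →
      Entry c i x → Entry c' i y → x = y := by
    intro c k c' k' hc hc'
    refine sig_ind _ (fun _ _ x _ y _ hx hy => ?_) fun i ih hik hik' x _ y _ hx hy => ?_
    · rw [hCeq hc hx hc.1, hCeq hc' hy hc'.1]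
    · obtain ⟨a, ha', b, -, ha, hb, hab⟩ := hc.2.1 i (succ_le_iff'.1 hik)
      obtain ⟨a', ha₂', b', -, ha₂, hb₂, hab₂⟩ := hc'.2.1 i (succ_le_iff'.1 hik')
      rw [hCeq hc hx hb, hCeq hc' hy hb₂]
      obtain rfl := ih (le_self_add.trans hik) (le_self_add.trans hik') a ha' a' ha₂' ha ha₂
      exact hNfun _ _ _ hab hab₂
  have hCex : ∀ k, ∃ c, C c k := by
    refine sig_ind _ ?_ ?_
    · obtain ⟨c, -, hc⟩ := exists_fin (fun z => z = pr 0 z₀) (pr 0 z₀ + 1)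
      have he : ∀ i x, Entry c i x → i = 0 ∧ x = z₀ := fun i x h => pr_inj.1 ((hc _).1 h).2
      refine ⟨c, (hc _).2 ⟨lt_add_one_iff'.2 le_rfl, rfl⟩, fun i hi => (not_lt_zero' i hi).elim,
        fun i _ x _ y _ hx hy => ?_⟩
      rw [(he i x hx).2, (he i y hy).2]
    · rintro k ⟨c, hc⟩
      obtain ⟨y, hy, hyZ⟩ := hCtop hc
      obtain ⟨t, ht⟩ := hNtot y hyZ
      obtain ⟨d, -, hd⟩ := exists_fin (fun z => (InFin z c ∧ ∃ i, ∃ x, z = pr i x ∧ i ≤ k) ∨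
        z = pr (k + 1) t) (c + pr (k + 1) t + 1)
      have he : ∀ i x, Entry d i x ↔ (Entry c i x ∧ i ≤ k) ∨ (i = k + 1 ∧ x = t) := by
        intro i x
        refine (hd _).trans ⟨?_, ?_⟩
        · rintro ⟨-, ⟨h, j, w, hjw, hj⟩ | h⟩
          · exact .inl ⟨h, (pr_inj.1 hjw).1 ▸ hj⟩
          · exact .inr (pr_inj.1 h)
        · rintro (⟨h, hi⟩ | ⟨rfl, rfl⟩)
          · exact ⟨lt_add_one_iff'.2 (h.lt.le.trans le_self_add), .inl ⟨h, i, x, rfl, hi⟩⟩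
          · exact ⟨lt_add_one_iff'.2 le_add_self, .inr rfl⟩
      refine ⟨d, (he _ _).2 (.inl ⟨hc.1, zero_le⟩), fun i hi => ?_, fun i _ x _ y _ hx hy => ?_⟩
      · rcases (lt_add_one_iff'.1 hi).lt_or_eq with hi | rfl
        · obtain ⟨a, -, b, -, ha, hb, hab⟩ := hc.2.1 i hi
          have ha' := (he _ _).2 (.inl ⟨ha, hi.le⟩)
          have hb' := (he _ _).2 (.inl ⟨hb, succ_le_iff'.2 hi⟩)
          exact ⟨a, ha'.lt_right, b, hb'.lt_right, ha', hb', hab⟩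
        · have ha' := (he _ _).2 (.inl ⟨hy, le_rfl⟩)
          have hb' := (he _ _).2 (.inr ⟨rfl, rfl⟩)
          exact ⟨y, ha'.lt_right, t, hb'.lt_right, ha', hb', ht⟩
      · have hk : ¬ k + 1 ≤ k := not_le.2 (lt_add_one_iff'.2 le_rfl)
        rcases (he i x).1 hx with ⟨hx, hi⟩ | ⟨hi, rfl⟩ <;>
          rcases (he i y).1 hy with ⟨hy, hi'⟩ | ⟨hi', rfl⟩
        · exact hCeq hc hx hy
        · exact (hk (hi' ▸ hi)).elim
        · exact (hk (hi ▸ hi')).elim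
        · rfl
  have hR : Sig1 fun v : ℕ → A.N => ∃ c, C c (v 0) ∧ Entry c (v 0) (v 1) := inferInstance
  obtain ⟨F, f, hf, hfC⟩ := exists_graph (fun k x => ∃ c, C c k ∧ Entry c k x)
    (fun k => by
      obtain ⟨c, hc⟩ := hCex k
      obtain ⟨y, hy, -⟩ := hCtop hc
      exact ⟨y, c, hc, hy⟩)
    fun k x y ⟨c, hc, hx⟩ ⟨c', hc', hy⟩ =>
      hCuniq hc hc' k le_rfl le_rfl x hx.lt_right y hy.lt_right hx hy
  refine ⟨F, f, hf, ?_, fun i => ?_, fun i => ?_⟩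
  · obtain ⟨c, hc, h0⟩ := hfC 0
    exact hCeq hc h0 hc.1
  · obtain ⟨c, hc, hi⟩ := hfC i
    obtain ⟨y, hy, hyZ⟩ := hCtop hc
    rwa [hCeq hc hi hy]
  · obtain ⟨c, hc, hi⟩ := hfC i
    obtain ⟨c', hc', hi'⟩ := hfC (i + 1)
    obtain ⟨a, -, b, -, ha, hb, hab⟩ := hc'.2.1 i (lt_add_one_iff'.2 le_rfl)
    rw [hCuniq hc hc' i le_rfl le_self_add _ hi.lt_right a ha.lt_right hi ha, hCeq hc' hi' hb]
    exact hab.1.2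

end

/-! ### From descending sequences of bounded length to `X^ω` -/

section
variable {A : Str} [hA : A.IsArith] [hC : A.HasComp] {X F : A.S} {f : A.N → A.N}

omit hC in
theorem expLt_of_step (hX : LinOrder (fun x => pr x x ∈ X) fun x y => pr x y ∈ X)
    (hf : IsGraph F f) (h : ∀ i, ExpLt (fun x y => pr x y ∈ X) (f (i + 1)) (f i)) {i j : A.N}
    (hij : i < j) : ExpLt (fun x y => pr x y ∈ X) (f j) (f i) := by
  suffices ∀ j, i < j → ∃ x, pr j x ∈ F ∧ ExpLt (fun x y => pr x y ∈ X) x (f i) by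
    obtain ⟨x, hx, hlt⟩ := this j hij
    rwa [(hf j x).1 hx]
  refine sig_ind _ (fun h => (not_lt_zero' _ h).elim) fun j ih hj => ⟨_, hf.mem _, ?_⟩
  rcases (lt_add_one_iff'.1 hj).lt_or_eq with hj | rfl
  · obtain ⟨x, hx, hlt⟩ := ih hj
    obtain rfl := (hf j x).1 hx
    exact (h j).trans hX hlt
  · exact h i

/-- The structure has no sequence of `l`-tuples from `X` that descends lexicographically. -/
def NoDesc (X : A.S) (l : A.N) : Prop :=
  ∀ F f, IsGraph F f → (∀ i, PowDom l (fun x => pr x x ∈ X) (f i)) →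
    (∀ i, ExpLt (fun x y => pr x y ∈ X) (f (i + 1)) (f i)) → False

/-- A failure of transfinite induction along `X^ω` yields a descending sequence. Started at an
element of minimal length among those outside of the given set, it has constant length. -/
theorem WellOrd.exp_of_noDesc (hX : WellOrd (fun x => pr x x ∈ X) fun x y => pr x y ∈ X)
    (h : ∀ l, NoDesc X l) : WellOrd (ExpDom (fun x => pr x x ∈ X) fun x y => pr x y ∈ X)
      (ExpLe (fun x => pr x x ∈ X) fun x y => pr x y ∈ X) := by
  refine ⟨fun Y hY z => ?_, linOrder_exp hX.2⟩
  by_contra hz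
  have hstep : ∀ s, ¬ s ∈ Y → ∃ t, ¬ t ∈ Y ∧ ExpDom (fun x => pr x x ∈ X) (fun x y => pr x y ∈ X) s ∧
      ExpLt (fun x y => pr x y ∈ X) t s := by
    intro s hs
    by_contra! hc
    refine hs (hY s fun t ht => ?_)
    by_contra htY
    exact hc t htY ht.1.2.1 (ht.1.2.2.resolve_left ht.2)
  obtain ⟨l, ⟨s₀, hs₀, hl₀⟩, hmin⟩ := sig_lnp (fun l => ∃ t, ¬ t ∈ Y ∧ IsSeq t l) (by
    obtain ⟨-, -, hd, -⟩ := hstep z hz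
    obtain ⟨l, hl⟩ := hd.1
    exact ⟨l, z, hz, hl⟩)
  obtain ⟨F, f, hf, -, hfZ, hfW⟩ := exists_iteration (fun s => ¬ s ∈ Y ∧ IsSeq s l)
    (fun s t => ExpLt (fun x y => pr x y ∈ X) t s) ⟨hs₀, hl₀⟩ (fun s ⟨hs, hl⟩ => by
      obtain ⟨t, ht, -, hlt⟩ := hstep s hs
      refine ⟨t, ⟨ht, ?_⟩, hlt⟩
      obtain ⟨k, l', hk, hl', hkl⟩ := hlt
      obtain rfl := hl.length_unique hl'
      rcases hkl with hkl | ⟨rfl, -⟩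
      · exact (hmin k hkl ⟨t, ht, hk⟩).elim
      · exact hk)
  refine h l F f hf (fun i => ⟨(hfZ i).2, ?_⟩) hfW
  obtain ⟨-, -, hd, -⟩ := hstep _ (hfZ i).1
  exact hd.2.1

/-! ### The implication from products to powers -/

/-- A bad sequence in a linear order descends, so well-orders are well quasi-orders. -/
theorem WellOrd.wqo (hX : WellOrd (fun x => pr x x ∈ X) fun x y => pr x y ∈ X) :
    Wqo (fun x => pr x x ∈ X) fun x y => pr x y ∈ X := by
  refine ⟨hX.2.1, fun F hF => ?_⟩
  obtain ⟨f, hf, hD⟩ := hF.exists_fun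
  by_contra hbad
  have hbad' : ∀ i j, i < j → ¬ pr (f i) (f j) ∈ X := fun i j hij h =>
    hbad ⟨i, j, f i, f j, hij, hf.mem i, hf.mem j, h⟩
  refine hX.not_descending hf (fun i j hij => ?_) fun i =>
    ⟨i + 1, lt_add_one_iff'.2 le_rfl, fun h => hbad' i (i + 1) (lt_add_one_iff'.2 le_rfl) ?_⟩
  · rcases hij.lt_or_eq with hij | rfl
    · exact (hX.2.2.2 _ _ (hD i) (hD j)).resolve_left (hbad' i j hij)
    · exact hD i
  · rw [h]; exact hD i

omit hC in
/-- The componentwise order is contained in the lexicographic order, so a lexicographically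
descending sequence of tuples is bad. -/
theorem noDesc_of_wqo {l : A.N} (hX : WellOrd (fun x => pr x x ∈ X) fun x y => pr x y ∈ X)
    (h : Wqo (PowDom l fun x => pr x x ∈ X)
      (PowLe l (fun x => pr x x ∈ X) fun x y => pr x y ∈ X)) : NoDesc X l := by
  intro F f hf hD hstep
  obtain ⟨i, j, s, t, hij, hs, ht, hle⟩ := h.2 F (hf.seqIn hD)
  obtain rfl := (hf i s).1 hs
  obtain rfl := (hf j t).1 ht
  rcases (expLt_iff (hD j).1 (hD i).1).1 (expLt_of_step hX.2 hf hstep hij) with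
    h | ⟨-, p, x, y, hx, hy, hxy, -⟩
  · exact lt_irrefl _ h
  · exact hxy.2 (hX.2.2.1 x y hxy.1 (hle.2.2 p y x hy hx))

end

theorem provable_WQPprod_imp_WOPexp : Provable RCA₀ (.imp WQPprod WOPexp) := by
  refine provable_of_models fun A hA v ρ => ?_
  have : Nonempty A.S := ⟨ρ 0⟩
  have := hA.isArith
  have := hA.hasComp
  intro h
  rw [sat_WQPprod] at h
  rw [sat_WOPexp]
  intro X hX
  obtain ⟨Q, hQ⟩ := exists_set fun x : A.N => pr x x ∈ X
  refine hX.exp_of_noDesc fun l => noDesc_of_wqo hX ?_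
  have hQ' : (fun x => x ∈ Q) = fun x : A.N => pr x x ∈ X := funext fun x => propext (hQ x)
  have := h l Q X
  rw [hQ'] at this
  exact this hX.wqo


/-! ### Powers of well-orders under full induction -/

section
variable {A : Str} [hA : A.IsArith] [hC : A.HasComp] {X : A.S}

/-- With induction for arbitrary predicates, a lexicographically descending sequence of tuples is
impossible: one place after the other becomes constant. -/
theorem noDesc_of_induction (hind : ∀ P : A.N → Prop, P 0 → (∀ x, P x → P (x + 1)) → ∀ x, P x)
    (hX : WellOrd (fun x => pr x x ∈ X) fun x y => pr x y ∈ X) (l : A.N) : NoDesc X l := by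
  intro F f hf hD hstep
  have key : ∀ p, p ≤ l → ∃ k, ∀ i, k ≤ i → ∀ j < p, ∀ x, Entry (f i) j x ↔ Entry (f k) j x := by
    refine hind _ (fun _ => ⟨0, fun _ _ j hj => (not_lt_zero' j hj).elim⟩) fun p ih hp => ?_
    have hpl : p < l := succ_le_iff'.1 hp
    obtain ⟨k, hk⟩ := ih hpl.le
    -- the entries at place `p` descend as soon as those at all earlier places are constant
    obtain ⟨G, g, hG, hg⟩ := exists_graph (fun i x => ∃ s, pr (k + i) s ∈ F ∧ Entry s p x)
      (fun i => by
        obtain ⟨x, hx⟩ := (hD (k + i)).1.2.2.1 p hpl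
        exact ⟨x, _, hf.mem _, hx⟩)
      fun i x y ⟨s, hs, hx⟩ ⟨t, ht, hy⟩ => by
        obtain rfl := (hf _ s).1 hs
        obtain rfl := (hf _ t).1 ht
        exact (hD _).1.eq hx hy
    have hg' : ∀ i, Entry (f (k + i)) p (g i) := by
      intro i
      obtain ⟨s, hs, h⟩ := hg i
      rwa [(hf _ s).1 hs]
    have hrefl : ∀ i, pr (g i) (g i) ∈ X := fun i => (hD _).2 p _ (hg' i)
    have hdesc : ∀ i j, i ≤ j → pr (g j) (g i) ∈ X := by
      intro i j hij
      rcases hij.lt_or_eq with hij | rfl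
      · rcases (expLt_iff (hD _).1 (hD _).1).1 (expLt_of_step hX.2 hf hstep
          (add_lt_add_right hij k)) with h | ⟨-, q, x, y, hx, hy, hxy, hq⟩
        · exact (lt_irrefl _ h).elim
        · rcases lt_trichotomy q p with h | rfl | h
          · have hx' := (hk (k + j) le_self_add q h x).1 hx
            have hy' := (hk (k + i) le_self_add q h y).1 hy
            exact (hxy.2 ((hD _).1.eq hx' hy')).elim
          · rw [(hD _).1.eq (hg' j) hx, (hD _).1.eq (hg' i) hy]
            exact hxy.1
          · rw [(hD _).1.eq (hg' i) ((hq p h _).1 (hg' j))]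
            exact hrefl j
      · exact hrefl i
    have hconst : ∃ i, ∀ j, i < j → g j = g i := by
      by_contra! hc
      exact hX.not_descending hG hdesc hc
    obtain ⟨m, hm⟩ := hconst
    refine ⟨k + m, fun i hi j hj x => ?_⟩
    rcases (lt_add_one_iff'.1 hj).lt_or_eq with hj | rfl
    · rw [hk i (le_self_add.trans hi) j hj, hk (k + m) le_self_add j hj]
    · obtain ⟨a, rfl⟩ := exists_add_of_le hi
      have hga : g (m + a) = g m := by
        rcases eq_zero_or_succ a with rfl | ⟨a, rfl⟩
        · rw [add_zero]
        · exact hm _ (by rw [← add_assoc]; exact lt_add_one_iff'.2 le_self_add)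
      have h₁ := hg' (m + a)
      rw [hga, ← add_assoc] at h₁
      exact ⟨fun h => (hD _).1.eq h₁ h ▸ hg' m, fun h => (hD _).1.eq (hg' m) h ▸ h₁⟩
  obtain ⟨k, hk⟩ := key l le_rfl
  rcases (expLt_iff (hD _).1 (hD _).1).1 (hstep k) with h | ⟨-, q, x, y, hx, hy, hxy, -⟩
  · exact lt_irrefl _ h
  · exact hxy.2 ((hD _).1.eq ((hk _ le_self_add q ((hD _).1.lt hx) x).1 hx) hy)

theorem sat_WOPexp_of_induction
    (hind : ∀ P : A.N → Prop, P 0 → (∀ x, P x → P (x + 1)) → ∀ x, P x)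
    (v : ℕ → A.N) (ρ : ℕ → A.S) : WOPexp.sat A v ρ :=
  (sat_WOPexp v ρ).2 fun _ hX => hX.exp_of_noDesc (noDesc_of_induction hind hX)

end

/-! ### Structures with the standard numbers -/

/-- The structure with the standard natural numbers and the given sets. -/
def natStr (S : Type) (mem : ℕ → S → Prop) : Str where
  N := ℕ
  S := S
  zero := 0
  one := 1
  add := (· + ·)
  mul := (· * ·)
  lt := (· < ·)
  mem := mem

instance {S : Type} [h : Nonempty S] {mem : ℕ → S → Prop} : (natStr S mem).IsArith where
  nonempty := h
  succ_ne_zero := Nat.succ_ne_zero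
  succ_inj _ _ := Nat.succ.inj
  add_zero := Nat.add_zero
  add_succ _ _ := rfl
  mul_zero := Nat.mul_zero
  mul_succ _ _ := rfl
  not_lt_zero := Nat.not_lt_zero
  lt_succ _ _ := Nat.lt_succ_iff_lt_or_eq
  ind _ _ h0 hs x := Nat.rec h0 hs x

/-- The standard numbers with a single set. -/
def oneSet (R : Set ℕ) : Str := natStr Unit fun n _ => n ∈ R

/-- The sets that are `Δ⁰₁` in `R`. -/
def deltaSets (R : Set ℕ) : Set (Set ℕ) :=
  {X | Sig1 (A := oneSet R) (fun v => v 0 ∈ X) ∧ Pi1 (A := oneSet R) fun v => v 0 ∈ X}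

/-- The standard numbers with the sets that are `Δ⁰₁` in `R`. -/
def deltaStr (R : Set ℕ) : Str := natStr (deltaSets R) fun n X => n ∈ X.1

section
variable {R : Set ℕ}

instance : (oneSet R).IsArith := inferInstanceAs (natStr Unit _).IsArith

theorem self_mem_deltaSets : R ∈ deltaSets R := by
  have : Sig0 (A := oneSet R) fun v => v 0 ∈ R := Sig0.mem' (A := oneSet R) (.var 0) ()
  exact ⟨inferInstance, inferInstance⟩

theorem univ_mem_deltaSets : Set.univ ∈ deltaSets R := by
  have : Sig0 (A := oneSet R) fun v => v 0 ∈ (Set.univ : Set ℕ) :=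
    (Sig0.eq' (.var 0) (.var 0) : Sig0 (A := oneSet R) fun v => v 0 = v 0).congr
      fun v => iff_of_true (Set.mem_univ (α := ℕ) (v 0)) rfl
  exact ⟨inferInstance, inferInstance⟩

instance : Nonempty (deltaSets R) := ⟨⟨R, self_mem_deltaSets⟩⟩

instance : (deltaStr R).IsArith := inferInstanceAs (natStr (deltaSets R) _).IsArith

/-- The value of a term in `deltaStr R`, as a number of `oneSet R`; both structures have the standard
numbers. -/
def deltaEval (R : Set ℕ) (t : Tm) (v : ℕ → (oneSet R).N) : (oneSet R).N := t.eval (deltaStr R) v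

/-- Satisfaction in `deltaStr R`, as a predicate on the numbers of `oneSet R`. -/
def deltaSat (φ : Fm) (ρ : ℕ → (deltaStr R).S) (v : ℕ → (oneSet R).N) : Prop :=
  φ.sat (deltaStr R) v ρ

instance tDef_deltaEval (t : Tm) : TDef (deltaEval R t) := by
  induction t with
  | var i => exact .var i
  | zero => exact .const (A := oneSet R) (0 : ℕ)
  | one => exact .const (A := oneSet R) (1 : ℕ)
  | add s t hs ht => exact hs.add' ht
  | mul s t hs ht => exact hs.mul' ht

/-- `Σ⁰₀` formulas with parameters that are `Δ⁰₁` in `R` are `Δ⁰₁` in `R`. -/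
theorem IsSigma00.delta {θ : Fm} (h : IsSigma00 θ) (ρ : ℕ → (deltaStr R).S) :
    Sig1 (deltaSat θ ρ) ∧ Pi1 (deltaSat θ ρ) := by
  induction h with
  | eq s t =>
    have : Sig0 fun v => deltaEval R s v = deltaEval R t v :=
      .eq' (tDef_deltaEval s) (tDef_deltaEval t)
    exact ⟨this.sig1, ⟨this.not'.sig1⟩⟩
  | lt s t =>
    have : Sig0 fun v => (oneSet R).lt (deltaEval R s v) (deltaEval R t v) :=
      .lt' (tDef_deltaEval s) (tDef_deltaEval t)
    exact ⟨this.sig1, ⟨this.not'.sig1⟩⟩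
  | mem t X =>
    exact ⟨Sig1.subst₁ (A := oneSet R) (R := fun x => x ∈ (ρ X).1) (ρ X).2.1 (tDef_deltaEval t),
      ⟨Sig1.subst₁ (A := oneSet R) (R := fun x => ¬ x ∈ (ρ X).1) (ρ X).2.2.out
        (tDef_deltaEval t)⟩⟩
  | fal => exact ⟨inferInstanceAs (Sig1 (A := oneSet R) fun _ => False),
      inferInstanceAs (Pi1 (A := oneSet R) fun _ => False)⟩
  | @imp φ ψ _ _ h₁ h₂ =>
    obtain ⟨_, _⟩ := h₁
    obtain ⟨_, _⟩ := h₂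
    exact ⟨inferInstanceAs (Sig1 fun v => deltaSat φ ρ v → deltaSat ψ ρ v),
      inferInstanceAs (Pi1 fun v => deltaSat φ ρ v → deltaSat ψ ρ v)⟩
  | @ball t φ _ ih =>
    obtain ⟨h₁, h₂⟩ := ih
    have e : ∀ v, deltaSat (Fm.allN (.imp (.lt (.var 0) t.lift) φ)) ρ v ↔
        ∀ x, x < deltaEval R t v → deltaSat φ ρ (scons x v) := by
      intro v
      refine forall_congr' fun x => imp_congr (iff_of_eq ?_) Iff.rfl
      exact congrArg ((oneSet R).lt x) (Tm.eval_lift (deltaStr R) x v t)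
    have : Sig1 fun v : ℕ → (oneSet R).N => deltaSat φ ρ (scons (v 0) fun i => v (i + 1)) :=
      h₁.congr fun v => by rw [scons_head_tail]
    have : Pi1 fun v : ℕ → (oneSet R).N => deltaSat φ ρ (scons (v 0) fun i => v (i + 1)) :=
      ⟨h₂.out.congr fun v => by rw [scons_head_tail]⟩
    have h₃ : Sig1 fun v => ∀ x, x < deltaEval R t v → deltaSat φ ρ (scons x v) :=
      inferInstance
    have : TDef fun v : ℕ → (oneSet R).N => deltaEval R t fun i => v (i + 1) :=
      (tDef_deltaEval t).rename _
    have h₄ : Pi1 fun v => ∀ x, x < deltaEval R t v → deltaSat φ ρ (scons x v) :=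
      inferInstance
    exact ⟨h₃.congr e, ⟨h₄.out.congr fun v => not_congr (e v)⟩⟩

instance : (deltaStr R).HasComp where
  comp P hP hP' := by
    -- set parameters of `deltaStr R` are eliminated by their definitions in `oneSet R`
    have tr : ∀ Q : (ℕ → ℕ) → Prop, Sig1 (A := deltaStr R) Q → Sig1 (A := oneSet R) Q := by
      intro Q hQ
      obtain ⟨Q', hQ', h⟩ := hQ.out
      obtain ⟨θ, p, ρ, hθ, hr⟩ := hQ'.out
      have h₁ : Sig1 (A := oneSet R) Q' := by
        have key : ∀ q : ℕ → (oneSet R).N, Sig1 fun v => deltaSat θ ρ (mix v q) := by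
          intro q
          have hg : ∀ i, TDef (mix (fun i v => v i) (fun i _ => q i) i) := by
            intro i
            obtain ⟨i, rfl | rfl⟩ := i.even_or_odd'
            · rw [mix_even]
              exact .var i
            · rw [mix_odd]
              exact .const (q i)
          refine ((hθ.delta ρ).1.subst hg).congr fun v => ?_
          rw [map_mix (fun f : (ℕ → (oneSet R).N) → (oneSet R).N => f v)]
        exact (key p).congr hr
      obtain ⟨Q'', hQ'', h''⟩ := h₁.out
      exact hQ''.exists₂.congr fun v => (h v).trans (exists_congr fun x => h'' _)
    exact ⟨⟨{x | P x}, tr _ hP, ⟨tr _ hP'.out⟩⟩, fun x => Iff.rfl⟩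

end

/-! ### A generic sequence of rationals -/

/-- A condition on sequences of rationals, met by those that agree with `val` below `len` and stay between `lo` and `hi` from there on. -/
structure Cond where
  val : ℕ → ℚ
  len : ℕ
  lo : ℚ
  hi : ℚ
  lo_lt_hi : lo < hi

/-- The sequence `f` obeys the condition `c` at the place `i`. -/
def Cond.At (c : Cond) (f : ℕ → ℚ) (i : ℕ) : Prop :=
  (i < c.len → f i = c.val i) ∧ (c.len ≤ i → c.lo < f i ∧ f i < c.hi)

theorem Cond.exists_at (c : Cond) : ∃ f, ∀ i, c.At f i := by
  obtain ⟨q, hq⟩ := exists_between c.lo_lt_hi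
  refine ⟨fun i => if i < c.len then c.val i else q, fun i => ⟨fun h => if_pos h, fun h => ?_⟩⟩
  simp only [if_neg (not_lt.2 h)]
  exact hq

/-- The predicate `S` is bounded, or it has some `n` such that `f n` is in the relation `r` with all
but finitely many values of `f`. -/
def Meets (r : ℚ → ℚ → Prop) (f : ℕ → ℚ) (S : ℕ → Prop) : Prop :=
  (∃ b, ∀ n, S n → n < b) ∨ ∃ n, S n ∧ ∃ m, ∀ k, m ≤ k → r (f n) (f k)

/-- Each element of `V f` depends on finitely many values of `f` only. -/
def IsOpenFamily (V : (ℕ → ℚ) → ℕ → Prop) : Prop :=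
  ∀ f n, V f n → ∃ m, ∀ f' : ℕ → ℚ, (∀ k < m, f k = f' k) → V f' n

/-- Every condition has an extension that forces `Meets r`. The hypothesis on `r` says that the values
to come can be kept in the relation `r` to any value allowed by the condition. If some sequence that
obeys `c` has an `n` beyond `c.len` in its set, enough of it is fixed to secure this `n`. Otherwise
`c.len` bounds the set of each sequence that obeys `c`. -/
theorem Cond.exists_meets (c : Cond) {V : (ℕ → ℚ) → ℕ → Prop} (hV : IsOpenFamily V)
    {r : ℚ → ℚ → Prop} (hr : ∀ a b q : ℚ, a < q → q < b → ∃ a' b', a ≤ a' ∧ b' ≤ b ∧ a' < b' ∧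
      ∀ x, a' < x → x < b' → r q x) :
    ∃ c' : Cond, c.len < c'.len ∧ (∀ f i, c'.At f i → c.At f i) ∧
      ∀ f, (∀ i, c'.At f i) → Meets r f (V f) := by
  by_cases h : ∃ f, (∀ i, c.At f i) ∧ ∃ n, c.len ≤ n ∧ V f n
  · obtain ⟨f, hf, n, hn, hfn⟩ := h
    obtain ⟨m, hm⟩ := hV f n hfn
    obtain ⟨a, b, ha, hb, hab, hr⟩ := hr _ _ _ ((hf n).2 hn).1 ((hf n).2 hn).2
    have hnN : n < max m (n + 1) := lt_max_of_lt_right n.lt_succ_self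
    refine ⟨⟨f, max m (n + 1), a, b, hab⟩, hn.trans_lt hnN, fun f' i hi => ?_, fun f' hf' => ?_⟩
    · by_cases hiN : i < max m (n + 1)
      · have := hi.1 hiN
        simp only at this
        rw [Cond.At, this]
        exact hf i
      · have := hi.2 (not_lt.1 hiN)
        exact ⟨fun h => (hiN ((h.trans_le hn).trans hnN)).elim,
          fun _ => ⟨ha.trans_lt this.1, this.2.trans_le hb⟩⟩
    · refine .inr ⟨n, hm f' fun k hk => ((hf' k).1 (lt_max_of_lt_left hk)).symm,
        max m (n + 1), fun k hk => ?_⟩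
      rw [(hf' n).1 hnN]
      exact hr _ ((hf' k).2 hk).1 ((hf' k).2 hk).2
  · obtain ⟨f, hf⟩ := c.exists_at
    have hsub : ∀ f' i, Cond.At ⟨f, c.len + 1, c.lo, c.hi, c.lo_lt_hi⟩ f' i → c.At f' i := by
      intro f' i hi
      by_cases hiN : i < c.len + 1
      · have := hi.1 hiN
        simp only at this
        rw [Cond.At, this]
        exact hf i
      · exact ⟨fun h => (hiN (h.trans (Nat.lt_succ_self _))).elim, fun _ => hi.2 (not_lt.1 hiN)⟩
    refine ⟨_, Nat.lt_succ_self _, hsub, fun f' hf' => .inl ⟨c.len, fun n hn => ?_⟩⟩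
    by_contra hlt
    exact h ⟨f', fun i => hsub f' i (hf' i), n, not_lt.1 hlt, hn⟩

/-- For countably many open families there is a sequence of rationals that meets all of them, from
below and from above. -/
theorem exists_generic {ι : Type} [Countable ι] [Nonempty ι] (V : ι → (ℕ → ℚ) → ℕ → Prop)
    (hV : ∀ i, IsOpenFamily (V i)) :
    ∃ f, ∀ i, Meets (· < ·) f (V i f) ∧ Meets (· > ·) f (V i f) := by
  have step : ∀ (i : ι) (c : Cond), ∃ c' : Cond, c.len < c'.len ∧
      (∀ f i, c'.At f i → c.At f i) ∧
      ∀ f, (∀ i, c'.At f i) → Meets (· < ·) f (V i f) ∧ Meets (· > ·) f (V i f) := by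
    intro i c
    obtain ⟨d, hd, hdc, hd'⟩ := c.exists_meets (hV i) (r := (· < ·)) fun a b q ha hb =>
      ⟨q, b, ha.le, le_rfl, hb, fun x hx _ => hx⟩
    obtain ⟨e, he, hed, he'⟩ := d.exists_meets (hV i) (r := (· > ·)) fun a b q ha hb =>
      ⟨a, q, le_rfl, hb.le, ha, fun x _ hx => hx⟩
    exact ⟨e, hd.trans he, fun f i h => hdc f i (hed f i h),
      fun f hf => ⟨hd' f fun i => hed f i (hf i), he' f hf⟩⟩
  choose next hlen hsub hmeets using step
  obtain ⟨e, he⟩ := exists_surjective_nat ι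
  let c : ℕ → Cond := Nat.rec ⟨0, 0, 0, 1, zero_lt_one⟩ fun k c => next (e k) c
  have hck : ∀ k, k ≤ (c k).len := by
    intro k
    induction k with
    | zero => exact Nat.zero_le _
    | succ k ih => exact Nat.succ_le_of_lt (ih.trans_lt (hlen (e k) (c k)))
  have hcc : ∀ k l, k ≤ l → ∀ f i, (c l).At f i → (c k).At f i := by
    intro k l hkl
    induction l, hkl using Nat.le_induction with
    | base => exact fun _ _ h => h
    | succ l _ ih => exact fun f i h => ih f i (hsub (e l) (c l) f i h)
  -- the sequence of the values that are eventually fixed obeys all conditions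
  have hf : ∀ k i, (c k).At (fun i => (c (i + 1)).val i) i := by
    intro k i
    obtain ⟨g, hg⟩ := (c (max k (i + 1))).exists_at
    have h₁ := (hcc _ _ (le_max_right k (i + 1)) g i (hg i)).1 (hck (i + 1))
    have h₂ := hcc _ _ (le_max_left k (i + 1)) g i (hg i)
    rw [Cond.At, h₁] at h₂
    exact h₂
  refine ⟨fun i => (c (i + 1)).val i, fun i => ?_⟩
  obtain ⟨k, rfl⟩ := he i
  exact hmeets (e k) (c k) _ (hf (k + 1))

/-! ### The disjoint union of an order and its reverse -/

/-- The order `x = y ∨ f x < f y`, carried by the even numbers `x + x`, and its reverse, carried by the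
odd numbers `x + x + 1`. -/
def OrderLe (f : ℕ → ℚ) (p q : ℕ) : Prop :=
  (∃ x y, p = x + x ∧ q = y + y ∧ (x = y ∨ f x < f y)) ∨
    ∃ x y, p = x + x + 1 ∧ q = y + y + 1 ∧ (x = y ∨ f y < f x)

theorem OrderLe.refl (f : ℕ → ℚ) (p : ℕ) : OrderLe f p p := by
  obtain ⟨x, rfl | rfl⟩ := p.even_or_odd'
  · exact .inl ⟨x, x, two_mul x, two_mul x, .inl rfl⟩
  · exact .inr ⟨x, x, by omega, by omega, .inl rfl⟩

theorem OrderLe.trans {f : ℕ → ℚ} {p q r : ℕ} (h : OrderLe f p q) (h' : OrderLe f q r) :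
    OrderLe f p r := by
  rcases h with ⟨x, y, rfl, rfl, h⟩ | ⟨x, y, rfl, rfl, h⟩ <;>
    rcases h' with ⟨z, w, hz, rfl, h'⟩ | ⟨z, w, hz, rfl, h'⟩
  · obtain rfl : y = z := by omega
    refine .inl ⟨x, w, rfl, rfl, ?_⟩
    rcases h with rfl | h
    · exact h'
    · rcases h' with rfl | h'
      exacts [.inr h, .inr (h.trans h')]
  · omega
  · omega
  · obtain rfl : y = z := by omega
    refine .inr ⟨x, w, rfl, rfl, ?_⟩
    rcases h with rfl | h
    · exact h'
    · rcases h' with rfl | h'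
      exacts [.inr h, .inr (h'.trans h)]

theorem orderLe_even {f : ℕ → ℚ} {x y : ℕ} : OrderLe f (x + x) (y + y) ↔ x = y ∨ f x < f y := by
  constructor
  · rintro (⟨x', y', hx, hy, h⟩ | ⟨x', y', hx, hy, h⟩)
    · obtain rfl : x = x' := by omega
      obtain rfl : y = y' := by omega
      exact h
    · omega
  · exact fun h => .inl ⟨x, y, rfl, rfl, h⟩

theorem orderLe_odd {f : ℕ → ℚ} {x y : ℕ} :
    OrderLe f (x + x + 1) (y + y + 1) ↔ x = y ∨ f y < f x := by
  constructor
  · rintro (⟨x', y', hx, hy, h⟩ | ⟨x', y', hx, hy, h⟩)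
    · omega
    · obtain rfl : x = x' := by omega
      obtain rfl : y = y' := by omega
      exact h
  · exact fun h => .inr ⟨x, y, rfl, rfl, h⟩

/-- A sequence has a good pair if `f` meets the sets of its even and of its odd values. -/
theorem exists_orderLe {f : ℕ → ℚ} {h : ℕ → ℕ}
    (hE : Meets (· < ·) f fun x => ∃ i, h i = x + x)
    (hO : Meets (· > ·) f fun x => ∃ i, h i = x + x + 1) :
    ∃ i j, i < j ∧ OrderLe f (h i) (h j) := by
  by_contra! hbad
  have hinj : Function.Injective h := by
    intro i j hij
    by_contra hne
    rcases lt_or_gt_of_ne hne with hlt | hlt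
    · exact hbad i j hlt (hij ▸ .refl f _)
    · exact hbad j i hlt (hij ▸ .refl f _)
  have hafter : ∀ i, ∃ b, ∀ j, b ≤ h j → i < j := by
    intro i
    refine ⟨(Finset.range (i + 1)).sup h + 1, fun j hj => ?_⟩
    by_contra hji
    have : h j ≤ (Finset.range (i + 1)).sup h :=
      Finset.le_sup (Finset.mem_range.2 (by omega))
    omega
  -- in the second case of `Meets`, the place of the witness precedes those of all large values
  have hEb : ∃ b, ∀ x, (∃ i, h i = x + x) → x < b := by
    rcases hE with hE | ⟨x, ⟨i, hi⟩, m, hm⟩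
    · exact hE
    · obtain ⟨b, hb⟩ := hafter i
      refine ⟨max m b, fun y ⟨j, hj⟩ => ?_⟩
      by_contra! hy
      refine hbad i j (hb j (by omega)) ?_
      rw [hi, hj]
      exact orderLe_even.2 (.inr (hm y ((le_max_left _ _).trans hy)))
  have hOb : ∃ b, ∀ x, (∃ i, h i = x + x + 1) → x < b := by
    rcases hO with hO | ⟨x, ⟨i, hi⟩, m, hm⟩
    · exact hO
    · obtain ⟨b, hb⟩ := hafter i
      refine ⟨max m b, fun y ⟨j, hj⟩ => ?_⟩
      by_contra! hy
      refine hbad i j (hb j (by omega)) ?_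
      rw [hi, hj]
      exact orderLe_odd.2 (.inr (hm y ((le_max_left _ _).trans hy)))
  obtain ⟨b, hb⟩ := hEb
  obtain ⟨d, hd⟩ := hOb
  refine Set.infinite_range_of_injective hinj ((Set.finite_lt_nat (b + b + d + d)).subset ?_)
  rintro _ ⟨i, rfl⟩
  change h i < _
  obtain ⟨x, hx | hx⟩ := (h i).even_or_odd'
  · have := hb x ⟨i, by omega⟩
    omega
  · have := hd x ⟨i, by omega⟩
    omega


/-! ### Coding the order and the use of a computation -/

/-- The pairing of the standard numbers. -/
def natPair (x y : ℕ) : ℕ := (x + y) * (x + y) + x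

theorem natPair_inj {x y z w : ℕ} : natPair x y = natPair z w ↔ x = z ∧ y = w :=
  pr_inj (A := oneSet ∅)

theorem left_le_natPair (x y : ℕ) : x ≤ natPair x y := Nat.le_add_left _ _

theorem right_le_natPair (x y : ℕ) : y ≤ natPair x y :=
  ((Nat.le_add_left y x).trans (Nat.le_mul_self _)).trans (Nat.le_add_right _ _)

/-- The set of the pairs in relation `OrderLe f`. -/
def orderCode (f : ℕ → ℚ) : Set ℕ := {z | ∃ p q, z = natPair p q ∧ OrderLe f p q}

theorem natPair_mem_orderCode {f : ℕ → ℚ} {p q : ℕ} :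
    natPair p q ∈ orderCode f ↔ OrderLe f p q := by
  constructor
  · rintro ⟨p', q', h, h'⟩
    obtain ⟨rfl, rfl⟩ := natPair_inj.1 h
    exact h'
  · exact fun h => ⟨p, q, rfl, h⟩

theorem mem_orderCode_congr {f f' : ℕ → ℚ} {m : ℕ} (h : ∀ k < m, f k = f' k) {z : ℕ} (hz : z < m)
    (hz' : z ∈ orderCode f) : z ∈ orderCode f' := by
  obtain ⟨p, q, rfl, hpq⟩ := hz'
  have hp := left_le_natPair p q
  have hq := right_le_natPair p q
  rw [natPair_mem_orderCode]
  rcases hpq with ⟨x, y, rfl, rfl, hxy⟩ | ⟨x, y, rfl, rfl, hxy⟩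
  · rw [orderLe_even, ← h x (by omega), ← h y (by omega)]
    exact hxy
  · rw [orderLe_odd, ← h x (by omega), ← h y (by omega)]
    exact hxy

/-- Satisfaction in `oneSet R`. -/
def OneSat (R : Set ℕ) (θ : Fm) (v : ℕ → ℕ) : Prop := θ.sat (oneSet R) v fun _ => ()

theorem eval_oneSet (R R' : Set ℕ) (t : Tm) (v : ℕ → ℕ) :
    t.eval (oneSet R) v = t.eval (oneSet R') v := by
  induction t with
  | var _ => rfl
  | zero => rfl
  | one => rfl
  | add s t hs ht => exact congrArg₂ (fun a b : ℕ => a + b) hs ht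
  | mul s t hs ht => exact congrArg₂ (fun a b : ℕ => a * b) hs ht

/-- A `Σ⁰₀` formula asks finitely many questions to its set parameter. -/
theorem IsSigma00.exists_use {θ : Fm} (h : IsSigma00 θ) (R : Set ℕ) :
    ∀ v : ℕ → ℕ, ∃ m, ∀ R' : Set ℕ, (∀ z < m, z ∈ R ↔ z ∈ R') → (OneSat R θ v ↔ OneSat R' θ v) := by
  induction h with
  | eq s t =>
    refine fun v => ⟨0, fun R' _ => ?_⟩
    exact iff_of_eq (congrArg₂ (fun a b : ℕ => a = b) (eval_oneSet R R' s v) (eval_oneSet R R' t v))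
  | lt s t =>
    refine fun v => ⟨0, fun R' _ => ?_⟩
    exact iff_of_eq (congrArg₂ (fun a b : ℕ => a < b) (eval_oneSet R R' s v) (eval_oneSet R R' t v))
  | mem t X =>
    refine fun v => ⟨Nat.succ (t.eval (oneSet R) v), fun R' hR' => ?_⟩
    refine (hR' _ (Nat.lt_succ_self _)).trans ?_
    exact iff_of_eq (congrArg (fun a : ℕ => a ∈ R') (eval_oneSet R R' t v))
  | fal => exact fun v => ⟨0, fun _ _ => Iff.rfl⟩
  | imp _ _ h₁ h₂ =>
    intro v
    obtain ⟨m, hm⟩ := h₁ v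
    obtain ⟨n, hn⟩ := h₂ v
    exact ⟨max m n, fun R' hR' => imp_congr
      (hm R' fun z hz => hR' z (lt_max_of_lt_left hz))
      (hn R' fun z hz => hR' z (lt_max_of_lt_right hz))⟩
  | @ball t φ _ ih =>
    intro v
    choose m hm using fun x : ℕ => ih (scons x v)
    refine ⟨(Finset.range (t.eval (oneSet R) v)).sup m, fun R' hR' => ?_⟩
    have e : ∀ S : Set ℕ, OneSat S (Fm.allN (.imp (.lt (.var 0) t.lift) φ)) v ↔
        ∀ x : ℕ, Nat.lt x (t.eval (oneSet S) v) → OneSat S φ (scons x v) := fun S =>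
      forall_congr' fun x => imp_congr
        (iff_of_eq (congrArg (Nat.lt x) (Tm.eval_lift (oneSet S) x v t))) Iff.rfl
    rw [e, e, ← eval_oneSet R R' t v]
    refine forall₂_congr fun x hx => hm x R' fun z hz => hR' z (hz.trans_le ?_)
    exact Finset.le_sup (Finset.mem_range.2 hx)

/-- The set of those `n` for which `∃ y, θ(y, n, n, …)` holds of `orderCode f`. It is
empty if `θ` is not `Σ⁰₀`. -/
def Enum (θ : Fm) (f : ℕ → ℚ) (n : ℕ) : Prop :=
  IsSigma00 θ ∧ ∃ y, OneSat (orderCode f) θ (scons y fun _ => n)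

theorem isOpenFamily_enum (θ : Fm) : IsOpenFamily (Enum θ) := by
  rintro f n ⟨hθ, y, hy⟩
  obtain ⟨m, hm⟩ := hθ.exists_use (orderCode f) (scons y fun _ => n)
  refine ⟨m, fun f' hf' => ⟨hθ, y, (hm _ fun z hz => ?_).1 hy⟩⟩
  exact ⟨mem_orderCode_congr hf' hz, mem_orderCode_congr (fun k hk => (hf' k hk).symm) hz⟩

theorem exists_numeral (R : Set ℕ) (n : ℕ) : ∃ t : Tm, ∀ v, t.eval (oneSet R) v = n := by
  induction n with
  | zero => exact ⟨.zero, fun _ => rfl⟩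
  | succ n ih =>
    obtain ⟨t, ht⟩ := ih
    exact ⟨.add t .one, fun v => congrArg Nat.succ (ht v)⟩

/-- Number parameters can be replaced by numerals, so every `Σ⁰₁` set is enumerated by a formula
without them. -/
theorem Sig1.exists_enum {f : ℕ → ℚ} {P : ℕ → Prop}
    (h : Sig1 (A := oneSet (orderCode f)) fun v => P (v 0)) : ∃ θ, Enum θ f = P := by
  obtain ⟨θ, w, ρ, hθ, h⟩ := Sig1.exists_formula (A := oneSet (orderCode f)) h
  choose t ht using fun i => exists_numeral (orderCode f) (w i)
  have e : ∀ u, (fun i => (scons (.var 0) (scons (.var 1) t) i).eval (oneSet (orderCode f)) u) =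
      scons (u 0) (scons (u 1) w) := by
    intro u
    rw [map_scons, map_scons]
    simp only [ht]
    rfl
  refine ⟨θ.subst (scons (.var 0) (scons (.var 1) t)) id, funext fun n => propext ?_⟩
  refine ((and_iff_right (hθ.subst _ _)).trans (exists_congr fun y => ?_)).trans
    (Fm.sat_exN.symm.trans (h n).symm)
  refine (Fm.sat_subst _ _ _ _ _ _).trans ?_
  exact iff_of_eq (congrArg (fun u => θ.sat (oneSet (orderCode f)) u ρ) (e (scons y fun _ => n)))

/-- There is a sequence `f` that meets, from below and from above, every set that is `Σ⁰₁` in the order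
given by `f`. -/
theorem exists_generic_order : ∃ f : ℕ → ℚ, ∀ P : ℕ → Prop,
    Sig1 (A := oneSet (orderCode f)) (fun v => P (v 0)) →
      Meets (· < ·) f P ∧ Meets (· > ·) f P := by
  obtain ⟨f, hf⟩ := exists_generic Enum isOpenFamily_enum
  refine ⟨f, fun P hP => ?_⟩
  obtain ⟨θ, rfl⟩ := hP.exists_enum
  exact hf θ


/-! ### Failure of the product principle -/

section
variable {A : Str} [hA : A.IsArith]

theorem lt_two_iff {i : A.N} : i < 1 + 1 ↔ i = 0 ∨ i = 1 := by
  rw [lt_add_one_iff', le_iff_lt_or_eq, ← zero_add (1 : A.N), lt_add_one_iff', nonpos_iff_eq_zero]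

/-- The sequence of the pairs `⟨2k, 2k + 1⟩` is a set. -/
theorem exists_pairs [A.HasComp] : ∃ (F : A.S) (s : A.N → A.N), IsGraph F s ∧ ∀ k,
    IsSeq (s k) (1 + 1) ∧ Entry (s k) 0 (k + k) ∧ Entry (s k) 1 (k + k + 1) := by
  refine exists_graph (fun k s => IsSeq s (1 + 1) ∧ Entry s 0 (k + k) ∧ Entry s 1 (k + k + 1))
    (fun k => ?_) fun k s t ⟨hs, hs₀, hs₁⟩ ⟨ht, ht₀, ht₁⟩ => hs.ext ht fun i x y hx hy => ?_
  · obtain ⟨s, hs, h⟩ := exists_fin (fun z => z = pr 0 (k + k) ∨ z = pr 1 (k + k + 1))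
      (pr 0 (k + k) + pr 1 (k + k + 1) + 1)
    have h' : ∀ i x, Entry s i x ↔ i = 0 ∧ x = k + k ∨ i = 1 ∧ x = k + k + 1 := by
      intro i x
      rw [Entry, h, pr_inj, pr_inj, and_iff_right_iff_imp, lt_add_one_iff']
      rintro (⟨rfl, rfl⟩ | ⟨rfl, rfl⟩)
      exacts [le_self_add, le_add_self]
    have h₀ : Entry s 0 (k + k) := (h' _ _).2 (.inl ⟨rfl, rfl⟩)
    have h₁ : Entry s 1 (k + k + 1) := (h' _ _).2 (.inr ⟨rfl, rfl⟩)
    refine ⟨s, ⟨hs, fun z hz => ?_, fun i hi => ?_, fun i x y hx hy => ?_⟩, h₀, h₁⟩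
    · rcases ((h z).1 hz).2 with rfl | rfl
      exacts [⟨_, _, lt_two_iff.2 (.inl rfl), rfl⟩, ⟨_, _, lt_two_iff.2 (.inr rfl), rfl⟩]
    · rcases lt_two_iff.1 hi with rfl | rfl
      exacts [⟨_, h₀⟩, ⟨_, h₁⟩]
    · rcases (h' _ _).1 hx with ⟨rfl, rfl⟩ | ⟨rfl, rfl⟩ <;>
        rcases (h' _ _).1 hy with ⟨hi, rfl⟩ | ⟨hi, rfl⟩
      exacts [rfl, (zero_ne_one hi).elim, (one_ne_zero hi).elim, rfl]
  · rcases lt_two_iff.1 (hs.lt hx) with rfl | rfl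
    · exact (hs.eq hx hs₀).trans (ht.eq ht₀ hy)
    · exact (hs.eq hx hs₁).trans (ht.eq ht₁ hy)

end

section
variable {f : ℕ → ℚ}

/-- A sequence is `Δ⁰₁` in the coded order, so genericity applies to the sets of its even and of its
odd values. -/
theorem wqo_generic (hf : ∀ P : ℕ → Prop, Sig1 (A := oneSet (orderCode f)) (fun v => P (v 0)) →
      Meets (· < ·) f P ∧ Meets (· > ·) f P)
    (Q R : (deltaStr (orderCode f)).S) (hQ : Q.1 = Set.univ) (hR : R.1 = orderCode f) :
    Wqo (A := deltaStr (orderCode f)) (fun x => x ∈ Q) fun x y => pr x y ∈ R := by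
  have hR' : ∀ x y : (deltaStr (orderCode f)).N, pr x y ∈ R ↔ OrderLe f x y := fun x y =>
    (iff_of_eq (congrArg (fun S : Set ℕ => natPair x y ∈ S) hR)).trans natPair_mem_orderCode
  have hQ' : ∀ x : (deltaStr (orderCode f)).N, x ∈ Q := fun x =>
    (iff_of_eq (congrArg (fun S : Set ℕ => x ∈ S) hQ)).2 trivial
  refine ⟨⟨fun x y _ => ⟨hQ' x, hQ' y⟩, fun x _ => (hR' x x).2 (.refl f x),
    fun x y z h h' => (hR' x z).2 (((hR' x y).1 h).trans ((hR' y z).1 h'))⟩, fun F hF => ?_⟩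
  obtain ⟨h, hh, -⟩ := hF.exists_fun
  let P : (oneSet (orderCode f)).N → Prop := fun z => Set.Mem F.1 z
  -- `g = 2x` and `g = 2x + 1` give the sets of indices that the sequence hits in the two copies
  have hval : ∀ g : (ℕ → (oneSet (orderCode f)).N) → (oneSet (orderCode f)).N, TDef g →
      Sig1 fun v => ∃ i : (oneSet (orderCode f)).N, P (pr i (g v)) := by
    intro g hg
    have : TDef fun v : ℕ → (oneSet (orderCode f)).N => g fun i => v (i + 1) := hg.rename _
    have : Sig1 fun v : ℕ → (oneSet (orderCode f)).N => P (pr (v 0) (g fun i => v (i + 1))) :=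
      Sig1.subst₁ (R := P) F.2.1 inferInstance
    infer_instance
  have hE := (hf (fun x => ∃ i, natPair i (x + x) ∈ F.1)
    (hval (fun v => v 0 + v 0) inferInstance)).1
  have hO := (hf (fun x => ∃ i, natPair i (x + x + 1) ∈ F.1)
    (hval (fun v => v 0 + v 0 + 1) inferInstance)).2
  have hF' : ∀ i x, natPair i x ∈ F.1 ↔ h i = x := hh
  simp only [hF'] at hE hO
  obtain ⟨i, j, hij, hle⟩ := exists_orderLe hE hO
  exact ⟨i, j, h i, h j, hij, hh.mem i, hh.mem j, (hR' _ _).2 hle⟩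

/-- The sequence `⟨2k, 2k + 1⟩` is bad: a good pair compares `f` in both directions. -/
theorem not_wqo_square (Q R : (deltaStr (orderCode f)).S) (hQ : Q.1 = Set.univ)
    (hR : R.1 = orderCode f) : ¬ Wqo (A := deltaStr (orderCode f)) (PowDom (1 + 1) fun x => x ∈ Q)
      (PowLe (1 + 1) (fun x => x ∈ Q) fun x y => pr x y ∈ R) := by
  intro hW
  obtain ⟨F, s, hF, hs⟩ := exists_pairs (A := deltaStr (orderCode f))
  obtain ⟨i, j, x, y, hij, hx, hy, hxy⟩ := hW.2 F (hF.seqIn fun k => ⟨(hs k).1, fun _ x _ =>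
    (iff_of_eq (congrArg (fun S : Set ℕ => x ∈ S) hQ)).2 trivial⟩)
  obtain rfl := (hF i x).1 hx
  obtain rfl := (hF j y).1 hy
  have h₀ := hxy.2.2 _ _ _ (hs i).2.1 (hs j).2.1
  have h₁ := hxy.2.2 _ _ _ (hs i).2.2 (hs j).2.2
  have hR' : ∀ x y : (deltaStr (orderCode f)).N, pr x y ∈ R ↔ OrderLe f x y := fun x y =>
    (iff_of_eq (congrArg (fun S : Set ℕ => natPair x y ∈ S) hR)).trans natPair_mem_orderCode
  have hne : ¬ i = j := hij.ne
  exact lt_asymm ((orderLe_even.1 ((hR' _ _).1 h₀)).resolve_left hne)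
    ((orderLe_odd.1 ((hR' _ _).1 h₁)).resolve_left hne)

end

theorem not_provable_WOPexp_imp_WQPprod : ¬ Provable RCA₀ (.imp WOPexp WQPprod) := by
  intro hd
  obtain ⟨f, hf⟩ := exists_generic_order
  let Q : (deltaStr (orderCode f)).S := ⟨Set.univ, univ_mem_deltaSets⟩
  let R : (deltaStr (orderCode f)).S := ⟨orderCode f, self_mem_deltaSets⟩
  let v : ℕ → (deltaStr (orderCode f)).N := fun _ => 0
  have h := Deriv.sound Str.models_of_isArith hd v (fun _ => Q) (by simp)
  have hWOP : WOPexp.sat (deltaStr (orderCode f)) v fun _ => Q :=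
    sat_WOPexp_of_induction (fun P h0 hs x => Nat.rec (motive := P) h0 hs x) _ _
  exact not_wqo_square Q R rfl rfl
    ((sat_WQPprod _ _).1 (h hWOP) (1 + 1) Q R (wqo_generic hf Q R rfl rfl))

end SOA

theorem mainTheorem9 :
    SOA.Provable SOA.RCA₀ (SOA.Fm.imp SOA.WQPprod SOA.WOPexp) ∧
      ¬ SOA.Provable SOA.RCA₀ (SOA.Fm.imp SOA.WOPexp SOA.WQPprod) :=
  ⟨SOA.provable_WQPprod_imp_WOPexp, SOA.not_provable_WOPexp_imp_WQPprod⟩
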